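/- **Model.** An economy consists of a horizon $T\in\mathbb N$; a finite set $\mathcal L$ of locations with travel times $\delta(a,b)\in\mathbb N$, $\delta(a,b)\ge 1$, $\delta(a,a)=1$; the feasible trips $\mathcal T=\{(a,b,t): a,b\in\mathcal L,\ t\in\mathbb{N},\ t+\delta(a,b)\le T\}$ with costs $c_{a,b,t}\ge 0$; costs $\kappa_\Delta\ge0$ ($0\le \Delta\le T$, $\kappa_0=0$) of exiting $\Delta$ periods before time $T$; a finite set $\mathcal D$ of drivers and a finite set $\mathcal R$ of riders. Driver $i$ has an entrance status $e_i\in\{0,1\}$ ($1$ if she has already entered), an entrance location $\ell_i$ and time $\underline\tau_i\le T$, and an exit time $\overline\tau_i\ge T$ with $\underline\tau_i<\overline\tau_i$. Rider $j$ requests one trip $(o_j,d_j,\tau_j)\in\mathcal T$ and has value $v_j\ge0$ for it. A feasible path of driver $i$ is a finite sequence of trips in $\mathcal T$, the first starting at $(\ell_i,\underline\tau_i)$ and each later one where and when the previous one ends. The empty path costs $0$ if $e_i=0$ (not entering) and $\kappa_{T-\underline\tau_i}$ if $e_i=1$ (exiting at once); a non-empty path costs the sum of its trip costs plus $\kappa_\Delta$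 if it ends at time $T-\Delta$. Denote by $\lambda_i(P)$ the cost of path $P$ to driver $i$. A feasible action path is a feasible path in which each trip is marked either as a relocation or as carrying a rider who requests that very trip. A dispatch $(x,\tilde z)$ consists of a feasible action path $\tilde z_i$ for every driver and of $x_j\in\{0,1\}$, where $x_j$ is the number of drivers $i$ whose $\tilde z_i$ carries rider $j$. Its welfare is $\sum_j x_jv_j-\sum_i\lambda_i(\tilde z_i)$; it is welfare-optimal if no dispatch has greater welfare. A plan is a dispatch together with payments $q_j$ by the riders and payments $\hat q_{i,t}$ to the drivers at times $t=0,\dots,T$. Put $\hat q_i=\sum_{t=0}^T\hat q_{i,t}$, and let $\pi_i=\hat q_i-\lambda_i(\tilde z_i)$ be the utility of driver $i$. Under anonymous trip prices $p=(p_{a,b,t})_{(a,b,t)\in\mathcal T}$, $p_{a,b,t}\in\mathbb R$, each rider $j$ pays $q_j=x_jp_{o_j,d_j,\tau_j}$, and each driver is paid $p_{a,b,t}$ at time $t$ for each trip $(a,b,t)$ on which she carries a rider, and nothing else. The plan $(x,\tilde z,p)$ is a competitive equilibrium (CE) if for every rider $j$, $v_j>p_{o_j,d_j,\tau_j}$ implies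 $x_j=1$ and $x_j=1$ implies $v_j\ge p_{o_j,d_j,\tau_j}$, and for every driver $i$, $\pi_i=\max_P\{\sum_{(a,b,t)\in P}\max(p_{a,b,t},0)-\lambda_i(P)\}$ over all feasible paths $P$ of $i$. **Lemma (Welfare Theorem).** 1. A dispatch $(x,\tilde z)$ is welfare-optimal if and only if there exist anonymous trip prices $p$ such that $(x,\tilde z,p)$ is a CE. 2. In every economy there exists a welfare-optimal dispatch with prices that make it a CE. 3. Such a plan can be computed efficiently: there are one program for a random access machine with natural-number and real-number memory, whose only operations on data are addition, subtraction and comparison at unit cost (the only real constant being $0$), and one polynomial $B$, such that for every economy the program, given the data of the economy, halts after at most $B(|\mathcal L|+|\mathcal D|+|\mathcal R|+T)$ steps and outputs a welfare-optimal dispatch $(x,\tilde z)$ together with trip prices $p$ for which $(x,\tilde z,p)$ is a CE. 4. Every CE plan $(x,\tilde z,p)$ is strictly budget balanced ($\sum_jq_j=\sum_i\hat q_i$), individually rational for riders ($x_jv_j\ge q_j$ for all $j$) and for drivers ($\pi_i\ge0$ for all $i$ with $e_i=0$), envy-free for riders ($x_jv_j-q_j\ge x_{j'}v_j-q_{j'}$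 whenever $j,j'$ request the same trip) and envy-free for drivers ($\pi_i=\pi_{i'}$ whenever $i,i'$ have the same entrance time, location and status). -/

import Mathlib

namespace Rideshare

/-- A trip `(a, b, t)`: origin, destination and starting time. -/
structure Trip (Loc : Type*) where
  orig : Loc
  dest : Loc
  start : ℕ

/-- A ridesharing economy with locations `Loc`, drivers `Drv` and riders `Rdr`.
Only the values of `tripCost` at trips within the horizon, and of `exitCost` up to the horizon,
are ever used. -/
structure Economy (Loc Drv Rdr : Type*) where
  /-- the length of the planning horizon -/
  T : ℕ
  /-- the time needed to travel between two locations -/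
  dist : Loc → Loc → ℕ
  dist_pos : ∀ a b, 1 ≤ dist a b
  dist_self : ∀ a, dist a a = 1
  /-- the cost of a trip to a driver -/
  tripCost : Trip Loc → ℝ
  tripCost_nonneg : ∀ r : Trip Loc, r.start + dist r.orig r.dest ≤ T → 0 ≤ tripCost r
  /-- the cost of exiting `Δ` periods before the end of the horizon -/
  exitCost : ℕ → ℝ
  exitCost_nonneg : ∀ Δ, Δ ≤ T → 0 ≤ exitCost Δ
  exitCost_zero : exitCost 0 = 0
  /-- whether the driver has already entered the platform -/
  entered : Drv → Bool
  entryLoc : Drv → Loc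
  entryTime : Drv → ℕ
  /-- the time at which the driver plans to leave -/
  exitTime : Drv → ℕ
  entryTime_lt_exitTime : ∀ i, entryTime i < exitTime i
  entryTime_le : ∀ i, entryTime i ≤ T
  /-- drivers stay at least until the end of the horizon -/
  le_exitTime : ∀ i, T ≤ exitTime i
  /-- the trip requested by the rider -/
  request : Rdr → Trip Loc
  request_mem : ∀ j, (request j).start + dist (request j).orig (request j).dest ≤ T
  /-- the rider's value for the requested trip -/
  value : Rdr → ℝ
  value_nonneg : ∀ j, 0 ≤ value j

/-- An action path: the successive trips of a driver, each without a rider (`none`) or with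
rider `j` (`some j`). -/
abbrev ActionPath (Loc Rdr : Type*) := List (Trip Loc × Option Rdr)

/-- A dispatch: rider pick-ups and an action path for every driver. -/
structure Dispatch (Loc Drv Rdr : Type*) where
  x : Rdr → ℕ
  z : Drv → ActionPath Loc Rdr

/-- A plan: a dispatch, the payment made by every rider, and the payment made to every driver
at every time. -/
structure Plan (Loc Drv Rdr : Type*) extends Dispatch Loc Drv Rdr where
  riderPay : Rdr → ℝ
  driverPay : Drv → ℕ → ℝ

namespace Economy

variable {Loc Drv Rdr : Type*} (E : Economy Loc Drv Rdr)

/-- The time at which a trip ends. -/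
def arrival (r : Trip Loc) : ℕ := r.start + E.dist r.orig r.dest

/-- The feasible trips within the planning horizon. -/
def trips : Set (Trip Loc) := {r | E.arrival r ≤ E.T}

/-- A sequence of feasible trips, the first of which starts at `(a, t)`, and each of the others
where and when the previous one ends. -/
def IsPathFrom : Loc → ℕ → List (Trip Loc) → Prop
  | _, _, [] => True
  | a, t, r :: P => r.orig = a ∧ r.start = t ∧ r ∈ E.trips ∧ IsPathFrom r.dest (E.arrival r) P

/-- The time at which a sequence of trips that begins at time `t` ends. -/
def endTime : ℕ → List (Trip Loc) → ℕ
  | t, [] => t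
  | _, r :: P => endTime (E.arrival r) P

/-- The feasible paths of driver `i`. The empty path means not entering, or, for a driver that
has entered already, exiting immediately. -/
def paths (i : Drv) : Set (List (Trip Loc)) :=
  {P | E.IsPathFrom (E.entryLoc i) (E.entryTime i) P}

open Classical in
/-- The total cost of a path to driver `i`: nothing if she does not enter, and otherwise the costs
of the trips plus the cost of exiting before the end of the horizon. -/
noncomputable def pathCost (i : Drv) (P : List (Trip Loc)) : ℝ :=
  if P = [] ∧ E.entered i = false then 0
  else (P.map E.tripCost).sum + E.exitCost (E.T - E.endTime (E.entryTime i) P)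

/-- The feasible action paths of driver `i`. -/
def actionPaths (i : Drv) : Set (ActionPath Loc Rdr) :=
  {w | w.map Prod.fst ∈ E.paths i ∧ ∀ r j, (r, some j) ∈ w → r = E.request j}

/-- The action path `w` includes the pick-up of rider `j`. -/
def PicksUp (w : ActionPath Loc Rdr) (j : Rdr) : Prop := (E.request j, some j) ∈ w

/-- The cost to driver `i` of the action path dispatched to her. -/
noncomputable def driverCost (d : Dispatch Loc Drv Rdr) (i : Drv) : ℝ :=
  E.pathCost i ((d.z i).map Prod.fst)

variable [Fintype Drv] [Fintype Rdr]

open Classical in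
/-- Feasible dispatches: drivers take feasible action paths, `x j ∈ {0, 1}`, and `x j` is the number
of drivers that pick up rider `j`. -/
def IsFeasible (d : Dispatch Loc Drv Rdr) : Prop :=
  (∀ i, d.z i ∈ E.actionPaths i) ∧
  ∀ j, d.x j = (∑ i, if E.PicksUp (d.z i) j then 1 else 0) ∧ (d.x j = 0 ∨ d.x j = 1)

/-- Social welfare: the values of the riders picked up minus the costs of the drivers. -/
noncomputable def welfare (d : Dispatch Loc Drv Rdr) : ℝ :=
  ∑ j, (d.x j : ℝ) * E.value j - ∑ i, E.driverCost d i

/-- A feasible dispatch of maximal welfare among the feasible dispatches. -/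
def IsWelfareOptimal (d : Dispatch Loc Drv Rdr) : Prop :=
  E.IsFeasible d ∧ ∀ d', E.IsFeasible d' → E.welfare d' ≤ E.welfare d

open Classical in
/-- The plan in which dispatch `d` is carried out at the anonymous trip prices `p`: a rider pays the
price of her trip if picked up and nothing otherwise, and a driver is paid the price of every rider
trip at the time at which it starts, and nothing else. -/
noncomputable def priced (d : Dispatch Loc Drv Rdr) (p : Trip Loc → ℝ) : Plan Loc Drv Rdr where
  toDispatch := d
  riderPay j := (d.x j : ℝ) * p (E.request j)
  driverPay i t :=
    ∑ j, if E.PicksUp (d.z i) j ∧ (E.request j).start = t then p (E.request j) else 0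

/-- The total payment to driver `i` over the planning horizon. -/
noncomputable def totalPay (π : Plan Loc Drv Rdr) (i : Drv) : ℝ :=
  ∑ t ∈ Finset.range (E.T + 1), π.driverPay i t

/-- The utility of driver `i`. -/
noncomputable def driverUtility (π : Plan Loc Drv Rdr) (i : Drv) : ℝ :=
  E.totalPay π i - E.driverCost π.toDispatch i

/-- The feasible dispatch `d` with anonymous trip prices `p` forms a competitive equilibrium. -/
def IsCE (d : Dispatch Loc Drv Rdr) (p : Trip Loc → ℝ) : Prop :=
  E.IsFeasible d ∧
  (∀ j, (p (E.request j) < E.value j → d.x j = 1) ∧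
    (d.x j = 1 → p (E.request j) ≤ E.value j)) ∧
  ∀ i, IsGreatest
    ((fun P : List (Trip Loc) => (P.map fun r => max (p r) 0).sum - E.pathCost i P) '' E.paths i)
    (E.driverUtility (E.priced d p) i)

/-- Strict budget balance. -/
def StrictBudgetBalance (π : Plan Loc Drv Rdr) : Prop :=
  ∑ j, π.riderPay j = ∑ i, E.totalPay π i

/-- Individual rationality for riders. -/
def RiderIR (π : Plan Loc Drv Rdr) : Prop :=
  ∀ j, π.riderPay j ≤ (π.x j : ℝ) * E.value j

/-- Individual rationality for drivers (that have not yet entered). -/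
def DriverIR (π : Plan Loc Drv Rdr) : Prop :=
  ∀ i, E.entered i = false → 0 ≤ E.driverUtility π i

/-- Envy-freeness for riders requesting the same trip. -/
def RiderEnvyFree (π : Plan Loc Drv Rdr) : Prop :=
  ∀ j j', E.request j = E.request j' →
    (π.x j' : ℝ) * E.value j - π.riderPay j' ≤ (π.x j : ℝ) * E.value j - π.riderPay j

/-- Envy-freeness for drivers: those with the same entrance time, location and status have the same
utility. -/
def DriverEnvyFree (π : Plan Loc Drv Rdr) : Prop :=
  ∀ i i', E.entryTime i = E.entryTime i' → E.entryLoc i = E.entryLoc i' →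
    E.entered i = E.entered i' → E.driverUtility π i = E.driverUtility π i'

end Economy

/-! ### A random access machine with real data

The store consists of arrays of natural numbers (used for control and for addresses) and arrays of
real numbers. An array is designated by a number and has three indices. The operations are addition,
subtraction and comparison, each of unit cost; there is no multiplication, no rounding and no real
constant but zero. Hence a computation of `s` steps on rational data only produces numbers whose
encoding length exceeds that of the data by `O(s)`. -/

structure Store where
  nat : ℕ → ℕ → ℕ → ℕ → ℕ
  real : ℕ → ℕ → ℕ → ℕ → ℝ

/-- Expressions with natural values; `cell A i j k` is the content of array `A` at `(i, j, k)`. -/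
inductive NExpr where
  | const (n : ℕ)
  | cell (A : ℕ) (i j k : NExpr)
  | add (e f : NExpr)
  | sub (e f : NExpr)

/-- Expressions with real values. -/
inductive RExpr where
  | zero
  | cell (A : ℕ) (i j k : NExpr)
  | add (e f : RExpr)
  | sub (e f : RExpr)

/-- Tests. -/
inductive Test where
  | nle (e f : NExpr)
  | rle (e f : RExpr)
  | not (b : Test)
  | and (b c : Test)

/-- Programs. -/
inductive Program where
  | skip
  | nset (A : ℕ) (i j k : NExpr) (e : NExpr)
  | rset (A : ℕ) (i j k : NExpr) (e : RExpr)
  | seq (c d : Program)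
  | ite (b : Test) (c d : Program)
  | loop (b : Test) (c : Program)

/-- Subtraction of natural numbers is truncated at zero. -/
def NExpr.eval (s : Store) : NExpr → ℕ
  | const n => n
  | cell A i j k => s.nat A (i.eval s) (j.eval s) (k.eval s)
  | add e f => e.eval s + f.eval s
  | sub e f => e.eval s - f.eval s

/-- The number of operations needed to evaluate an expression. -/
def NExpr.cost : NExpr → ℕ
  | const _ => 1
  | cell _ i j k => i.cost + j.cost + k.cost + 1
  | add e f => e.cost + f.cost + 1
  | sub e f => e.cost + f.cost + 1

noncomputable def RExpr.eval (s : Store) : RExpr → ℝ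
  | zero => 0
  | cell A i j k => s.real A (i.eval s) (j.eval s) (k.eval s)
  | add e f => e.eval s + f.eval s
  | sub e f => e.eval s - f.eval s

def RExpr.cost : RExpr → ℕ
  | zero => 1
  | cell _ i j k => i.cost + j.cost + k.cost + 1
  | add e f => e.cost + f.cost + 1
  | sub e f => e.cost + f.cost + 1

def Test.Holds (s : Store) : Test → Prop
  | nle e f => e.eval s ≤ f.eval s
  | rle e f => e.eval s ≤ f.eval s
  | not b => ¬ b.Holds s
  | and b c => b.Holds s ∧ c.Holds s

def Test.cost : Test → ℕ
  | nle e f => e.cost + f.cost + 1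
  | rle e f => e.cost + f.cost + 1
  | not b => b.cost + 1
  | and b c => b.cost + c.cost + 1

def Store.setNat (s : Store) (A i j k n : ℕ) : Store where
  nat A' i' j' k' := if A' = A ∧ i' = i ∧ j' = j ∧ k' = k then n else s.nat A' i' j' k'
  real := s.real

noncomputable def Store.setReal (s : Store) (A i j k : ℕ) (y : ℝ) : Store where
  nat := s.nat
  real A' i' j' k' := if A' = A ∧ i' = i ∧ j' = j ∧ k' = k then y else s.real A' i' j' k'

/-- `Exec c s n s'`: started in store `s`, program `c` halts in store `s'` after `n` steps. -/
inductive Exec : Program → Store → ℕ → Store → Prop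
  | skip (s : Store) : Exec .skip s 1 s
  | nset (s : Store) (A : ℕ) (i j k e : NExpr) :
      Exec (.nset A i j k e) s (i.cost + j.cost + k.cost + e.cost + 1)
        (s.setNat A (i.eval s) (j.eval s) (k.eval s) (e.eval s))
  | rset (s : Store) (A : ℕ) (i j k : NExpr) (e : RExpr) :
      Exec (.rset A i j k e) s (i.cost + j.cost + k.cost + e.cost + 1)
        (s.setReal A (i.eval s) (j.eval s) (k.eval s) (e.eval s))
  | seq {c d : Program} {s s' s'' : Store} {m n : ℕ} :
      Exec c s m s' → Exec d s' n s'' → Exec (.seq c d) s (m + n) s''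
  | ite_true {b : Test} {c d : Program} {s s' : Store} {n : ℕ} :
      b.Holds s → Exec c s n s' → Exec (.ite b c d) s (b.cost + n) s'
  | ite_false {b : Test} {c d : Program} {s s' : Store} {n : ℕ} :
      ¬ b.Holds s → Exec d s n s' → Exec (.ite b c d) s (b.cost + n) s'
  | loop_true {b : Test} {c : Program} {s s' s'' : Store} {m n : ℕ} :
      b.Holds s → Exec c s m s' → Exec (.loop b c) s' n s'' →
        Exec (.loop b c) s (b.cost + m + n) s''
  | loop_false {b : Test} {c : Program} {s : Store} :
      ¬ b.Holds s → Exec (.loop b c) s b.cost s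

/-- A finite sequence, continued by zeros. -/
def extend {α : Type*} [Zero α] {n : ℕ} (f : Fin n → α) (k : ℕ) : α :=
  if h : k < n then f ⟨k, h⟩ else 0

/-- The store that holds (the relevant data of) an economy with locations `0, …, l - 1`, drivers
`0, …, n - 1` and riders `0, …, m - 1`, and zeros everywhere else. -/
noncomputable def inputStore {l n m : ℕ} (E : Economy (Fin l) (Fin n) (Fin m)) : Store where
  nat
    | 0, 0, 0, 0 => l
    | 0, 1, 0, 0 => n
    | 0, 2, 0, 0 => m
    | 0, 3, 0, 0 => E.T
    | 1, a, b, 0 => extend (fun a : Fin l => extend (fun b : Fin l => E.dist a b) b) a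
    | 2, i, 0, 0 => extend (fun i : Fin n => (E.entered i).toNat) i
    | 2, i, 1, 0 => extend (fun i : Fin n => (E.entryLoc i : ℕ)) i
    | 2, i, 2, 0 => extend (fun i : Fin n => E.entryTime i) i
    | 2, i, 3, 0 => extend (fun i : Fin n => E.exitTime i) i
    | 3, j, 0, 0 => extend (fun j : Fin m => ((E.request j).orig : ℕ)) j
    | 3, j, 1, 0 => extend (fun j : Fin m => ((E.request j).dest : ℕ)) j
    | 3, j, 2, 0 => extend (fun j : Fin m => (E.request j).start) j
    | _, _, _, _ => 0
  real
    | 0, a, b, t => extend (fun a : Fin l => extend (fun b : Fin l =>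
        if t + E.dist a b ≤ E.T then E.tripCost ⟨a, b, t⟩ else 0) b) a
    | 1, Δ, 0, 0 => if Δ ≤ E.T then E.exitCost Δ else 0
    | 2, j, 0, 0 => extend (fun j : Fin m => E.value j) j
    | _, _, _, _ => 0

/-- The store `s` holds dispatch `d` and trip prices `p`: the pick-ups in array `4`, the lengths of
the action paths in array `5`, the actions in array `6` (origin, destination, start, and `0` for no
rider or `j + 1` for rider `j`), and the prices of the feasible trips in real array `3`. -/
def HoldsPlan {l n m : ℕ} (E : Economy (Fin l) (Fin n) (Fin m)) (s : Store)
    (d : Dispatch (Fin l) (Fin n) (Fin m)) (p : Trip (Fin l) → ℝ) : Prop :=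
  (∀ j : Fin m, s.nat 4 j 0 0 = d.x j) ∧
  (∀ i : Fin n, s.nat 5 i 0 0 = (d.z i).length) ∧
  (∀ (i : Fin n) (k : ℕ) (hk : k < (d.z i).length),
    s.nat 6 i k 0 = (d.z i)[k].1.orig ∧
    s.nat 6 i k 1 = (d.z i)[k].1.dest ∧
    s.nat 6 i k 2 = (d.z i)[k].1.start ∧
    s.nat 6 i k 3 = (d.z i)[k].2.elim 0 (fun j => (j : ℕ) + 1)) ∧
  ∀ r ∈ E.trips, s.real 3 r.orig r.dest r.start = p r

end Rideshare

/-!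
A competitive equilibrium splits the welfare of a dispatch into the surpluses of the riders and the
utilities of the drivers. Each of these terms is as large as the prices permit, so every equilibrium
is optimal, and an optimal dispatch attains all of the maxima at the prices of any equilibrium.

For existence, let every driver send one unit of flow through the time-expanded network of locations
and times, from her entrance to a sink, along an arc for her empty path, arcs for the trips of the
riders, which have capacity one, arcs for relocations, and arcs for exiting, with the gains in
welfare on the arcs. A flow of maximal gain is found by routing the drivers one after another along
shortest augmenting paths, and maintaining a dual feasible potential: the value to a driver of being
available at a location and time. The flow decomposes into action paths since all arcs lead forward
in time. The trip price is the cost of the trip plus the loss of potential, and complementary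
slackness makes the dispatch and these prices an equilibrium. Only sums, differences and comparisons
of the data occur, and the number of augmentations is the number of drivers.
-/

namespace Rideshare

/-! ### Welfare and equilibria -/

namespace Economy

variable {Loc Drv Rdr : Type*} {E : Economy Loc Drv Rdr}

section Paths

variable {a : Loc} {t : ℕ} {P : List (Trip Loc)} {r : Trip Loc}

lemma start_lt_arrival (E : Economy Loc Drv Rdr) (r : Trip Loc) : r.start < E.arrival r :=
  Nat.lt_add_of_pos_right (E.dist_pos r.orig r.dest)

/-- The location at which a sequence of trips that begins at `a` ends. -/
def endLoc : Loc → List (Trip Loc) → Loc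
  | a, [] => a
  | _, r :: P => endLoc r.dest P

lemma endLoc_concat : ∀ (a : Loc) (P : List (Trip Loc)) (r : Trip Loc),
    endLoc a (P ++ [r]) = r.dest
  | _, [], _ => rfl
  | _, q :: P, r => endLoc_concat q.dest P r

lemma endTime_concat : ∀ (t : ℕ) (P : List (Trip Loc)) (r : Trip Loc),
    E.endTime t (P ++ [r]) = E.arrival r
  | _, [], _ => rfl
  | _, q :: P, r => endTime_concat (E.arrival q) P r

namespace IsPathFrom

lemma mem_trips (hP : E.IsPathFrom a t P) : ∀ r ∈ P, r ∈ E.trips := by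
  induction P generalizing a t with
  | nil => simp
  | cons q P ih =>
    obtain ⟨-, -, hq, hP⟩ := hP
    exact List.forall_mem_cons.2 ⟨hq, ih hP⟩

lemma le_start (hP : E.IsPathFrom a t P) : ∀ r ∈ P, t ≤ r.start := by
  induction P generalizing a t with
  | nil => simp
  | cons q P ih =>
    obtain ⟨-, rfl, -, hP⟩ := hP
    exact List.forall_mem_cons.2
      ⟨le_rfl, fun r hr => (E.start_lt_arrival q).le.trans (ih hP r hr)⟩

lemma pairwise_start_lt (hP : E.IsPathFrom a t P) : P.Pairwise fun q r => q.start < r.start := by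
  induction P generalizing a t with
  | nil => exact List.Pairwise.nil
  | cons q P ih =>
    obtain ⟨-, -, -, hP⟩ := hP
    exact List.pairwise_cons.2
      ⟨fun r hr => (E.start_lt_arrival q).trans_le (hP.le_start r hr), ih hP⟩

lemma concat (hP : E.IsPathFrom a t P) (ho : r.orig = endLoc a P) (hs : r.start = E.endTime t P)
    (hr : r ∈ E.trips) : E.IsPathFrom a t (P ++ [r]) := by
  induction P generalizing a t with
  | nil => exact ⟨ho, hs, hr, trivial⟩
  | cons q P ih =>
    obtain ⟨hqo, hqs, hq, hP⟩ := hP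
    exact ⟨hqo, hqs, hq, ih hP ho hs⟩

lemma endTime_le (hP : E.IsPathFrom a t P) (ht : t ≤ E.T) : E.endTime t P ≤ E.T := by
  induction P generalizing a t with
  | nil => exact ht
  | cons q P ih =>
    obtain ⟨-, -, hq, hP⟩ := hP
    exact ih hP hq

end IsPathFrom

end Paths

section Revenue

variable {i : Drv} {w : ActionPath Loc Rdr}

/-- The riders carried along an action path. -/
def carried (w : ActionPath Loc Rdr) : List Rdr := w.filterMap Prod.snd

/-- The revenue from an action path at trip prices `p`. -/
def revenue (p : Trip Loc → ℝ) (w : ActionPath Loc Rdr) : ℝ :=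
  (w.map fun y => if y.2.isSome then p y.1 else 0).sum

lemma picksUp_iff_mem_carried (hw : w ∈ E.actionPaths i) {j : Rdr} :
    E.PicksUp w j ↔ j ∈ carried w := by
  simp only [carried, List.mem_filterMap, PicksUp]
  constructor
  · exact fun h => ⟨_, h, rfl⟩
  · rintro ⟨⟨r, _⟩, h, rfl⟩
    exact hw.2 r j h ▸ h

lemma nodup_carried (hw : w ∈ E.actionPaths i) : (carried w).Nodup := by
  have hpair : w.Pairwise fun y y' => y.1.start < y'.1.start := by
    simpa only [List.pairwise_map] using IsPathFrom.pairwise_start_lt hw.1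
  refine List.pairwise_filterMap.2 (hpair.imp_of_mem ?_)
  rintro ⟨r, _⟩ ⟨r', _⟩ hy hy' hlt j rfl _ rfl rfl
  rw [hw.2 r j hy, hw.2 r' j hy'] at hlt
  exact lt_irrefl _ hlt

lemma revenue_eq_sum_carried (hw : w ∈ E.actionPaths i) (p : Trip Loc → ℝ) :
    revenue p w = ((carried w).map fun j => p (E.request j)).sum := by
  have hreq := hw.2
  clear hw
  induction w with
  | nil => rfl
  | cons y w ih =>
    obtain ⟨r, _ | j⟩ := y
    · simpa [revenue, carried] using ih fun r j h => hreq r j (List.mem_cons_of_mem _ h)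
    · simpa [revenue, carried, ← hreq r j List.mem_cons_self] using
        ih fun r j h => hreq r j (List.mem_cons_of_mem _ h)

open Classical in
lemma sum_picksUp [Fintype Rdr] (hw : w ∈ E.actionPaths i) (p : Trip Loc → ℝ) :
    ∑ j, (if E.PicksUp w j then p (E.request j) else 0) = revenue p w := by
  rw [revenue_eq_sum_carried hw, ← List.sum_toFinset _ (nodup_carried hw)]
  simp [picksUp_iff_mem_carried hw, ← List.mem_toFinset]

lemma revenue_le (p : Trip Loc → ℝ) (w : ActionPath Loc Rdr) :
    revenue p w ≤ ((w.map Prod.fst).map fun r => max (p r) 0).sum := by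
  rw [revenue, List.map_map]
  refine List.sum_le_sum fun y _ => ?_
  by_cases h : y.2.isSome <;> simp [h]

end Revenue

section Welfare

variable [Fintype Drv] {d d' : Dispatch Loc Drv Rdr}

namespace IsFeasible

lemma mul_surplus_le (hd : E.IsFeasible d) (y : ℝ) (j : Rdr) : (d.x j : ℝ) * y ≤ max y 0 := by
  rcases (hd.2 j).2 with h | h <;> simp [h]

lemma rider_best_response_iff (hd : E.IsFeasible d) (p : Trip Loc → ℝ) (j : Rdr) :
    ((p (E.request j) < E.value j → d.x j = 1) ∧ (d.x j = 1 → p (E.request j) ≤ E.value j)) ↔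
      (d.x j : ℝ) * (E.value j - p (E.request j)) = max (E.value j - p (E.request j)) 0 := by
  rcases (hd.2 j).2 with h | h
  · simp [h, eq_comm (a := (0 : ℝ))]
  · simp [h]

variable [Fintype Rdr]

lemma totalPay_priced (hd : E.IsFeasible d) (p : Trip Loc → ℝ) (i : Drv) :
    E.totalPay (E.priced d p) i = revenue p (d.z i) := by
  classical
  simp only [← sum_picksUp (hd.1 i) p, totalPay, priced]
  rw [Finset.sum_comm]
  refine Finset.sum_congr rfl fun j _ => ?_
  have hj : (E.request j).start < E.T + 1 :=
    Nat.lt_succ_of_le (Nat.le_of_add_right_le (E.request_mem j))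
  by_cases h : E.PicksUp (d.z i) j <;> simp [h, hj]

lemma driverUtility_priced (hd : E.IsFeasible d) (p : Trip Loc → ℝ) (i : Drv) :
    E.driverUtility (E.priced d p) i = revenue p (d.z i) - E.driverCost d i := by
  rw [driverUtility, hd.totalPay_priced]
  rfl

lemma sum_price_eq_sum_revenue (hd : E.IsFeasible d) (p : Trip Loc → ℝ) :
    ∑ j, (d.x j : ℝ) * p (E.request j) = ∑ i, revenue p (d.z i) := by
  classical
  simp only [← fun i => sum_picksUp (hd.1 i) p]
  rw [Finset.sum_comm]
  refine Finset.sum_congr rfl fun j _ => ?_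
  rw [(hd.2 j).1]
  push_cast
  simp only [Finset.sum_mul, ite_mul, one_mul, zero_mul]

lemma welfare_eq (hd : E.IsFeasible d) (p : Trip Loc → ℝ) :
    E.welfare d = ∑ j, (d.x j : ℝ) * (E.value j - p (E.request j)) +
      ∑ i, (revenue p (d.z i) - E.driverCost d i) := by
  simp only [mul_sub, Finset.sum_sub_distrib, hd.sum_price_eq_sum_revenue, welfare]
  ring

end IsFeasible

namespace IsCE

variable [Fintype Rdr] {p : Trip Loc → ℝ}

lemma mul_surplus (h : E.IsCE d p) (j : Rdr) :
    (d.x j : ℝ) * (E.value j - p (E.request j)) = max (E.value j - p (E.request j)) 0 :=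
  (h.1.rider_best_response_iff p j).1 (h.2.1 j)

lemma mul_surplus_le (h : E.IsCE d p) (hd' : E.IsFeasible d') (j : Rdr) :
    (d'.x j : ℝ) * (E.value j - p (E.request j)) ≤
      (d.x j : ℝ) * (E.value j - p (E.request j)) :=
  h.mul_surplus j ▸ hd'.mul_surplus_le _ j

lemma utility_le (h : E.IsCE d p) (hd' : E.IsFeasible d') (i : Drv) :
    revenue p (d'.z i) - E.driverCost d' i ≤ revenue p (d.z i) - E.driverCost d i := by
  rw [← h.1.driverUtility_priced]
  exact (sub_le_sub_right (revenue_le p (d'.z i)) _).trans ((h.2.2 i).2 ⟨_, (hd'.1 i).1, rfl⟩)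

theorem isWelfareOptimal (h : E.IsCE d p) : E.IsWelfareOptimal d := by
  refine ⟨h.1, fun d' hd' => ?_⟩
  rw [h.1.welfare_eq p, hd'.welfare_eq p]
  exact add_le_add (Finset.sum_le_sum fun j _ => h.mul_surplus_le hd' j)
    (Finset.sum_le_sum fun i _ => h.utility_le hd' i)

-- Welfare splits into surpluses and utilities, each of which is largest at an equilibrium, so that
-- equality of the sums forces equality of every term.
theorem of_isWelfareOptimal (h : E.IsCE d p) (hd' : E.IsWelfareOptimal d') : E.IsCE d' p := by
  have hwelfare : E.welfare d' = E.welfare d :=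
    le_antisymm (h.isWelfareOptimal.2 d' hd'.1) (hd'.2 d h.1)
  rw [h.1.welfare_eq p, hd'.1.welfare_eq p] at hwelfare
  have hrider : ∀ j ∈ Finset.univ, _ := fun j _ => h.mul_surplus_le hd'.1 j
  have hdriver : ∀ i ∈ Finset.univ, _ := fun i _ => h.utility_le hd'.1 i
  obtain ⟨hriders, hdrivers⟩ := (add_eq_add_iff_eq_and_eq (Finset.sum_le_sum hrider)
    (Finset.sum_le_sum hdriver)).1 hwelfare
  rw [Finset.sum_eq_sum_iff_of_le hrider] at hriders
  rw [Finset.sum_eq_sum_iff_of_le hdriver] at hdrivers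
  refine ⟨hd'.1, fun j => ?_, fun i => ?_⟩
  · rw [hd'.1.rider_best_response_iff, hriders j (Finset.mem_univ j), h.mul_surplus]
  · rw [hd'.1.driverUtility_priced, hdrivers i (Finset.mem_univ i), ← h.1.driverUtility_priced]
    exact h.2.2 i

theorem strictBudgetBalance (h : E.IsCE d p) : E.StrictBudgetBalance (E.priced d p) := by
  simp only [StrictBudgetBalance, h.1.totalPay_priced]
  exact h.1.sum_price_eq_sum_revenue p

theorem riderIR (h : E.IsCE d p) : E.RiderIR (E.priced d p) := fun j => by
  refine sub_nonneg.1 (le_of_le_of_eq (le_max_right (E.value j - p (E.request j)) 0) ?_)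
  rw [← h.mul_surplus j, mul_sub]
  rfl

theorem driverIR (h : E.IsCE d p) : E.DriverIR (E.priced d p) := fun i hi =>
  (h.2.2 i).2 ⟨[], trivial, by simp [pathCost, hi]⟩

theorem riderEnvyFree (h : E.IsCE d p) : E.RiderEnvyFree (E.priced d p) := fun j j' hjj' => by
  have hle := h.1.mul_surplus_le (E.value j - p (E.request j)) j'
  rw [← h.mul_surplus j, mul_sub, mul_sub] at hle
  simpa only [priced, ← hjj'] using hle

theorem driverEnvyFree (h : E.IsCE d p) : E.DriverEnvyFree (E.priced d p) := by
  intro i i' htime hloc hentered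
  have hpaths : E.paths i = E.paths i' := by simp only [paths, htime, hloc]
  have hcost : E.pathCost i = E.pathCost i' := funext fun P => by
    simp only [pathCost, htime, hentered]
  refine (h.2.2 i).unique ?_
  rw [hpaths, hcost]
  exact h.2.2 i'

end IsCE

end Welfare

section Potential

variable {V : Loc → ℕ → ℝ}

/-- The trip prices derived from a potential `V`, where `V a t` is the value to a driver of being
available at location `a` at time `t`. -/
def potentialPrice (E : Economy Loc Drv Rdr) (V : Loc → ℕ → ℝ) (r : Trip Loc) : ℝ :=
  E.tripCost r + V r.orig r.start - V r.dest (E.arrival r)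

/-- Complementary slackness between the dispatch `d` and the potential `V`, in the linear program
of maximal welfare and its dual. -/
structure Supports (E : Economy Loc Drv Rdr) (V : Loc → ℕ → ℝ) (d : Dispatch Loc Drv Rdr) :
    Prop where
  price_nonneg : ∀ r ∈ E.trips, 0 ≤ E.potentialPrice V r
  exit_le : ∀ a t, t ≤ E.T → -E.exitCost (E.T - t) ≤ V a t
  value_le_price : ∀ j, d.x j = 0 → E.value j ≤ E.potentialPrice V (E.request j)
  price_le_value : ∀ j, d.x j = 1 → E.potentialPrice V (E.request j) ≤ E.value j
  relocation : ∀ i r, (r, none) ∈ d.z i → E.potentialPrice V r ≤ 0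
  le_of_eq_nil : ∀ i, d.z i = [] → V (E.entryLoc i) (E.entryTime i) ≤ -E.pathCost i []
  le_of_ne_nil : ∀ i, d.z i ≠ [] → -E.pathCost i [] ≤ V (E.entryLoc i) (E.entryTime i)
  exit_eq : ∀ i, d.z i ≠ [] → V (endLoc (E.entryLoc i) ((d.z i).map Prod.fst))
    (E.endTime (E.entryTime i) ((d.z i).map Prod.fst)) =
      -E.exitCost (E.T - E.endTime (E.entryTime i) ((d.z i).map Prod.fst))

lemma IsPathFrom.sum_potentialPrice {a : Loc} {t : ℕ} {P : List (Trip Loc)}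
    (hP : E.IsPathFrom a t P) : (P.map (E.potentialPrice V)).sum =
      (P.map E.tripCost).sum + V a t - V (endLoc a P) (E.endTime t P) := by
  induction P generalizing a t with
  | nil => simp [endLoc, endTime]
  | cons q P ih =>
    obtain ⟨rfl, rfl, -, hP⟩ := hP
    simp only [List.map_cons, List.sum_cons, endLoc, endTime, ih hP, potentialPrice]
    ring

lemma pathCost_nil_le (E : Economy Loc Drv Rdr) (i : Drv) :
    E.pathCost i [] ≤ E.exitCost (E.T - E.entryTime i) := by
  rw [pathCost]
  split_ifs
  · exact E.exitCost_nonneg _ (Nat.sub_le _ _)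
  · simp [endTime]

lemma sum_potentialPrice_sub_pathCost {i : Drv} {P : List (Trip Loc)} (hP : P ∈ E.paths i)
    (hne : P ≠ []) : (P.map (E.potentialPrice V)).sum - E.pathCost i P =
      V (E.entryLoc i) (E.entryTime i) - (V (endLoc (E.entryLoc i) P)
        (E.endTime (E.entryTime i) P) + E.exitCost (E.T - E.endTime (E.entryTime i) P)) := by
  rw [IsPathFrom.sum_potentialPrice hP, pathCost, if_neg fun h => hne h.1]
  ring

namespace Supports

variable {d : Dispatch Loc Drv Rdr}

lemma sum_max_price (h : E.Supports V d) {i : Drv} {P : List (Trip Loc)} (hP : P ∈ E.paths i) :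
    (P.map fun r => max (E.potentialPrice V r) 0).sum = (P.map (E.potentialPrice V)).sum :=
  congrArg List.sum <| List.map_congr_left fun r hr =>
    max_eq_left (h.price_nonneg r (IsPathFrom.mem_trips hP r hr))

lemma revenue_eq (h : E.Supports V d) {i : Drv} (hi : d.z i ∈ E.actionPaths i) :
    revenue (E.potentialPrice V) (d.z i) =
      (((d.z i).map Prod.fst).map (E.potentialPrice V)).sum := by
  rw [revenue, List.map_map]
  refine congrArg List.sum (List.map_congr_left ?_)
  rintro ⟨r, _ | j⟩ hr
  · exact le_antisymm
      (h.price_nonneg r (IsPathFrom.mem_trips hi.1 r (List.mem_map_of_mem (f := Prod.fst) hr)))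
      (h.relocation i r hr)
  · rfl

lemma sum_price_sub_pathCost_le (h : E.Supports V d) {i : Drv} {P : List (Trip Loc)}
    (hP : P ∈ E.paths i) : (P.map (E.potentialPrice V)).sum - E.pathCost i P ≤
      max (V (E.entryLoc i) (E.entryTime i)) (-E.pathCost i []) := by
  rcases eq_or_ne P [] with rfl | hne
  · simp
  · rw [sum_potentialPrice_sub_pathCost hP hne]
    have := h.exit_le (endLoc (E.entryLoc i) P) _ (IsPathFrom.endTime_le hP (E.entryTime_le i))
    exact le_max_of_le_left (by linarith)

lemma sum_price_sub_driverCost (h : E.Supports V d) {i : Drv} (hi : d.z i ∈ E.actionPaths i) :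
    (((d.z i).map Prod.fst).map (E.potentialPrice V)).sum - E.driverCost d i =
      max (V (E.entryLoc i) (E.entryTime i)) (-E.pathCost i []) := by
  rw [driverCost]
  by_cases hne : d.z i = []
  · simp [hne, h.le_of_eq_nil i hne]
  · rw [sum_potentialPrice_sub_pathCost hi.1 (by simpa using hne), h.exit_eq i hne,
      max_eq_left (h.le_of_ne_nil i hne)]
    ring

theorem isCE [Fintype Drv] [Fintype Rdr] (h : E.Supports V d) (hd : E.IsFeasible d) :
    E.IsCE d (E.potentialPrice V) := by
  refine ⟨hd, fun j => ⟨fun hlt => ?_, h.price_le_value j⟩, fun i => ?_⟩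
  · exact (hd.2 j).2.resolve_left fun h0 => (h.value_le_price j h0).not_gt hlt
  rw [hd.driverUtility_priced, h.revenue_eq (hd.1 i)]
  refine ⟨⟨_, (hd.1 i).1, congrArg (· - _) (h.sum_max_price (hd.1 i).1)⟩, ?_⟩
  rintro _ ⟨P, hP, rfl⟩
  simp only [h.sum_max_price hP, h.sum_price_sub_driverCost (hd.1 i)]
  exact h.sum_price_sub_pathCost_le hP

end Supports

end Potential

end Economy

/-! ### Programs with bounded loops -/

/-- Programs all of whose loops run over initial segments of the natural numbers, so that they
denote functions of the store. -/
inductive Code where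
  | skip
  | nset (A : ℕ) (i j k : NExpr) (e : NExpr)
  | rset (A : ℕ) (i j k : NExpr) (e : RExpr)
  | seq (c d : Code)
  | ite (b : Test) (c d : Code)
  /-- `count x e c` executes `c` with `x = 0, 1, …`, as long as `x` is less than `e`. -/
  | count (x : ℕ) (e : NExpr) (c : Code)

/-- The scalar variable `x`: the cell of array `x` at the origin. -/
abbrev var (x : ℕ) : NExpr := .cell x (.const 0) (.const 0) (.const 0)

/-- The arrays that an expression refers to. -/
def NExpr.arrays : NExpr → List ℕ
  | const _ => []
  | cell A i j k => A :: (i.arrays ++ j.arrays ++ k.arrays)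
  | add e f => e.arrays ++ f.arrays
  | sub e f => e.arrays ++ f.arrays

/-- The arrays of natural numbers that an expression with real values refers to. -/
def RExpr.arrays : RExpr → List ℕ
  | zero => []
  | cell _ i j k => i.arrays ++ j.arrays ++ k.arrays
  | add e f => e.arrays ++ f.arrays
  | sub e f => e.arrays ++ f.arrays

/-- The arrays of real numbers that an expression refers to. -/
def RExpr.realArrays : RExpr → List ℕ
  | zero => []
  | cell A _ _ _ => [A]
  | add e f => e.realArrays ++ f.realArrays
  | sub e f => e.realArrays ++ f.realArrays

lemma NExpr.eval_congr {s s' : Store} (e : NExpr) (h : ∀ A ∈ e.arrays, s'.nat A = s.nat A) :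
    e.eval s' = e.eval s := by
  induction e with
  | const n => rfl
  | cell A i j k hi hj hk =>
    simp only [arrays, List.mem_cons, List.mem_append] at h
    simp only [eval, h A (Or.inl rfl), hi fun B hB => h B (by tauto), hj fun B hB => h B (by tauto),
      hk fun B hB => h B (by tauto)]
  | add e f he hf =>
    simp only [arrays, List.mem_append] at h
    simp only [eval, he fun B hB => h B (by tauto), hf fun B hB => h B (by tauto)]
  | sub e f he hf =>
    simp only [arrays, List.mem_append] at h
    simp only [eval, he fun B hB => h B (by tauto), hf fun B hB => h B (by tauto)]

lemma RExpr.eval_congr {s s' : Store} (e : RExpr) (h : ∀ A ∈ e.arrays, s'.nat A = s.nat A)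
    (hr : ∀ A ∈ e.realArrays, s'.real A = s.real A) : e.eval s' = e.eval s := by
  induction e with
  | zero => rfl
  | cell A i j k =>
    simp only [arrays, List.mem_append] at h
    simp only [eval, hr A (List.mem_singleton.2 rfl), i.eval_congr fun B hB => h B (by tauto),
      j.eval_congr fun B hB => h B (by tauto), k.eval_congr fun B hB => h B (by tauto)]
  | add e f he hf =>
    simp only [arrays, realArrays, List.mem_append] at h hr
    simp only [eval, he (fun B hB => h B (by tauto)) (fun B hB => hr B (by tauto)),
      hf (fun B hB => h B (by tauto)) (fun B hB => hr B (by tauto))]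
  | sub e f he hf =>
    simp only [arrays, realArrays, List.mem_append] at h hr
    simp only [eval, he (fun B hB => h B (by tauto)) (fun B hB => hr B (by tauto)),
      hf (fun B hB => h B (by tauto)) (fun B hB => hr B (by tauto))]

/-- The array `f` with the entry at `(i, j, k)` replaced. -/
def updateAt {α : Type*} (f : ℕ → ℕ → ℕ → α) (i j k : ℕ) (y : α) (i' j' k' : ℕ) : α :=
  if i' = i ∧ j' = j ∧ k' = k then y else f i' j' k'

@[simp] lemma updateAt_self {α : Type*} (f : ℕ → ℕ → ℕ → α) (i j k : ℕ) (y : α) :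
    updateAt f i j k y i j k = y := by simp [updateAt]

@[simp] lemma Store.setNat_nat_self (s : Store) (A i j k n : ℕ) :
    (s.setNat A i j k n).nat A = updateAt (s.nat A) i j k n := by
  funext i' j' k'
  simp [setNat, updateAt]

@[simp] lemma Store.setNat_nat_of_ne (s : Store) {A B : ℕ} (i j k n : ℕ) (h : B ≠ A) :
    (s.setNat A i j k n).nat B = s.nat B := by
  funext i' j' k'
  simp [setNat, h]

@[simp] lemma Store.setNat_real (s : Store) (A i j k n : ℕ) :
    (s.setNat A i j k n).real = s.real := rfl

@[simp] lemma Store.setReal_nat (s : Store) (A i j k : ℕ) (y : ℝ) :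
    (s.setReal A i j k y).nat = s.nat := rfl

@[simp] lemma Store.setReal_real_self (s : Store) (A i j k : ℕ) (y : ℝ) :
    (s.setReal A i j k y).real A = updateAt (s.real A) i j k y := by
  funext i' j' k'
  simp [setReal, updateAt]

@[simp] lemma Store.setReal_real_of_ne (s : Store) {A B : ℕ} (i j k : ℕ) (y : ℝ) (h : B ≠ A) :
    (s.setReal A i j k y).real B = s.real B := by
  funext i' j' k'
  simp [setReal, h]

lemma NExpr.eval_setNat {A : ℕ} {e : NExpr} (h : A ∉ e.arrays) (s : Store) (i j k n : ℕ) :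
    e.eval (s.setNat A i j k n) = e.eval s :=
  e.eval_congr fun _ hB => s.setNat_nat_of_ne i j k n fun hBA => h (hBA ▸ hB)

lemma NExpr.eval_setReal (e : NExpr) (s : Store) (A i j k : ℕ) (y : ℝ) :
    e.eval (s.setReal A i j k y) = e.eval s :=
  e.eval_congr fun _ _ => rfl

lemma RExpr.eval_setNat {A : ℕ} {e : RExpr} (h : A ∉ e.arrays) (s : Store) (i j k n : ℕ) :
    e.eval (s.setNat A i j k n) = e.eval s :=
  e.eval_congr (fun _ hB => s.setNat_nat_of_ne i j k n fun hBA => h (hBA ▸ hB)) fun _ _ => rfl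

lemma RExpr.eval_setReal {A : ℕ} {e : RExpr} (h : A ∉ e.realArrays) (s : Store) (i j k : ℕ)
    (y : ℝ) : e.eval (s.setReal A i j k y) = e.eval s :=
  e.eval_congr (fun _ _ => rfl) fun _ hB => s.setReal_real_of_ne i j k y fun hBA => h (hBA ▸ hB)

namespace Code

/-- The effect of `N` rounds of a loop with counter `x` whose body has the effect `f`. -/
def rounds (x : ℕ) (f : Store → Store) (s : Store) : ℕ → Store
  | 0 => s.setNat x 0 0 0 0
  | k + 1 => (f (rounds x f s k)).setNat x 0 0 0 (k + 1)

open Classical in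
/-- The effect of executing a piece of code. -/
noncomputable def run : Code → Store → Store
  | skip, s => s
  | nset A i j k e, s => s.setNat A (i.eval s) (j.eval s) (k.eval s) (e.eval s)
  | rset A i j k e, s => s.setReal A (i.eval s) (j.eval s) (k.eval s) (e.eval s)
  | seq c d, s => d.run (c.run s)
  | ite b c d, s => if b.Holds s then c.run s else d.run s
  | count x e c, s => rounds x c.run s (e.eval s)

/-- The arrays of natural numbers that are modified. -/
def writes : Code → List ℕ
  | skip => []
  | nset A _ _ _ _ => [A]
  | rset _ _ _ _ _ => []
  | seq c d => c.writes ++ d.writes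
  | ite _ c d => c.writes ++ d.writes
  | count x _ c => x :: c.writes

/-- The arrays of real numbers that are modified. -/
def realWrites : Code → List ℕ
  | skip => []
  | nset _ _ _ _ _ => []
  | rset A _ _ _ _ => [A]
  | seq c d => c.realWrites ++ d.realWrites
  | ite _ c d => c.realWrites ++ d.realWrites
  | count _ _ c => c.realWrites

section Frame

variable {x : ℕ} {f : Store → Store} {A : ℕ}

lemma rounds_counter (x : ℕ) (f : Store → Store) (s : Store) (k : ℕ) :
    (rounds x f s k).nat x 0 0 0 = k := by
  cases k <;> simp [rounds]

lemma rounds_nat (hA : A ≠ x) (hf : ∀ s, (f s).nat A = s.nat A) (s : Store) (k : ℕ) :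
    (rounds x f s k).nat A = s.nat A := by
  induction k with
  | zero => simp [rounds, hA]
  | succ k ih => simp [rounds, hA, hf, ih]

lemma rounds_real (hf : ∀ s, (f s).real A = s.real A) (s : Store) (k : ℕ) :
    (rounds x f s k).real A = s.real A := by
  induction k with
  | zero => simp [rounds]
  | succ k ih => simp [rounds, hf, ih]

lemma run_nat (c : Code) (hA : A ∉ c.writes) (s : Store) : (c.run s).nat A = s.nat A := by
  induction c generalizing s with
  | skip => rfl
  | nset B i j k e =>
    have : A ≠ B := by simpa [writes] using hA
    simp [run, this]
  | rset B i j k e => rfl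
  | seq c d hc hd =>
    simp only [writes, List.mem_append, not_or] at hA
    rw [run, hd hA.2, hc hA.1]
  | ite b c d hc hd =>
    simp only [writes, List.mem_append, not_or] at hA
    rw [run]
    split_ifs
    exacts [hc hA.1 s, hd hA.2 s]
  | count x e c hc =>
    simp only [writes, List.mem_cons, not_or] at hA
    exact rounds_nat hA.1 (hc hA.2) s _

lemma run_real (c : Code) (hA : A ∉ c.realWrites) (s : Store) : (c.run s).real A = s.real A := by
  induction c generalizing s with
  | skip => rfl
  | nset B i j k e => rfl
  | rset B i j k e =>
    have : A ≠ B := by simpa [realWrites] using hA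
    simp [run, this]
  | seq c d hc hd =>
    simp only [realWrites, List.mem_append, not_or] at hA
    rw [run, hd hA.2, hc hA.1]
  | ite b c d hc hd =>
    simp only [realWrites, List.mem_append, not_or] at hA
    rw [run]
    split_ifs
    exacts [hc hA.1 s, hd hA.2 s]
  | count x e c hc => exact rounds_real (hc hA) s _

/-- The stores `s` and `s'` differ in arrays that `c` modifies only. -/
structure Frame (c : Code) (s s' : Store) : Prop where
  nat : ∀ A ∉ c.writes, s'.nat A = s.nat A
  real : ∀ A ∉ c.realWrites, s'.real A = s.real A

lemma frame_run (c : Code) (s : Store) : c.Frame s (c.run s) :=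
  ⟨fun _ hA => run_nat c hA s, fun _ hA => run_real c hA s⟩

lemma Frame.mono {c d : Code} {s s' : Store} (hs : c.Frame s s')
    (hn : ∀ A ∈ c.writes, A ∈ d.writes := by decide)
    (hr : ∀ A ∈ c.realWrites, A ∈ d.realWrites := by decide) : d.Frame s s' :=
  ⟨fun A hA => hs.nat A fun h => hA (hn A h), fun A hA => hs.real A fun h => hA (hr A h)⟩

lemma Frame.trans {c : Code} {s₁ s₂ s₃ : Store} (h : c.Frame s₁ s₂) (h' : c.Frame s₂ s₃) :
    c.Frame s₁ s₃ :=
  ⟨fun A hA => (h'.nat A hA).trans (h.nat A hA), fun A hA => (h'.real A hA).trans (h.real A hA)⟩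

lemma frame_setNat {c : Code} (hx : x ∈ c.writes) (s : Store) (i j k n : ℕ) :
    c.Frame s (s.setNat x i j k n) :=
  ⟨fun _ hA => s.setNat_nat_of_ne i j k n fun h => hA (h ▸ hx), fun _ _ => rfl⟩

end Frame

section Count

variable {x : ℕ} {e : NExpr} {c : Code} {s : Store} {N : ℕ}

theorem run_count (I : ℕ → Store → Prop) (hN : e.eval s = N)
    (counter : ∀ k s' v, I k s' → I k (s'.setNat x 0 0 0 v)) (zero : I 0 s)
    (succ : ∀ k < N, ∀ s', s'.nat x 0 0 0 = k → (count x e c).Frame s s' → I k s' →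
      I (k + 1) (c.run s')) :
    I N ((count x e c).run s) := by
  have hrounds : ∀ k ≤ N, I k (rounds x c.run s k) := by
    intro k hk
    induction k with
    | zero => exact counter _ _ _ zero
    | succ k ih =>
      refine counter _ _ _ (succ k hk _ (rounds_counter x c.run s k)
        ⟨fun A hA => ?_, fun A hA => ?_⟩ (ih (Nat.le_of_succ_le hk)))
      · simp only [writes, List.mem_cons, not_or] at hA
        exact rounds_nat hA.1 (run_nat c hA.2) s k
      · exact rounds_real (run_real c hA) s k
  rw [run, hN]
  exact hrounds N le_rfl

theorem run_count_pointwise {ι β : Type*} (get : Store → ι → β) (F : ι → β → β) (p : ι → Prop)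
    [DecidablePred p] (idx : ι → ℕ) (hN : e.eval s = N)
    (counter : ∀ s' v, get (s'.setNat x 0 0 0 v) = get s')
    (body : ∀ k < N, ∀ s', s'.nat x 0 0 0 = k → (count x e c).Frame s s' → ∀ i,
      get (c.run s') i = if p i ∧ idx i = k then F i (get s' i) else get s' i) (i : ι) :
    get ((count x e c).run s) i = if p i ∧ idx i < N then F i (get s i) else get s i := by
  refine run_count (fun k s' => get s' i = if p i ∧ idx i < k then F i (get s i) else get s i) hN
    (fun k s' v h => by rwa [counter]) (by simp) fun k hk s' hx hs' ih => ?_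
  rw [body k hk s' hx hs', ih]
  by_cases hp : p i
  · rcases lt_trichotomy (idx i) k with hlt | heq | hgt
    · simp [hp, hlt, hlt.ne, hlt.trans k.lt_succ_self]
    · simp [hp, heq]
    · simp [hp, hgt.ne', hgt.not_gt, (Nat.succ_le_of_lt hgt).not_gt]
  · simp [hp]

theorem run_count_count_pointwise {y N' : ℕ} {e' : NExpr} {ι β : Type*} (get : Store → ι → β)
    (F : ι → β → β) (p : ι → Prop) [DecidablePred p] (idx idx' : ι → ℕ) (hN : e.eval s = N)
    (hN' : ∀ s', (count x e (count y e' c)).Frame s s' → e'.eval s' = N')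
    (hx : x ∉ (count y e' c).writes) (counter : ∀ s' z v, z = x ∨ z = y →
      get (s'.setNat z 0 0 0 v) = get s')
    (body : ∀ k < N, ∀ k' < N', ∀ s', s'.nat x 0 0 0 = k → s'.nat y 0 0 0 = k' →
      (count x e (count y e' c)).Frame s s' → ∀ i,
      get (c.run s') i = if (p i ∧ idx i = k) ∧ idx' i = k' then F i (get s' i) else get s' i)
    (i : ι) :
    get ((count x e (count y e' c)).run s) i =
      if (p i ∧ idx' i < N') ∧ idx i < N then F i (get s i) else get s i := by
  refine run_count_pointwise (c := count y e' c) get F (fun j => p j ∧ idx' j < N') idx hN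
    (fun s' v => counter s' x v (.inl rfl)) (fun k hk s₁ hk₁ hs₁ j => ?_) i
  rw [run_count_pointwise (c := c) get F (fun j => p j ∧ idx j = k) idx' (hN' s₁ hs₁)
    (fun s' v => counter s' y v (.inr rfl)) (fun k' hk' s₂ hk₂ hs₂ => ?_) j]
  · simp only [and_right_comm]
  · refine body k hk k' hk' s₂ (by rw [hs₂.nat x hx, hk₁]) hk₂ ⟨fun A hA => ?_, fun A hA => ?_⟩
    · rw [hs₂.nat A fun h => hA (List.mem_cons_of_mem _ h), hs₁.nat A hA]
    · rw [hs₂.real A hA, hs₁.real A hA]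

end Count

/-- The loop that `count x e c` is compiled to, where `P` is the compiled body. -/
def countLoop (x : ℕ) (e : NExpr) (P : Program) : Program :=
  .loop (.nle (.add (var x) (.const 1)) e)
    (.seq P (.nset x (.const 0) (.const 0) (.const 0) (.add (var x) (.const 1))))

/-- The translation of code into a program of the machine. -/
def compile : Code → Program
  | skip => .skip
  | nset A i j k e => .nset A i j k e
  | rset A i j k e => .rset A i j k e
  | seq c d => .seq c.compile d.compile
  | ite b c d => .ite b c.compile d.compile
  | count x e c =>
    .seq (.nset x (.const 0) (.const 0) (.const 0) (.const 0)) (countLoop x e c.compile)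

/-- Loop bounds refer to the arrays `ro` only, which are never modified, and the bodies of loops do
not modify the counters. -/
def wellFormed (ro : List ℕ) : Code → Bool
  | skip => true
  | nset A _ _ _ _ => A ∉ ro
  | rset _ _ _ _ _ => true
  | seq c d => c.wellFormed ro && d.wellFormed ro
  | ite _ c d => c.wellFormed ro && d.wellFormed ro
  | count x e c => x ∉ ro && (∀ A ∈ e.arrays, A ∈ ro) && x ∉ c.writes && c.wellFormed ro

/-- The bounds of the loops. -/
def bounds : Code → List NExpr
  | skip => []
  | nset _ _ _ _ _ => []
  | rset _ _ _ _ _ => []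
  | seq c d => c.bounds ++ d.bounds
  | ite _ c d => c.bounds ++ d.bounds
  | count _ e c => e :: c.bounds

open Polynomial in
/-- A bound for the running time in terms of a bound for the lengths of the loops; testing and
increasing the counter of a loop costs `e.cost + 17`. -/
noncomputable def time : Code → ℕ[X]
  | skip => 1
  | nset _ i j k e => C (i.cost + j.cost + k.cost + e.cost + 1)
  | rset _ i j k e => C (i.cost + j.cost + k.cost + e.cost + 1)
  | seq c d => c.time + d.time
  | ite b c d => C b.cost + c.time + d.time
  | count _ e c => X * (c.time + C (e.cost + 17)) + C (e.cost + 12)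

section Compile

variable {ro : List ℕ} {A : ℕ}

lemma notMem_writes {c : Code} (h : c.wellFormed ro) (hA : A ∈ ro) : A ∉ c.writes := by
  induction c with
  | skip => simp [writes]
  | nset B i j k e =>
    rintro hAB
    rw [List.mem_singleton.1 hAB] at hA
    simp [wellFormed, hA] at h
  | rset B i j k e => simp [writes]
  | seq c d hc hd | ite b c d hc hd =>
    simp only [wellFormed, Bool.and_eq_true] at h
    simp [writes, hc h.1, hd h.2]
  | count x e c hc =>
    simp only [wellFormed, Bool.and_eq_true, decide_eq_true_eq] at h
    have hne : A ≠ x := fun hAx => h.1.1.1 (hAx ▸ hA)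
    simp [writes, hne, hc h.2]

lemma mem_of_mem_bounds {c : Code} (h : c.wellFormed ro) {e : NExpr} (he : e ∈ c.bounds)
    (hA : A ∈ e.arrays) : A ∈ ro := by
  induction c with
  | skip | nset | rset => simp [bounds] at he
  | seq c d hc hd | ite b c d hc hd =>
    simp only [wellFormed, Bool.and_eq_true] at h
    exact (List.mem_append.1 he).elim (hc h.1) (hd h.2)
  | count x f c hc =>
    simp only [wellFormed, Bool.and_eq_true, decide_eq_true_eq] at h
    rcases List.mem_cons.1 he with rfl | he
    exacts [h.1.1.2 A hA, hc h.2 he]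

lemma exec_countLoop {x : ℕ} {e : NExpr} {P : Program} {f : Store → Store} {s : Store} {N τ : ℕ}
    (he : ∀ k, e.eval (rounds x f s k) = N) (hx : ∀ s, (f s).nat x = s.nat x)
    (hP : ∀ k, ∃ t ≤ τ, Exec P (rounds x f s k) t (f (rounds x f s k))) :
    ∃ t ≤ N * (τ + (e.cost + 17)) + (e.cost + 7),
      Exec (countLoop x e P) (rounds x f s 0) t (rounds x f s N) := by
  suffices hloop : ∀ j k, k + j = N → ∃ t ≤ j * (τ + (e.cost + 17)) + (e.cost + 7),
      Exec (countLoop x e P) (rounds x f s k) t (rounds x f s N) from hloop N 0 (zero_add N)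
  intro j
  induction j with
  | zero =>
    rintro k rfl
    refine ⟨_, ?_, Exec.loop_false ?_⟩
    · simp only [Test.cost, NExpr.cost]
      omega
    · simp [Test.Holds, NExpr.eval, rounds_counter, he]
  | succ j ih =>
    intro k hk
    obtain ⟨t, ht, hbody⟩ := hP k
    obtain ⟨t', ht', hrest⟩ := ih (k + 1) (by omega)
    have hincr := Exec.nset (f (rounds x f s k)) x (.const 0) (.const 0) (.const 0)
      (.add (var x) (.const 1))
    simp only [NExpr.eval, hx, rounds_counter] at hincr
    refine ⟨_, ?_, Exec.loop_true ?_ (hbody.seq hincr) hrest⟩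
    · simp only [Test.cost, NExpr.cost, add_mul]
      omega
    · simp only [Test.Holds, NExpr.eval, rounds_counter, he]
      omega

lemma exec_count {x : ℕ} {e : NExpr} {c : Code} {K : ℕ} {s : Store}
    (h : (count x e c).wellFormed ro) (hK : ∀ f ∈ (count x e c).bounds, f.eval s ≤ K)
    (hc : ∀ s', (∀ f ∈ c.bounds, f.eval s' ≤ K) →
      ∃ t ≤ c.time.eval K, Exec c.compile s' t (c.run s')) :
    ∃ t ≤ (count x e c).time.eval K, Exec (count x e c).compile s t ((count x e c).run s) := by
  simp only [wellFormed, Bool.and_eq_true, decide_eq_true_eq] at h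
  obtain ⟨⟨⟨hxro, hero⟩, hxc⟩, hwf⟩ := h
  have hro : ∀ k, ∀ A ∈ ro, (rounds x c.run s k).nat A = s.nat A := fun k A hA =>
    rounds_nat (fun hAx : A = x => hxro (hAx ▸ hA)) (run_nat c (notMem_writes hwf hA)) s k
  obtain ⟨t, ht, hloop⟩ := exec_countLoop (N := e.eval s)
    (fun k => e.eval_congr fun A hA => hro k A (hero A hA)) (run_nat c hxc) fun k =>
      hc _ fun f hf => by
        rw [f.eval_congr fun A hA => hro k A (mem_of_mem_bounds hwf hf hA)]
        exact hK f (List.mem_cons_of_mem _ hf)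
  refine ⟨_, ?_, (Exec.nset s x (.const 0) (.const 0) (.const 0) (.const 0)).seq hloop⟩
  have hN := Nat.mul_le_mul_right (c.time.eval K + (e.cost + 17)) (hK e List.mem_cons_self)
  simp only [NExpr.cost, time, Polynomial.eval_add, Polynomial.eval_mul, Polynomial.eval_C,
    Polynomial.eval_X]
  omega

theorem exec_compile {c : Code} (h : c.wellFormed ro) {K : ℕ} {s : Store}
    (hK : ∀ e ∈ c.bounds, e.eval s ≤ K) :
    ∃ t ≤ c.time.eval K, Exec c.compile s t (c.run s) := by
  induction c generalizing s with
  | skip => exact ⟨1, by simp [time], Exec.skip s⟩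
  | nset A i j k e => exact ⟨_, by simp [time], Exec.nset s A i j k e⟩
  | rset A i j k e => exact ⟨_, by simp [time], Exec.rset s A i j k e⟩
  | seq c d hc hd =>
    simp only [wellFormed, Bool.and_eq_true] at h
    obtain ⟨t, ht, hct⟩ := hc h.1 (s := s) fun e he => hK e (List.mem_append_left _ he)
    obtain ⟨t', ht', hdt⟩ := hd h.2 (s := c.run s) fun e he => by
      rw [e.eval_congr fun A hA => run_nat c (notMem_writes h.1 (mem_of_mem_bounds h.2 he hA)) s]
      exact hK e (List.mem_append_right _ he)
    exact ⟨t + t', by simp only [time, Polynomial.eval_add]; omega, hct.seq hdt⟩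
  | ite b c d hc hd =>
    simp only [wellFormed, Bool.and_eq_true] at h
    rw [run]
    by_cases hb : b.Holds s
    · obtain ⟨t, ht, hct⟩ := hc h.1 (s := s) fun e he => hK e (List.mem_append_left _ he)
      exact ⟨b.cost + t, by simp only [time, Polynomial.eval_add, Polynomial.eval_C]; omega,
        by simpa [hb, compile] using hct.ite_true hb⟩
    · obtain ⟨t, ht, hct⟩ := hd h.2 (s := s) fun e he => hK e (List.mem_append_right _ he)
      exact ⟨b.cost + t, by simp only [time, Polynomial.eval_add, Polynomial.eval_C]; omega,
        by simpa [hb, compile] using hct.ite_false hb⟩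
  | count x e c hc => exact exec_count h hK fun s' => hc (s := s') (by
      simp only [wellFormed, Bool.and_eq_true] at h
      exact h.2)

end Compile

end Code

/-! ### Flows in time-expanded networks -/

/-- The contents of an array of the machine. -/
abbrev Table (α : Type*) := ℕ → ℕ → ℕ → α

/-- The nodes of a time-expanded network: pairs of a location and a time. -/
abbrev Node := ℕ × ℕ

/-- The entry of a table at a node. -/
def nodeVal {α : Type*} (V : Table α) (v : Node) : α := V v.1 v.2 0

lemma nodeVal_updateAt {α : Type*} (V : Table α) (a t : ℕ) (y : α) (w : Node) :
    nodeVal (updateAt V a t 0 y) w = if w.1 = a ∧ w.2 = t then y else nodeVal V w := by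
  simp only [nodeVal, updateAt, and_true]

/-- A time-expanded network. Arc `e` has two ends, `0` (the tail) and `1` (the head). In terms of
residual capacities `r`, it can be used from end `d` to end `1 - d` if `r e d 0` is positive, and
the flow on it is `r e 1 0`. The data are tables, as they are found in the store of the machine. -/
structure Net where
  /-- the number of arcs -/
  M : ℕ
  /-- `ends e 0 d` and `ends e 1 d` are the location and the time of end `d` of arc `e` -/
  ends : Table ℕ
  /-- `gain e d 0` is the gain from the use of arc `e` from end `d` to end `1 - d` -/
  gain : Table ℝ
  /-- `dec e d 0` is the amount of residual capacity of arc `e` at end `d` that is used up -/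
  dec : Table ℕ
  /-- the number of locations -/
  l : ℕ
  /-- the last time at which trips may end -/
  T : ℕ

namespace Net

section Defs

variable (G : Net)

/-- End `d` of arc `e`. -/
def node (e d : ℕ) : Node := (G.ends e 0 d, G.ends e 1 d)

/-- The sink, at a time later than all the others. -/
def sink : Node := (0, G.T + 1)

/-- The nodes of a network that are not the sink. -/
def Inner (v : Node) : Prop := v.1 < G.l ∧ v.2 ≤ G.T

/-- Networks in which arcs lead forward in time, from each inner node there is an exit of unlimited
capacity to the sink, and the data of the ends of an arc fit together. -/
structure Proper : Prop where
  inner_tail : ∀ e < G.M, G.Inner (G.node e 0)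
  head : ∀ e < G.M, G.Inner (G.node e 1) ∨ G.node e 1 = G.sink
  exit : ∀ v, G.Inner v → ∃ e < G.M, G.node e 0 = v ∧ G.node e 1 = G.sink ∧ G.dec e 0 0 = 0
  gain_one : ∀ e < G.M, G.gain e 1 0 = - G.gain e 0 0
  dec_one : ∀ e < G.M, G.dec e 1 0 = 1
  time_lt : ∀ e < G.M, (G.node e 0).2 < (G.node e 1).2

/-- Dual feasibility of the potential `V`: the gain from a usable arc never exceeds the loss of
potential. -/
def Valid (r : Table ℕ) (V : Table ℝ) : Prop :=
  ∀ e < G.M, ∀ d < 2, 1 ≤ r e d 0 →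
    G.gain e d 0 + nodeVal V (G.node e (1 - d)) ≤ nodeVal V (G.node e d)

/-- Arc `e` can be used from end `d`, and its gain equals the loss of potential. -/
def Tight (r : Table ℕ) (V : Table ℝ) (e d : ℕ) : Prop :=
  e < G.M ∧ d < 2 ∧ 1 ≤ r e d 0 ∧
    G.gain e d 0 + nodeVal V (G.node e (1 - d)) = nodeVal V (G.node e d)

/-- The tables `r` of residual capacities: arcs with `dec e 0 0 = 0` have no limit, and those with
`dec e 0 0 = 1` have capacity one. -/
def Capacities (r : Table ℕ) : Prop :=
  ∀ e < G.M, (G.dec e 0 0 = 0 → 1 ≤ r e 0 0) ∧ (G.dec e 0 0 = 1 → r e 0 0 + r e 1 0 = 1)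

/-- The outflow minus the inflow at a node. -/
def net (f : ℕ → ℕ) (v : Node) : ℤ :=
  ∑ e ∈ Finset.range G.M,
    (f e : ℤ) * ((if G.node e 0 = v then 1 else 0) - (if G.node e 1 = v then 1 else 0))

/-- The residual capacities after the use of arc `e` from end `d`. -/
def flip (r : Table ℕ) (e d : ℕ) : Table ℕ :=
  updateAt (updateAt r e d 0 (r e d 0 - G.dec e d 0)) e (1 - d) 0 (r e (1 - d) 0 + 1)

/-- The nodes of a tree rooted at `src`, latest first: to each node `w` but the root leads an arc
with property `A`, arc `pe w` from end `pd w`, from an earlier node. -/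
inductive Tree (A : ℕ → ℕ → Prop) (pe pd : Table ℕ) (src : Node) : List Node → Prop
  | root : Tree A pe pd src [src]
  | cons {w : Node} {L : List Node} (notMem : w ∉ L) (tree : Tree A pe pd src L)
      (arc : A (nodeVal pe w) (nodeVal pd w))
      (parent_mem : G.node (nodeVal pe w) (nodeVal pd w) ∈ L)
      (head_eq : G.node (nodeVal pe w) (1 - nodeVal pd w) = w) : Tree A pe pd src (w :: L)

end Defs

variable {G : Net} {e d : ℕ}

lemma not_inner_sink : ¬ G.Inner G.sink := fun h => Nat.not_succ_le_self G.T h.2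

lemma Proper.node (hG : G.Proper) (he : e < G.M) (hd : d < 2) :
    G.Inner (G.node e d) ∨ G.node e d = G.sink := by
  interval_cases d
  exacts [Or.inl (hG.inner_tail e he), hG.head e he]

lemma Proper.gain_flip (hG : G.Proper) (he : e < G.M) (hd : d < 2) :
    G.gain e (1 - d) 0 = - G.gain e d 0 := by
  interval_cases d
  · exact hG.gain_one e he
  · simp [hG.gain_one e he]

lemma Proper.length_le (hG : G.Proper) {L : List Node} (hL : L.Nodup) (h : ∀ v ∈ L, G.Inner v) :
    L.length ≤ G.M := by
  choose! f hf using hG.exit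
  have hcard := Finset.card_le_card_of_injOn (s := L.toFinset) (t := Finset.range G.M) f
    (fun v hv => by simpa using (hf v (h v (by simpa using hv))).1) fun v hv w hw hvw => by
      rw [← (hf v (h v (by simpa using hv))).2.1, ← (hf w (h w (by simpa using hw))).2.1, hvw]
  rwa [List.toFinset_card_of_nodup hL, Finset.card_range] at hcard

section Flow

variable {f f' : ℕ → ℕ} {v : Node}

lemma net_of_eq {c : ℤ} (he : e < G.M) (h : ∀ e', e' ≠ e → f' e' = f e')
    (hc : (f' e : ℤ) = f e + c) (v : Node) :
    G.net f' v = G.net f v +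
      c * ((if G.node e 0 = v then 1 else 0) - (if G.node e 1 = v then 1 else 0)) := by
  have he' : e ∈ Finset.range G.M := Finset.mem_range.2 he
  rw [net, net, ← Finset.add_sum_erase _ _ he', ← Finset.add_sum_erase _ _ he', hc,
    Finset.sum_congr rfl fun e' h' => by rw [h e' (Finset.ne_of_mem_erase h')]]
  ring

lemma exists_arc_of_net_pos (h : 0 < G.net f v) : ∃ e < G.M, 1 ≤ f e ∧ G.node e 0 = v := by
  by_contra! hcon
  refine absurd h (not_lt.2 (Finset.sum_nonpos fun e he => ?_))
  rcases Nat.eq_zero_or_pos (f e) with hf | hf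
  · simp [hf]
  · simp only [hcon e (Finset.mem_range.1 he) hf, if_false]
    split_ifs <;> simp

lemma net_eq_sum_outflow (h : ∀ e < G.M, G.node e 1 = v → f e = 0) :
    G.net f v = ∑ e ∈ Finset.range G.M, (f e : ℤ) * if G.node e 0 = v then 1 else 0 :=
  Finset.sum_congr rfl fun e he => by
    by_cases h1 : G.node e 1 = v
    · simp [h e (Finset.mem_range.1 he) h1]
    · simp [h1]

-- Arcs lead forward in time, so a circulation vanishes on the earliest arcs, then on the next, etc.
lemma Proper.eq_zero_of_net_eq_zero (hG : G.Proper) (h : ∀ v, v ≠ G.sink → G.net f v = 0)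
    (he : e < G.M) : f e = 0 := by
  suffices hbefore : ∀ t, ∀ e < G.M, (G.node e 0).2 < t → f e = 0 from
    hbefore _ e he (Nat.lt_succ_self _)
  intro t
  induction t with
  | zero => exact fun _ _ h0 => absurd h0 (Nat.not_lt_zero _)
  | succ t ih =>
    intro e he ht
    have hnet := h _ fun h0 : G.node e 0 = G.sink => not_inner_sink (h0 ▸ hG.inner_tail e he)
    rw [net_eq_sum_outflow fun e' he' h' => ih e' he' (by have := hG.time_lt e' he'; grind),
      Finset.sum_eq_zero_iff_of_nonneg fun e' _ => by split_ifs <;> simp] at hnet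
    simpa using hnet e (Finset.mem_range.2 he)

end Flow

section Residual

variable {r : Table ℕ} {V V' : Table ℝ}

lemma flip_of_ne {e' : ℕ} (h : e' ≠ e) (d' : ℕ) : G.flip r e d e' d' 0 = r e' d' 0 := by
  simp [flip, updateAt, h]

lemma Tight.valid_flip (hG : G.Proper) (ht : G.Tight r V e d) (hV : G.Valid r V) :
    G.Valid (G.flip r e d) V := by
  obtain ⟨he, hd, -, hgain⟩ := ht
  intro e' he' d' hd' h'
  rcases ne_or_eq e' e with hee | rfl
  · rw [flip_of_ne hee] at h'
    exact hV e' he' d' hd' h'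
  · rcases eq_or_ne d' d with rfl | hdd
    · exact hgain.le
    · obtain rfl : d' = 1 - d := by omega
      rw [hG.gain_flip he hd, show 1 - (1 - d) = d by omega]
      linarith

lemma Tight.capacities_flip (hG : G.Proper) (ht : G.Tight r V e d) (hr : G.Capacities r) :
    G.Capacities (G.flip r e d) := by
  obtain ⟨he, hd, hpos, -⟩ := ht
  intro e' he'
  rcases ne_or_eq e' e with hee | rfl
  · simp only [flip_of_ne hee]
    exact hr e' he'
  · obtain ⟨hfree, hunit⟩ := hr e' he'
    have hdec := hG.dec_one e' he'
    interval_cases d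
    · exact ⟨fun h => by simp [flip, updateAt, h, hfree h],
        fun h => by have := hunit h; simp [flip, updateAt, h]; omega⟩
    · exact ⟨fun _ => by simp [flip, updateAt],
        fun h => by have := hunit h; simp [flip, updateAt, hdec]; omega⟩

lemma Tight.net_flip (hG : G.Proper) (ht : G.Tight r V e d) (v : Node) :
    G.net (fun e' => G.flip r e d e' 1 0) v = G.net (fun e' => r e' 1 0) v +
      (if G.node e d = v then 1 else 0) - (if G.node e (1 - d) = v then 1 else 0) := by
  obtain ⟨he, hd, hpos, -⟩ := ht
  have hdec := hG.dec_one e he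
  interval_cases d
  · rw [net_of_eq (c := 1) he (f := fun e' => r e' 1 0) (fun e' h => flip_of_ne h 1)
      (by simp [flip, updateAt])]
    simp only [Nat.sub_zero]
    ring
  · rw [net_of_eq (c := -1) he (f := fun e' => r e' 1 0) (fun e' h => flip_of_ne h 1)
      (by simp [flip, updateAt, hdec, Nat.cast_sub hpos, sub_eq_add_neg])]
    simp only [Nat.sub_self]
    ring

lemma Valid.of_shift (hV : G.Valid r V) {S : Set Node} {c : ℝ} (hc : 0 ≤ c)
    (hin : ∀ e < G.M, ∀ d < 2, G.node e d ∈ S →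
      nodeVal V' (G.node e d) = nodeVal V (G.node e d) - c)
    (hout : ∀ e < G.M, ∀ d < 2, G.node e d ∉ S →
      nodeVal V' (G.node e d) = nodeVal V (G.node e d))
    (hslack : ∀ e < G.M, ∀ d < 2, 1 ≤ r e d 0 → G.node e d ∈ S → G.node e (1 - d) ∉ S →
      c ≤ nodeVal V (G.node e d) - nodeVal V (G.node e (1 - d)) - G.gain e d 0) :
    G.Valid r V' := by
  intro e he d hd hr
  have h := hV e he d hd hr
  have hd' : 1 - d < 2 := by omega
  by_cases h1 : G.node e d ∈ S <;> by_cases h2 : G.node e (1 - d) ∈ S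
  · rw [hin e he d hd h1, hin e he _ hd' h2]
    linarith
  · have := hslack e he d hd hr h1 h2
    rw [hin e he d hd h1, hout e he _ hd' h2]
    linarith
  · rw [hout e he d hd h1, hin e he _ hd' h2]
    linarith
  · rwa [hout e he d hd h1, hout e he _ hd' h2]

end Residual

namespace Tree

variable {A A' : ℕ → ℕ → Prop} {pe pd pe' pd' : Table ℕ} {src w : Node} {L : List Node}

lemma congr (h : G.Tree A pe pd src L)
    (hA : ∀ e d, G.node e d ∈ L → G.node e (1 - d) ∈ L → A e d → A' e d)
    (hp : ∀ v ∈ L, nodeVal pe' v = nodeVal pe v ∧ nodeVal pd' v = nodeVal pd v) :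
    G.Tree A' pe' pd' src L := by
  induction h with
  | root => exact root
  | @cons w L notMem _ arc parent_mem head_eq ih =>
    obtain ⟨hpe, hpd⟩ := hp w List.mem_cons_self
    have hL : L ⊆ w :: L := List.subset_cons_self w L
    refine cons notMem (ih (fun e d h h' => hA e d (hL h) (hL h')) fun v hv => hp v (hL hv))
      ?_ ?_ ?_ <;> rw [hpe, hpd]
    exacts [hA _ _ (hL parent_mem) (head_eq.symm ▸ List.mem_cons_self) arc, parent_mem, head_eq]

lemma src_mem (h : G.Tree A pe pd src L) : src ∈ L := by
  induction h with
  | root => exact List.mem_cons_self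
  | cons _ _ _ _ _ ih => exact List.mem_cons_of_mem _ ih

lemma nodup (h : G.Tree A pe pd src L) : L.Nodup := by
  induction h with
  | root => exact List.nodup_singleton src
  | cons notMem _ _ _ _ ih => exact List.nodup_cons.2 ⟨notMem, ih⟩

lemma exists_cons (h : G.Tree A pe pd src L) (hw : w ∈ L) :
    ∃ L', G.Tree A pe pd src (w :: L') ∧ L'.length < L.length := by
  induction h with
  | root => exact ⟨[], List.mem_singleton.1 hw ▸ root, Nat.zero_lt_one⟩
  | @cons v L notMem tree arc parent_mem head_eq ih =>
    rcases List.mem_cons.1 hw with rfl | hw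
    · exact ⟨L, cons notMem tree arc parent_mem head_eq, Nat.lt_succ_self _⟩
    · obtain ⟨L', hL', hlt⟩ := ih hw
      exact ⟨L', hL', hlt.trans (Nat.lt_succ_self _)⟩

end Tree

end Net

/-! ### The algorithm -/

namespace Algorithm

open Code

local notation:60 c:61 ";;" d:60 => Code.seq c d

instance (n : ℕ) : OfNat NExpr n := ⟨.const n⟩
instance : Add NExpr := ⟨.add⟩
instance : Sub NExpr := ⟨.sub⟩
instance : Zero RExpr := ⟨.zero⟩
instance : Add RExpr := ⟨.add⟩
instance : Sub RExpr := ⟨.sub⟩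

/-- The test whether two natural numbers are equal. -/
def equal (e f : NExpr) : Test := .and (.nle e f) (.nle f e)

section Eval

variable (s : Store) (A : ℕ) (i j k e f : NExpr) (g h : RExpr) (b c : Test)

@[simp] lemma eval_zero : NExpr.eval s 0 = 0 := rfl
@[simp] lemma eval_one : NExpr.eval s 1 = 1 := rfl
@[simp] lemma eval_two : NExpr.eval s 2 = 2 := rfl
@[simp] lemma eval_three : NExpr.eval s 3 = 3 := rfl
@[simp] lemma eval_const (n : ℕ) : NExpr.eval s (.const n) = n := rfl
@[simp] lemma eval_cell :
    NExpr.eval s (.cell A i j k) = s.nat A (i.eval s) (j.eval s) (k.eval s) := rfl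
@[simp] lemma eval_add : (e + f).eval s = e.eval s + f.eval s := rfl
@[simp] lemma eval_sub : (e - f).eval s = e.eval s - f.eval s := rfl
@[simp] lemma evalReal_zero : RExpr.eval s 0 = 0 := rfl
@[simp] lemma evalReal_cell :
    RExpr.eval s (.cell A i j k) = s.real A (i.eval s) (j.eval s) (k.eval s) := rfl
@[simp] lemma evalReal_add : (g + h).eval s = g.eval s + h.eval s := rfl
@[simp] lemma evalReal_sub : (g - h).eval s = g.eval s - h.eval s := rfl
@[simp] lemma holds_nle : (Test.nle e f).Holds s ↔ e.eval s ≤ f.eval s := Iff.rfl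
@[simp] lemma holds_rle : (Test.rle g h).Holds s ↔ g.eval s ≤ h.eval s := Iff.rfl
@[simp] lemma holds_and : (Test.and b c).Holds s ↔ b.Holds s ∧ c.Holds s := Iff.rfl
@[simp] lemma holds_equal : (equal e f).Holds s ↔ e.eval s = f.eval s := le_antisymm_iff.symm

end Eval

-- The arrays of natural numbers, apart from those that hold the input and the output: the ends of
-- the arcs of the network, their residual capacities and decrements, the number of arcs; membership
-- of nodes in the tree, the arc leading to a node of the tree, and the end from which it leads to
-- the node; counters for drivers or riders, rounds, arcs, origins, destinations and times; whether
-- an arc has been found, the arc, and its end; location and time of the current node.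
local notation "ENDS" => 10
local notation "RESIDUAL" => 11
local notation "DEC" => 12
local notation "ARCS" => 13
local notation "TREE" => 14
local notation "PARENTARC" => 15
local notation "PARENTEND" => 16
local notation "AGENT" => 20
local notation "ROUND" => 21
local notation "ARC" => 22
local notation "ORIG" => 23
local notation "DEST" => 24
local notation "TIME" => 25
local notation "FOUND" => 26
local notation "FOUNDARC" => 27
local notation "FOUNDEND" => 28
local notation "NODELOC" => 29
local notation "NODETIME" => 30

-- The arrays of real numbers, apart from those that hold the input and the output: the gains from
-- the arcs, the potential of the nodes, the least slack, the sum of the values of the riders, and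
-- the initial potential as a function of time.
local notation "GAIN" => 10
local notation "POTENTIAL" => 11
local notation "SLACK" => 12
local notation "VALUES" => 13
local notation "LEVEL" => 14

/-- Assignment to a scalar variable. -/
abbrev assign (x : ℕ) (e : NExpr) : Code := nset x 0 0 0 e

section Access

variable (i j a b t Δ e d : NExpr)

/-- The number of locations. -/
abbrev locs : NExpr := .cell 0 0 0 0

/-- The number of drivers. -/
abbrev drivers : NExpr := .cell 0 1 0 0

/-- The number of riders. -/
abbrev riders : NExpr := .cell 0 2 0 0

/-- The length of the planning horizon. -/
abbrev horizon : NExpr := .cell 0 3 0 0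

/-- The time needed to travel from `a` to `b`. -/
abbrev travelTime : NExpr := .cell 1 a b 0

/-- The entrance status of driver `i`. -/
abbrev entered : NExpr := .cell 2 i 0 0

/-- The entrance location of driver `i`. -/
abbrev entryLoc : NExpr := .cell 2 i 1 0

/-- The entrance time of driver `i`. -/
abbrev entryTime : NExpr := .cell 2 i 2 0

/-- The origin of the trip of rider `j`. -/
abbrev requestOrig : NExpr := .cell 3 j 0 0

/-- The destination of the trip of rider `j`. -/
abbrev requestDest : NExpr := .cell 3 j 1 0

/-- The starting time of the trip of rider `j`. -/
abbrev requestStart : NExpr := .cell 3 j 2 0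

/-- The cost of the trip `(a, b, t)`. -/
abbrev tripCost : RExpr := .cell 0 a b t

/-- The cost of exiting `Δ` periods before the horizon. -/
abbrev exitCost : RExpr := .cell 1 Δ 0 0

/-- The value of rider `j`. -/
abbrev value : RExpr := .cell 2 j 0 0

/-- The location of end `d` of arc `e`. -/
abbrev arcLoc : NExpr := .cell ENDS e 0 d

/-- The time of end `d` of arc `e`. -/
abbrev arcTime : NExpr := .cell ENDS e 1 d

/-- The residual capacity of arc `e` at end `d`. -/
abbrev residual : NExpr := .cell RESIDUAL e d 0

/-- The potential of end `d` of arc `e`. -/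
abbrev arcPotential : RExpr := .cell POTENTIAL (arcLoc e d) (arcTime e d) 0

/-- Whether end `d` of arc `e` is in the tree. -/
abbrev arcInTree : NExpr := .cell TREE (arcLoc e d) (arcTime e d) 0

/-- The slack of arc `e`, used from end `d` to end `d'`. -/
abbrev arcSlack (d' : NExpr) : RExpr :=
  arcPotential e d - arcPotential e d' - .cell GAIN e d 0

end Access

section Network

/-- Append an arc from `(a, t)` to `(b, u)` with gain `g` and decrement `c`. -/
def addArc (a t b u : NExpr) (g : RExpr) (c : NExpr) : Code :=
  nset ENDS (var ARCS) 0 0 a ;; nset ENDS (var ARCS) 1 0 t ;;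
  nset ENDS (var ARCS) 0 1 b ;; nset ENDS (var ARCS) 1 1 u ;;
  rset GAIN (var ARCS) 0 0 g ;; rset GAIN (var ARCS) 1 0 (0 - g) ;;
  nset DEC (var ARCS) 0 0 c ;; nset DEC (var ARCS) 1 0 1 ;; nset RESIDUAL (var ARCS) 0 0 1 ;;
  nset RESIDUAL (var ARCS) 1 0 0 ;; assign ARCS (var ARCS + 1)

/-- For every driver an arc for her empty path. -/
def addEmptyPaths : Code :=
  count AGENT drivers
    (ite (.nle (entered (var AGENT)) 0)
      (addArc (entryLoc (var AGENT)) (entryTime (var AGENT)) 0 (horizon + 1) 0 1)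
      (addArc (entryLoc (var AGENT)) (entryTime (var AGENT)) 0 (horizon + 1)
        (0 - exitCost (horizon - entryTime (var AGENT))) 1))

/-- For every rider an arc for her trip. -/
def addRiders : Code :=
  count AGENT riders
    (addArc (requestOrig (var AGENT)) (requestStart (var AGENT)) (requestDest (var AGENT))
      (requestStart (var AGENT) +
        travelTime (requestOrig (var AGENT)) (requestDest (var AGENT)))
      (value (var AGENT) - tripCost (requestOrig (var AGENT)) (requestDest (var AGENT))
        (requestStart (var AGENT))) 1)

/-- For every location and time an arc for exiting. -/
def addExits : Code :=
  count ORIG locs (count TIME (horizon + 1)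
    (addArc (var ORIG) (var TIME) 0 (horizon + 1) (0 - exitCost (horizon - var TIME)) 0))

/-- For every feasible trip an arc for relocations. -/
def addRelocations : Code :=
  count ORIG locs (count DEST locs (count TIME (horizon + 1)
    (ite (.nle (var TIME + travelTime (var ORIG) (var DEST)) horizon)
      (addArc (var ORIG) (var TIME) (var DEST) (var TIME + travelTime (var ORIG) (var DEST))
        (0 - tripCost (var ORIG) (var DEST) (var TIME)) 0)
      skip)))

/-- The construction of the network. -/
def network : Code := addEmptyPaths ;; addRiders ;; addExits ;; addRelocations

/-- The sum of the riders' values. -/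
def sumValues : Code :=
  count AGENT riders (rset VALUES 0 0 0 (.cell VALUES 0 0 0 + value (var AGENT)))

/-- The multiples of the sum of the riders' values by the remaining time. -/
def setLevels : Code :=
  count TIME (horizon + 1)
    (rset LEVEL (horizon - var TIME) 0 0
      (.cell LEVEL (horizon + 1 - var TIME) 0 0 + .cell VALUES 0 0 0))

/-- The initial potential of the nodes other than the sink. -/
def setPotential : Code :=
  count ORIG locs (count TIME (horizon + 1)
    (rset POTENTIAL (var ORIG) (var TIME) 0 (.cell LEVEL (var TIME) 0 0)))

/-- The initial potential: the sum of the riders' values times the remaining time. -/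
def initPotential : Code := sumValues ;; setLevels ;; setPotential

/-- The construction of the network and of the initial potential. -/
def setup : Code := network ;; initPotential

end Network

section Route

/-- Remove all nodes from the tree. -/
def clearTree : Code :=
  count ORIG locs (count TIME (horizon + 2) (nset TREE (var ORIG) (var TIME) 0 0))

/-- Begin the tree of the current driver. -/
def initTree : Code := clearTree ;; nset TREE (entryLoc (var AGENT)) (entryTime (var AGENT)) 0 1

/-- Record the current arc, used from end `d` to end `d'`, if it leaves the tree with less slack
than the arc found so far. -/
def probe (d d' : ℕ) : Code :=
  ite (.and (.nle 1 (arcInTree (var ARC) (.const d)))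
      (.and (.nle (arcInTree (var ARC) (.const d')) 0)
        (.nle 1 (residual (var ARC) (.const d)))))
    (ite (.and (.nle 1 (var FOUND))
        (.rle (.cell SLACK 0 0 0) (arcSlack (var ARC) (.const d) (.const d'))))
      skip
      (rset SLACK 0 0 0 (arcSlack (var ARC) (.const d) (.const d')) ;;
        assign FOUND 1 ;; assign FOUNDARC (var ARC) ;; assign FOUNDEND (.const d)))
    skip

/-- Find an arc of least slack that leaves the tree. -/
def scan : Code := assign FOUND 0 ;; count ARC (var ARCS) (probe 0 1 ;; probe 1 0)

/-- Lower the potential on the tree by the least slack. -/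
def lower : Code :=
  count ORIG locs (count TIME (horizon + 2)
    (ite (.nle 1 (.cell TREE (var ORIG) (var TIME) 0))
      (rset POTENTIAL (var ORIG) (var TIME) 0
        (.cell POTENTIAL (var ORIG) (var TIME) 0 - .cell SLACK 0 0 0))
      skip))

/-- Write `e` into array `A` at the node to which the arc found leads. -/
abbrev setAtHead (A : ℕ) (e : NExpr) : Code :=
  nset A (arcLoc (var FOUNDARC) (1 - var FOUNDEND)) (arcTime (var FOUNDARC) (1 - var FOUNDEND)) 0 e

/-- Add the node to which the arc found leads to the tree. -/
def attach : Code :=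
  setAtHead PARENTARC (var FOUNDARC) ;; setAtHead PARENTEND (var FOUNDEND) ;; setAtHead TREE 1

/-- Grow the tree until it contains the sink. -/
def grow : Code :=
  count ROUND (var ARCS)
    (ite (.nle (.cell TREE 0 (horizon + 1) 0) 0) (scan ;; lower ;; attach) skip)

/-- Use the arc that leads to the current node, and go to its beginning. -/
def stepBack : Code :=
  assign FOUNDARC (.cell PARENTARC (var NODELOC) (var NODETIME) 0) ;;
  assign FOUNDEND (.cell PARENTEND (var NODELOC) (var NODETIME) 0) ;;
  nset RESIDUAL (var FOUNDARC) (var FOUNDEND) 0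
    (residual (var FOUNDARC) (var FOUNDEND) - .cell DEC (var FOUNDARC) (var FOUNDEND) 0) ;;
  nset RESIDUAL (var FOUNDARC) (1 - var FOUNDEND) 0
    (residual (var FOUNDARC) (1 - var FOUNDEND) + 1) ;;
  assign NODELOC (arcLoc (var FOUNDARC) (var FOUNDEND)) ;;
  assign NODETIME (arcTime (var FOUNDARC) (var FOUNDEND))

/-- Use the arcs on the path in the tree from the entrance of the current driver to the sink. -/
def augment : Code :=
  assign NODELOC 0 ;; assign NODETIME (horizon + 1) ;;
  count ROUND (var ARCS + 1)
    (ite (.and (equal (var NODELOC) (entryLoc (var AGENT)))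
        (equal (var NODETIME) (entryTime (var AGENT))))
      skip stepBack)

/-- Route each driver in turn along a shortest augmenting path from her entrance to the sink. -/
def route : Code := count AGENT drivers (initTree ;; grow ;; augment)

end Route

section Output

/-- Output the trip prices. -/
def writePrices : Code :=
  count ORIG locs (count DEST locs (count TIME (horizon + 1)
    (rset 3 (var ORIG) (var DEST) (var TIME) (tripCost (var ORIG) (var DEST) (var TIME) +
      .cell POTENTIAL (var ORIG) (var TIME) 0 -
      .cell POTENTIAL (var DEST) (var TIME + travelTime (var ORIG) (var DEST)) 0))))

/-- Output the pick-ups; the arcs of the riders follow those for the empty paths of the drivers. -/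
def writePickUps : Code :=
  count AGENT riders (nset 4 (var AGENT) 0 0 (residual (drivers + var AGENT) 1))

/-- Find an arc with flow, other than those for empty paths, that leaves the current node. -/
def findArc : Code :=
  count ARC (var ARCS)
    (ite (.and (.nle drivers (var ARC)) (.and (.nle 1 (residual (var ARC) 1))
        (.and (equal (var NODELOC) (arcLoc (var ARC) 0))
          (equal (var NODETIME) (arcTime (var ARC) 0)))))
      (assign FOUNDARC (var ARC)) skip)

/-- Append a trip along the arc found to the action path of the current driver. -/
def recordTrip : Code :=
  nset 6 (var AGENT) (.cell 5 (var AGENT) 0 0) 0 (var NODELOC) ;;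
  nset 6 (var AGENT) (.cell 5 (var AGENT) 0 0) 1 (arcLoc (var FOUNDARC) 1) ;;
  nset 6 (var AGENT) (.cell 5 (var AGENT) 0 0) 2 (var NODETIME) ;;
  ite (.nle (drivers + riders) (var FOUNDARC))
    (nset 6 (var AGENT) (.cell 5 (var AGENT) 0 0) 3 0)
    (nset 6 (var AGENT) (.cell 5 (var AGENT) 0 0) 3 (var FOUNDARC - drivers + 1)) ;;
  nset 5 (var AGENT) 0 0 (.cell 5 (var AGENT) 0 0 + 1)

/-- Go to the node to which the arc found leads. -/
def advance : Code :=
  assign NODELOC (arcLoc (var FOUNDARC) 1) ;; assign NODETIME (arcTime (var FOUNDARC) 1)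

/-- Follow one unit of flow along the arc found. -/
def traverse : Code :=
  nset RESIDUAL (var FOUNDARC) 1 0 (residual (var FOUNDARC) 1 - 1) ;;
  ite (.nle (arcTime (var FOUNDARC) 1) horizon) recordTrip skip ;; advance

/-- Follow the flow from the entrance of the current driver to the sink. -/
def follow : Code :=
  assign NODELOC (entryLoc (var AGENT)) ;; assign NODETIME (entryTime (var AGENT)) ;;
  count ROUND (horizon + 1) (ite (.nle (var NODETIME) horizon) (findArc ;; traverse) skip)

/-- Output the action paths. -/
def writePaths : Code :=
  count AGENT drivers (ite (.nle (residual (var AGENT) 1) 0) follow skip)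

end Output

/-- The algorithm, once the network has been constructed. -/
def solve : Code := route ;; writePrices ;; writePickUps ;; writePaths

lemma wellFormed_setup : setup.wellFormed [0] := by decide

lemma wellFormed_solve : solve.wellFormed [0, ARCS] := by decide

variable {l n m : ℕ}

/-! ### The network of an economy -/

/-- The store contains the data of the economy. -/
structure Input (E : Economy (Fin l) (Fin n) (Fin m)) (s : Store) : Prop where
  nat : ∀ A < 4, s.nat A = (inputStore E).nat A
  real : ∀ A < 3, s.real A = (inputStore E).real A

namespace Input

variable {E : Economy (Fin l) (Fin n) (Fin m)} {s : Store}

lemma inputStore (E : Economy (Fin l) (Fin n) (Fin m)) : Input E (inputStore E) :=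
  ⟨fun _ _ => rfl, fun _ _ => rfl⟩

lemma of_frame (h : Input E s) {c : Code} {s' : Store} (hs : c.Frame s s')
    (hn : ∀ A ∈ c.writes, 4 ≤ A := by decide) (hr : ∀ A ∈ c.realWrites, 3 ≤ A := by decide) :
    Input E s' where
  nat A hA := (hs.nat A fun hw => hA.not_ge (hn A hw)).trans (h.nat A hA)
  real A hA := (hs.real A fun hw => hA.not_ge (hr A hw)).trans (h.real A hA)

lemma locs (h : Input E s) : s.nat 0 0 0 0 = l := by rw [h.nat 0 (by decide)]; rfl

lemma drivers (h : Input E s) : s.nat 0 1 0 0 = n := by rw [h.nat 0 (by decide)]; rfl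

lemma riders (h : Input E s) : s.nat 0 2 0 0 = m := by rw [h.nat 0 (by decide)]; rfl

lemma horizon (h : Input E s) : s.nat 0 3 0 0 = E.T := by rw [h.nat 0 (by decide)]; rfl

lemma travelTime (h : Input E s) (a b : Fin l) : s.nat 1 a b 0 = E.dist a b := by
  simp [h.nat 1, Rideshare.inputStore, extend]

lemma entered (h : Input E s) (i : Fin n) : s.nat 2 i 0 0 = (E.entered i).toNat := by
  simp [h.nat 2, Rideshare.inputStore, extend]

lemma entryLoc (h : Input E s) (i : Fin n) : s.nat 2 i 1 0 = E.entryLoc i := by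
  simp [h.nat 2, Rideshare.inputStore, extend]

lemma entryTime (h : Input E s) (i : Fin n) : s.nat 2 i 2 0 = E.entryTime i := by
  simp [h.nat 2, Rideshare.inputStore, extend]

lemma requestOrig (h : Input E s) (j : Fin m) : s.nat 3 j 0 0 = (E.request j).orig := by
  simp [h.nat 3, Rideshare.inputStore, extend]

lemma requestDest (h : Input E s) (j : Fin m) : s.nat 3 j 1 0 = (E.request j).dest := by
  simp [h.nat 3, Rideshare.inputStore, extend]

lemma requestStart (h : Input E s) (j : Fin m) : s.nat 3 j 2 0 = (E.request j).start := by
  simp [h.nat 3, Rideshare.inputStore, extend]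

lemma tripCost (h : Input E s) {r : Trip (Fin l)} (hr : r ∈ E.trips) :
    s.real 0 r.orig r.dest r.start = E.tripCost r := by
  have hle : r.start + E.dist r.orig r.dest ≤ E.T := hr
  simp [h.real 0, Rideshare.inputStore, extend, hle]

lemma exitCost (h : Input E s) {Δ : ℕ} (hΔ : Δ ≤ E.T) : s.real 1 Δ 0 0 = E.exitCost Δ := by
  simp [h.real 1, Rideshare.inputStore, hΔ]

lemma value (h : Input E s) (j : Fin m) : s.real 2 j 0 0 = E.value j := by
  simp [h.real 2, Rideshare.inputStore, extend]

end Input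

/-- The data of an arc; `unit` is `1` if it has capacity one and `0` if there is no limit. -/
structure Row where
  /-- the node at which the arc begins -/
  tail : Node
  /-- the node at which the arc ends -/
  head : Node
  /-- the gain from the use of the arc -/
  gain : ℝ
  /-- the amount of residual capacity that is used up by the use of the arc -/
  unit : ℕ

/-- Arc `e` of a network has the data `R`. -/
structure IsRow (G : Net) (e : ℕ) (R : Row) : Prop where
  tail : G.node e 0 = R.tail
  head : G.node e 1 = R.head
  gain : G.gain e 0 0 = R.gain
  gain_one : G.gain e 1 0 = - R.gain
  dec : G.dec e 0 0 = R.unit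
  dec_one : G.dec e 1 0 = 1

/-- The network in a store. -/
def netOf (s : Store) : Net where
  M := s.nat ARCS 0 0 0
  ends := s.nat ENDS
  gain := s.real GAIN
  dec := s.nat DEC
  l := s.nat 0 0 0 0
  T := s.nat 0 3 0 0

lemma netOf_congr {s s' : Store} (hn : ∀ A ∈ [0, ENDS, DEC, ARCS], s'.nat A = s.nat A)
    (hr : s'.real GAIN = s.real GAIN) : netOf s' = netOf s := by
  simp only [List.forall_mem_cons] at hn
  simp only [netOf, hn, hr]

lemma netOf_frame {c : Code} {s s' : Store} (hs : c.Frame s s')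
    (hn : ∀ A ∈ [0, ENDS, DEC, ARCS], A ∉ c.writes := by decide)
    (hr : GAIN ∉ c.realWrites := by decide) : netOf s' = netOf s :=
  netOf_congr (fun A hA => hs.nat A (hn A hA)) (hs.real GAIN hr)

/-- The store holds the arcs listed, with no flow. -/
structure HoldsArcs (s : Store) (L : List Row) : Prop where
  length : s.nat ARCS 0 0 0 = L.length
  row : ∀ e R, L[e]? = some R → IsRow (netOf s) e R
  residual : ∀ e < L.length, s.nat RESIDUAL e 0 0 = 1 ∧ s.nat RESIDUAL e 1 0 = 0

namespace HoldsArcs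

variable {s : Store} {L : List Row}

lemma setNat (h : HoldsArcs s L) {x : ℕ} (hx : x ∉ [0, ENDS, RESIDUAL, DEC, ARCS]) (v : ℕ) :
    HoldsArcs (s.setNat x 0 0 0 v) L := by
  simp only [List.mem_cons, List.not_mem_nil, or_false, not_or] at hx
  have hnet : netOf (s.setNat x 0 0 0 v) = netOf s :=
    netOf_congr (by simp [Ne.symm hx.1, Ne.symm hx.2.1, Ne.symm hx.2.2.2.1, Ne.symm hx.2.2.2.2]) rfl
  refine ⟨?_, by rw [hnet]; exact h.row, ?_⟩
  · rw [s.setNat_nat_of_ne _ _ _ _ (Ne.symm hx.2.2.2.2)]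
    exact h.length
  · rw [s.setNat_nat_of_ne _ _ _ _ (Ne.symm hx.2.2.1)]
    exact h.residual

lemma addArc (h : HoldsArcs s L) {a t b u c : NExpr} {g : RExpr} {R : Row}
    (hR : R = ⟨(a.eval s, t.eval s), (b.eval s, u.eval s), g.eval s, c.eval s⟩)
    (ht : ENDS ∉ t.arrays := by decide) (hb : ENDS ∉ b.arrays := by decide)
    (hu : ENDS ∉ u.arrays := by decide) (hc : ENDS ∉ c.arrays := by decide)
    (hg : ENDS ∉ g.arrays := by decide) (hg' : GAIN ∉ g.realArrays := by decide) :
    HoldsArcs ((addArc a t b u g c).run s) (L ++ [R]) := by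
  obtain ⟨hlen, hrow, hres⟩ := h
  have hrun : (Algorithm.addArc a t b u g c).run s =
      ((((((((((s.setNat ENDS L.length 0 0 (a.eval s)).setNat ENDS L.length 1 0 (t.eval s)).setNat
        ENDS L.length 0 1 (b.eval s)).setNat ENDS L.length 1 1 (u.eval s)).setReal
        GAIN L.length 0 0 (g.eval s)).setReal GAIN L.length 1 0 (- g.eval s)).setNat
        DEC L.length 0 0 (c.eval s)).setNat DEC L.length 1 0 1).setNat
        RESIDUAL L.length 0 0 1).setNat RESIDUAL L.length 1 0 0).setNat
        ARCS 0 0 0 (L.length + 1) := by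
    simp [Algorithm.addArc, run, NExpr.eval_setNat, NExpr.eval_setReal, RExpr.eval_setNat,
      RExpr.eval_setReal, *]
  rw [hrun]
  refine ⟨by simp, fun e R' he => ?_, fun e he => ?_⟩
  · rcases lt_trichotomy e L.length with hlt | rfl | hgt
    · rw [List.getElem?_append_left hlt] at he
      obtain ⟨htail, hhead, hgain, hgain', hdec, hdec'⟩ := hrow e R' he
      constructor <;> simpa [netOf, Net.node, updateAt, hlt.ne]
    · obtain rfl : R = R' := by simpa using he
      subst hR
      constructor <;> simp [netOf, Net.node, updateAt]
    · simp [List.getElem?_append_right hgt.le, Nat.sub_ne_zero_of_lt hgt] at he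
  · rcases Nat.lt_succ_iff_lt_or_eq.1 (by simpa using he) with hlt | rfl
    · simp [updateAt, hlt.ne, hres e hlt]
    · simp [updateAt]

lemma count (h : HoldsArcs s L) {x : ℕ} {e : NExpr} {c : Code} {N : ℕ} (f : Fin N → List Row)
    (hN : e.eval s = N) (hx : x ∉ [0, ENDS, RESIDUAL, DEC, ARCS])
    (body : ∀ (k : Fin N) (s' : Store) (L' : List Row), s'.nat x 0 0 0 = k →
      (count x e c).Frame s s' → HoldsArcs s' L' → HoldsArcs (c.run s') (L' ++ f k)) :
    HoldsArcs ((count x e c).run s) (L ++ (List.finRange N).flatMap f) := by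
  have key := run_count (c := c)
    (fun k s' => HoldsArcs s' (L ++ ((List.finRange N).take k).flatMap f)) hN
    (fun _ _ v h' => h'.setNat hx v) (by simpa using h) fun k hk s' hk' hs' h' => by
      have hbody := body ⟨k, hk⟩ s' _ hk' hs' h'
      rwa [List.take_succ_eq_append_getElem (by simpa using hk), List.flatMap_append,
        ← List.append_assoc, List.getElem_finRange, List.flatMap_singleton]
  rwa [List.take_of_length_le (by simp)] at key

end HoldsArcs

section Rows

variable (E : Economy (Fin l) (Fin n) (Fin m))

/-- The arc for the empty path of a driver. -/
noncomputable def emptyPathRow (i : Fin n) : Row :=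
  ⟨(E.entryLoc i, E.entryTime i), (0, E.T + 1), - E.pathCost i [], 1⟩

/-- The arc for a rider. -/
def riderRow (j : Fin m) : Row :=
  ⟨((E.request j).orig, (E.request j).start), ((E.request j).dest, E.arrival (E.request j)),
    E.value j - E.tripCost (E.request j), 1⟩

/-- The arc for exiting. -/
def exitRow (a : Fin l) (t : ℕ) : Row := ⟨(a, t), (0, E.T + 1), - E.exitCost (E.T - t), 0⟩

/-- The arc for relocating. -/
def relocationRow (r : Trip (Fin l)) : Row :=
  ⟨(r.orig, r.start), (r.dest, E.arrival r), - E.tripCost r, 0⟩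

/-- The arcs for exiting. -/
def exitRows : List Row :=
  (List.finRange l).flatMap fun a =>
    (List.finRange (E.T + 1)).flatMap fun t : Fin (E.T + 1) => [exitRow E a t]

/-- The arcs for relocating. -/
def relocationRows : List Row :=
  (List.finRange l).flatMap fun a => (List.finRange l).flatMap fun b =>
    (List.finRange (E.T + 1)).flatMap fun t : Fin (E.T + 1) =>
      if (t : ℕ) + E.dist a b ≤ E.T then [relocationRow E ⟨a, b, t⟩] else []

/-- The arcs of unlimited capacity. -/
def freeRows : List Row := exitRows E ++ relocationRows E

/-- All the arcs. -/
noncomputable def rows : List Row :=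
  (List.finRange n).map (emptyPathRow E) ++ (List.finRange m).map (riderRow E) ++ freeRows E

variable {E} {s : Store} {L : List Row}

lemma holdsArcs_addEmptyPaths (hE : Input E s) (h : HoldsArcs s L) :
    HoldsArcs (addEmptyPaths.run s) (L ++ (List.finRange n).map (emptyPathRow E)) := by
  rw [List.map_eq_flatMap]
  refine h.count _ hE.drivers (by decide) fun i s' L' hi hs' h' => ?_
  have hE' : Input E s' := hE.of_frame hs'
  have hcost := hE'.exitCost (Δ := E.T - E.entryTime i) (by omega)
  rw [run]
  split_ifs with hb
  · refine h'.addArc ?_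
    have : E.entered i = false := by simpa [hi, hE'.entered] using hb
    simp [emptyPathRow, hi, hE'.entryLoc, hE'.entryTime, hE'.horizon, Economy.pathCost, this]
  · refine h'.addArc ?_
    have : E.entered i = true := by simpa [hi, hE'.entered] using hb
    simp [emptyPathRow, hi, hE'.entryLoc, hE'.entryTime, hE'.horizon, Economy.pathCost, this,
      Economy.endTime, hcost]

lemma holdsArcs_addRiders (hE : Input E s) (h : HoldsArcs s L) :
    HoldsArcs (addRiders.run s) (L ++ (List.finRange m).map (riderRow E)) := by
  rw [List.map_eq_flatMap]
  refine h.count _ hE.riders (by decide) fun j s' L' hj hs' h' => h'.addArc ?_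
  have hE' : Input E s' := hE.of_frame hs'
  simp [riderRow, hj, hE'.requestOrig, hE'.requestDest, hE'.requestStart, hE'.travelTime, hE'.value,
    hE'.tripCost (E.request_mem j), Economy.arrival]

lemma holdsArcs_addExits (hE : Input E s) (h : HoldsArcs s L) :
    HoldsArcs (addExits.run s) (L ++ exitRows E) := by
  refine h.count _ hE.locs (by decide) fun a s₁ L₁ ha hs₁ h₁ => ?_
  have hE₁ : Input E s₁ := hE.of_frame hs₁
  refine h₁.count (N := E.T + 1) _ (by simpa using hE₁.horizon) (by decide)
    fun t s₂ L₂ ht hs₂ h₂ => h₂.addArc ?_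
  have hE₂ : Input E s₂ := hE₁.of_frame hs₂
  have ha₂ : s₂.nat ORIG 0 0 0 = a := by rw [hs₂.nat ORIG (by decide), ha]
  simp [exitRow, ha₂, ht, hE₂.horizon, hE₂.exitCost (Δ := E.T - t) (by omega)]

lemma holdsArcs_addRelocations (hE : Input E s) (h : HoldsArcs s L) :
    HoldsArcs (addRelocations.run s) (L ++ relocationRows E) := by
  refine h.count _ hE.locs (by decide) fun a s₁ L₁ ha hs₁ h₁ => ?_
  have hE₁ : Input E s₁ := hE.of_frame hs₁
  refine h₁.count _ hE₁.locs (by decide) fun b s₂ L₂ hb hs₂ h₂ => ?_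
  have hE₂ : Input E s₂ := hE₁.of_frame hs₂
  refine h₂.count (N := E.T + 1) _ (by simpa using hE₂.horizon) (by decide)
    fun t s₃ L₃ ht hs₃ h₃ => ?_
  have hE₃ : Input E s₃ := hE₂.of_frame hs₃
  have ha₃ : s₃.nat ORIG 0 0 0 = a := by
    rw [hs₃.nat ORIG (by decide), hs₂.nat ORIG (by decide), ha]
  have hb₃ : s₃.nat DEST 0 0 0 = b := by rw [hs₃.nat DEST (by decide), hb]
  simp only [run, holds_nle, eval_add, eval_cell, eval_zero, eval_const, eval_three, ha₃,
    hb₃, ht, hE₃.horizon, hE₃.travelTime]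
  split_ifs with hle
  · refine h₃.addArc ?_
    have hcost := hE₃.tripCost (r := ⟨a, b, t⟩) hle
    simp only at hcost
    simp [relocationRow, ha₃, hb₃, ht, hE₃.travelTime, Economy.arrival, hcost]
  · simpa using h₃

lemma holdsArcs_network (E : Economy (Fin l) (Fin n) (Fin m)) :
    HoldsArcs (network.run (inputStore E)) (rows E) := by
  have h₀ : HoldsArcs (inputStore E) [] := ⟨rfl, by simp, by simp⟩
  have hE₀ := Input.inputStore E
  have hE₁ := hE₀.of_frame (frame_run addEmptyPaths _)
  have hE₂ := hE₁.of_frame (frame_run addRiders _)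
  have hE₃ := hE₂.of_frame (frame_run addExits _)
  have h₄ := holdsArcs_addRelocations hE₃ <| holdsArcs_addExits hE₂ <|
    holdsArcs_addRiders hE₁ <| holdsArcs_addEmptyPaths hE₀ h₀
  rwa [List.nil_append, List.append_assoc _ (exitRows E)] at h₄

lemma getElem?_rows_emptyPath (i : Fin n) : (rows E)[(i : ℕ)]? = some (emptyPathRow E i) := by
  simp [rows, List.getElem?_append]

lemma getElem?_rows_rider (j : Fin m) : (rows E)[n + j]? = some (riderRow E j) := by
  simp [rows, List.getElem?_append]

lemma getElem?_rows_free (k : ℕ) : (rows E)[n + m + k]? = (freeRows E)[k]? := by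
  rw [rows, List.getElem?_append_right (by simp)]
  simp

lemma mem_exitRows {R : Row} :
    R ∈ exitRows E ↔ ∃ (a : Fin l) (t : ℕ), t ≤ E.T ∧ R = exitRow E a t := by
  simp only [exitRows, List.mem_flatMap, List.mem_finRange, true_and, List.mem_singleton]
  constructor
  · rintro ⟨a, t, h⟩
    exact ⟨a, t, by omega, h⟩
  · rintro ⟨a, t, ht, h⟩
    exact ⟨a, ⟨t, by omega⟩, h⟩

lemma mem_relocationRows {R : Row} :
    R ∈ relocationRows E ↔ ∃ r ∈ E.trips, R = relocationRow E r := by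
  simp only [relocationRows, List.mem_flatMap, List.mem_finRange, true_and, List.mem_ite_nil_right,
    List.mem_singleton]
  constructor
  · rintro ⟨a, b, t, hle, h⟩
    exact ⟨⟨a, b, t⟩, hle, h⟩
  · rintro ⟨r, hr, h⟩
    have hle : r.start + E.dist r.orig r.dest ≤ E.T := hr
    exact ⟨r.orig, r.dest, ⟨r.start, by omega⟩, hle, h⟩

lemma length_flatMap_finRange_le {β : Type*} {N K : ℕ} {f : Fin N → List β}
    (h : ∀ k, (f k).length ≤ K) : ((List.finRange N).flatMap f).length ≤ N * K := by
  rw [List.length_flatMap]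
  refine (List.sum_le_card_nsmul _ K ?_).trans (by simp)
  simpa using h

lemma length_rows_le (E : Economy (Fin l) (Fin n) (Fin m)) :
    (rows E).length ≤ n + m + (l * (E.T + 1) + l * (l * (E.T + 1))) := by
  have hexit : (exitRows E).length ≤ l * (E.T + 1) := length_flatMap_finRange_le fun a => by simp
  have hrelocation : (relocationRows E).length ≤ l * (l * (E.T + 1)) :=
    length_flatMap_finRange_le fun a => length_flatMap_finRange_le fun b => by
      refine (length_flatMap_finRange_le (K := 1) fun t => ?_).trans (mul_one _).le
      split_ifs <;> simp
  simp only [rows, freeRows, List.length_append, List.length_map, List.length_finRange]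
  omega

end Rows

/-- The arcs of the network are those listed in `rows E`. -/
structure Represents (E : Economy (Fin l) (Fin n) (Fin m)) (G : Net) : Prop where
  l_eq : G.l = l
  T_eq : G.T = E.T
  M_eq : G.M = (rows E).length
  row : ∀ e R, (rows E)[e]? = some R → IsRow G e R

namespace Represents

variable {E : Economy (Fin l) (Fin n) (Fin m)} {G : Net} {e : ℕ}

lemma M_eq_add (h : Represents E G) : G.M = n + m + (freeRows E).length := by
  simp [h.M_eq, rows, Nat.add_assoc]

lemma emptyPath (h : Represents E G) (i : Fin n) : IsRow G i (emptyPathRow E i) :=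
  h.row i _ (getElem?_rows_emptyPath i)

lemma rider (h : Represents E G) (j : Fin m) : IsRow G (n + j) (riderRow E j) :=
  h.row _ _ (getElem?_rows_rider j)

lemma free (h : Represents E G) {R : Row} (hR : R ∈ freeRows E) :
    ∃ e < G.M, n + m ≤ e ∧ IsRow G e R := by
  obtain ⟨k, hk⟩ := List.mem_iff_getElem?.1 hR
  have hlt := (List.getElem?_eq_some_iff.1 hk).1
  have hM := h.M_eq_add
  exact ⟨n + m + k, by omega, by omega, h.row _ _ (by rw [getElem?_rows_free, hk])⟩

lemma exit (h : Represents E G) (a : Fin l) {t : ℕ} (ht : t ≤ E.T) :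
    ∃ e < G.M, n + m ≤ e ∧ IsRow G e (exitRow E a t) :=
  h.free (List.mem_append_left _ (mem_exitRows.2 ⟨a, t, ht, rfl⟩))

lemma relocation (h : Represents E G) {r : Trip (Fin l)} (hr : r ∈ E.trips) :
    ∃ e < G.M, n + m ≤ e ∧ IsRow G e (relocationRow E r) :=
  h.free (List.mem_append_right _ (mem_relocationRows.2 ⟨r, hr, rfl⟩))

lemma exists_row (h : Represents E G) (he : e < G.M) :
    (∃ i : Fin n, e = i ∧ IsRow G e (emptyPathRow E i)) ∨
    (∃ j : Fin m, e = n + j ∧ IsRow G e (riderRow E j)) ∨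
    (n + m ≤ e ∧ ∃ (a : Fin l) (t : ℕ), t ≤ E.T ∧ IsRow G e (exitRow E a t)) ∨
    (n + m ≤ e ∧ ∃ r ∈ E.trips, IsRow G e (relocationRow E r)) := by
  rcases Nat.lt_or_ge e n with hn | hn
  · exact .inl ⟨⟨e, hn⟩, rfl, h.emptyPath ⟨e, hn⟩⟩
  obtain ⟨k, rfl⟩ := Nat.exists_eq_add_of_le hn
  rcases Nat.lt_or_ge k m with hm | hm
  · exact .inr (.inl ⟨⟨k, hm⟩, rfl, h.rider ⟨k, hm⟩⟩)
  obtain ⟨k, rfl⟩ := Nat.exists_eq_add_of_le hm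
  have hk : k < (freeRows E).length := by have := h.M_eq_add; omega
  have hR : IsRow G (n + (m + k)) (freeRows E)[k] :=
    h.row _ _ (by rw [← Nat.add_assoc, getElem?_rows_free, List.getElem?_eq_getElem hk])
  rcases List.mem_append.1 (List.getElem_mem hk) with hmem | hmem
  · obtain ⟨a, t, ht, heq⟩ := mem_exitRows.1 hmem
    exact .inr (.inr (.inl ⟨by omega, a, t, ht, heq ▸ hR⟩))
  · obtain ⟨r, hr, heq⟩ := mem_relocationRows.1 hmem
    exact .inr (.inr (.inr ⟨by omega, r, hr, heq ▸ hR⟩))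

lemma sink_eq (h : Represents E G) : G.sink = (0, E.T + 1) := by rw [Net.sink, h.T_eq]

lemma inner (h : Represents E G) (a : Fin l) {t : ℕ} (ht : t ≤ E.T) : G.Inner (a, t) :=
  ⟨h.l_eq ▸ a.2, h.T_eq ▸ ht⟩

lemma exists_isRow (h : Represents E G) (he : e < G.M) :
    ∃ R, IsRow G e R ∧ G.Inner R.tail ∧ (G.Inner R.head ∨ R.head = G.sink) ∧
      R.tail.2 < R.head.2 := by
  have hstart : ∀ r ∈ E.trips, r.start ≤ E.T := fun r hr => (E.start_lt_arrival r).le.trans hr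
  rcases h.exists_row he with ⟨i, -, hR⟩ | ⟨j, -, hR⟩ | ⟨-, a, t, ht, hR⟩ | ⟨-, r, hr, hR⟩
  · exact ⟨_, hR, h.inner _ (E.entryTime_le i), .inr h.sink_eq.symm,
      Nat.lt_succ_of_le (E.entryTime_le i)⟩
  · exact ⟨_, hR, h.inner _ (hstart _ (E.request_mem j)), .inl (h.inner _ (E.request_mem j)),
      E.start_lt_arrival _⟩
  · exact ⟨_, hR, h.inner a ht, .inr h.sink_eq.symm, Nat.lt_succ_of_le ht⟩
  · exact ⟨_, hR, h.inner _ (hstart r hr), .inl (h.inner _ hr), E.start_lt_arrival r⟩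

lemma proper (h : Represents E G) : G.Proper where
  inner_tail e he := by
    obtain ⟨R, hR, htail, -⟩ := h.exists_isRow he
    rwa [hR.tail]
  head e he := by
    obtain ⟨R, hR, -, hhead, -⟩ := h.exists_isRow he
    rwa [hR.head]
  exit := by
    rintro ⟨a, t⟩ ⟨ha, ht⟩
    rw [h.l_eq] at ha
    rw [h.T_eq] at ht
    obtain ⟨e, he, -, hR⟩ := h.exit ⟨a, ha⟩ ht
    exact ⟨e, he, hR.tail, hR.head.trans h.sink_eq.symm, hR.dec⟩
  gain_one e he := by
    obtain ⟨R, hR, -⟩ := h.exists_isRow he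
    rw [hR.gain, hR.gain_one]
  dec_one e he := by
    obtain ⟨R, hR, -⟩ := h.exists_isRow he
    exact hR.dec_one
  time_lt e he := by
    obtain ⟨R, hR, -, -, hlt⟩ := h.exists_isRow he
    rwa [hR.tail, hR.head]

end Represents

section InitialPotential

/-- The potential from which the algorithm starts: the sum of the riders' values, times the
remaining time. It is so steep that no arc gains more than the loss of potential. -/
noncomputable def initialPotential (E : Economy (Fin l) (Fin n) (Fin m)) (v : Node) : ℝ :=
  if v.2 ≤ E.T ∧ v.1 < l then ((E.T + 1 - v.2 : ℕ) : ℝ) * ∑ j, E.value j else 0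

variable {E : Economy (Fin l) (Fin n) (Fin m)} {s : Store}

lemma real_sumValues (hE : Input E s) (h : s.real VALUES 0 0 0 = 0) :
    (sumValues.run s).real VALUES 0 0 0 = ∑ j, E.value j := by
  have key : (sumValues.run s).real VALUES 0 0 0 = ∑ j ∈ Finset.range m, s.real 2 j 0 0 :=
    run_count (fun k s' => s'.real VALUES 0 0 0 = ∑ j ∈ Finset.range k, s.real 2 j 0 0) hE.riders
      (fun _ _ _ h' => h') (by simpa using h) fun k _ s' hk' hs' h' => by
        simp [run, hk', h', Finset.sum_range_succ, hs'.real 2 (by decide)]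
  rw [key, Finset.sum_range]
  exact Finset.sum_congr rfl fun j _ => hE.value j

lemma real_setLevels (hE : Input E s) (h : s.real LEVEL (E.T + 1) 0 0 = 0) {t : ℕ} (ht : t ≤ E.T) :
    (setLevels.run s).real LEVEL t 0 0 = ((E.T + 1 - t : ℕ) : ℝ) * s.real VALUES 0 0 0 := by
  refine run_count (N := E.T + 1) (fun k s' => ∀ t ≤ E.T + 1, E.T + 1 ≤ t + k →
    s'.real LEVEL t 0 0 = ((E.T + 1 - t : ℕ) : ℝ) * s.real VALUES 0 0 0) (by simp [hE.horizon])
    (fun _ _ _ h' => h') (fun t ht hk => ?_) (fun k hk s' hk' hs' ih t ht htk => ?_)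
    t (by omega) (by omega)
  · obtain rfl : t = E.T + 1 := by omega
    simp [h]
  · have hstep : E.T + 1 - (E.T - k) = (E.T + 1 - (E.T + 1 - k)) + 1 := by omega
    have hrun : (rset LEVEL (horizon - var TIME) 0 0
        (.cell LEVEL (horizon + 1 - var TIME) 0 0 + .cell VALUES 0 0 0)).run s' =
        s'.setReal LEVEL (E.T - k) 0 0 (((E.T + 1 - (E.T - k) : ℕ) : ℝ) * s.real VALUES 0 0 0) := by
      simp [run, (hE.of_frame hs').horizon, hk', hs'.real VALUES (by decide), hstep,
        ih (E.T + 1 - k) (by omega) (by omega), add_mul]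
    rw [hrun]
    rcases eq_or_ne t (E.T - k) with rfl | hne
    · simp [updateAt]
    · simpa [updateAt, hne] using ih t ht (by omega)

lemma nodeVal_setPotential (hE : Input E s) (v : Node) :
    nodeVal ((setPotential.run s).real POTENTIAL) v =
      if v.2 ≤ E.T ∧ v.1 < l then s.real LEVEL v.2 0 0 else nodeVal (s.real POTENTIAL) v := by
  have key := run_count_count_pointwise (x := ORIG) (y := TIME) (e := locs) (e' := horizon + 1)
    (c := rset POTENTIAL (var ORIG) (var TIME) 0 (.cell LEVEL (var TIME) 0 0)) (N' := E.T + 1)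
    (fun s' v => nodeVal (s'.real POTENTIAL) v) (fun v _ => s.real LEVEL v.2 0 0) (fun _ => True)
    Prod.fst Prod.snd hE.locs (fun s' hs' => by simp [(hE.of_frame hs').horizon]) (by decide)
    (fun _ _ _ _ => rfl) (fun a _ t _ s' ha ht hs' v => by
      simp only [run, eval_cell, eval_zero, evalReal_cell, eval_const, ha, ht,
        Store.setReal_real_self, nodeVal_updateAt, hs'.real LEVEL (by decide), true_and]
      exact if_ctx_congr Iff.rfl (fun h => by rw [h.2]) fun _ => rfl) v
  simpa [setPotential, Nat.lt_succ_iff] using key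

lemma nodeVal_initPotential (hE : Input E s)
    (h : ∀ A ∈ [POTENTIAL, VALUES, LEVEL], s.real A = 0) (v : Node) :
    nodeVal ((initPotential.run s).real POTENTIAL) v = initialPotential E v := by
  have hs₁ := frame_run sumValues s
  have hE₁ := hE.of_frame hs₁
  have hs₂ := frame_run setLevels (sumValues.run s)
  have hvalues : (sumValues.run s).real VALUES 0 0 0 = ∑ j, E.value j :=
    real_sumValues hE (by rw [h VALUES (by decide)]; rfl)
  have hlevel : (sumValues.run s).real LEVEL (E.T + 1) 0 0 = 0 := by
    rw [hs₁.real LEVEL (by decide), h LEVEL (by decide)]; rfl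
  rw [initPotential, run, run, nodeVal_setPotential (hE₁.of_frame hs₂),
    hs₂.real POTENTIAL (by decide), hs₁.real POTENTIAL (by decide)]
  refine if_ctx_congr Iff.rfl (fun hv => ?_) fun _ => by
    rw [h POTENTIAL (by decide)]; rfl
  rw [real_setLevels hE₁ hlevel hv.1, hvalues]

lemma sum_value_nonneg : 0 ≤ ∑ j, E.value j := Finset.sum_nonneg fun j _ => E.value_nonneg j

lemma initialPotential_nonneg (v : Node) : 0 ≤ initialPotential E v := by
  rw [initialPotential]
  split_ifs
  exacts [mul_nonneg (Nat.cast_nonneg _) sum_value_nonneg, le_rfl]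

lemma initialPotential_sink : initialPotential E (0, E.T + 1) = 0 := by simp [initialPotential]

lemma sum_value_add_initialPotential_le {r : Trip (Fin l)} (hr : r ∈ E.trips) :
    ∑ j, E.value j + initialPotential E (r.dest, E.arrival r) ≤
      initialPotential E (r.orig, r.start) := by
  have harrival : E.arrival r ≤ E.T := hr
  have hstart := E.start_lt_arrival r
  have hsteps : ((E.T + 1 - E.arrival r : ℕ) : ℝ) + 1 ≤ ((E.T + 1 - r.start : ℕ) : ℝ) := by
    exact_mod_cast (by omega : E.T + 1 - E.arrival r + 1 ≤ E.T + 1 - r.start)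
  simp only [initialPotential, Fin.is_lt, and_true, harrival, hstart.le.trans harrival, if_true]
  linarith [mul_le_mul_of_nonneg_right hsteps (sum_value_nonneg (E := E))]

lemma pathCost_nil_nonneg (i : Fin n) : 0 ≤ E.pathCost i [] := by
  rw [Economy.pathCost]
  split_ifs
  exacts [le_rfl, add_nonneg (by simp) (E.exitCost_nonneg _ (by omega))]

lemma Represents.valid_initialPotential {G : Net} (hG : Represents E G) {r : Table ℕ}
    (hr : ∀ e < G.M, r e 1 0 = 0) {V : Table ℝ} (hV : ∀ v, nodeVal V v = initialPotential E v) :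
    G.Valid r V := by
  intro e he d hd hres
  obtain rfl : d = 0 := by
    by_contra hne
    rw [show d = 1 by omega, hr e he] at hres
    exact absurd hres (by decide)
  simp only [hV]
  rcases hG.exists_row he with ⟨i, -, hR⟩ | ⟨j, -, hR⟩ | ⟨-, a, t, -, hR⟩ | ⟨-, q, hq, hR⟩ <;>
    rw [hR.gain, hR.tail, hR.head]
  · simp only [emptyPathRow, initialPotential_sink]
    linarith [pathCost_nil_nonneg (E := E) i,
      initialPotential_nonneg (E := E) (E.entryLoc i, E.entryTime i)]
  · have hvalue : E.value j ≤ ∑ j, E.value j :=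
      Finset.single_le_sum (fun j _ => E.value_nonneg j) (Finset.mem_univ j)
    simp only [riderRow]
    linarith [sum_value_add_initialPotential_le (E.request_mem j),
      E.tripCost_nonneg _ (E.request_mem j)]
  · simp only [exitRow, initialPotential_sink]
    linarith [E.exitCost_nonneg (E.T - t) (Nat.sub_le _ _),
      initialPotential_nonneg (E := E) (a, t)]
  · simp only [relocationRow]
    linarith [sum_value_add_initialPotential_le hq, E.tripCost_nonneg q hq,
      sum_value_nonneg (E := E)]

end InitialPotential

/-- The store after the construction of the network and of the initial potential. -/
structure SetUp (E : Economy (Fin l) (Fin n) (Fin m)) (s : Store) : Prop where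
  input : Input E s
  rep : Represents E (netOf s)
  caps : (netOf s).Capacities (s.nat RESIDUAL)
  valid : (netOf s).Valid (s.nat RESIDUAL) (s.real POTENTIAL)
  sink : nodeVal (s.real POTENTIAL) (netOf s).sink = 0
  flow : ∀ e < (netOf s).M, s.nat RESIDUAL e 1 0 = 0
  len : ∀ i, s.nat 5 i 0 0 = 0

lemma HoldsArcs.represents {E : Economy (Fin l) (Fin n) (Fin m)} {s : Store} (hE : Input E s)
    (h : HoldsArcs s (rows E)) : Represents E (netOf s) :=
  ⟨hE.locs, hE.horizon, h.length, h.row⟩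

lemma setUp_setup (E : Economy (Fin l) (Fin n) (Fin m)) : SetUp E (setup.run (inputStore E)) := by
  have harcs := holdsArcs_network E
  have hnetwork := frame_run network (inputStore E)
  have hE : Input E (network.run (inputStore E)) := (Input.inputStore E).of_frame hnetwork
  have hlen : (network.run (inputStore E)).nat 5 = fun _ _ _ => 0 := by
    rw [hnetwork.nat 5 (by decide)]
    rfl
  have hV := nodeVal_initPotential hE fun A hA => by
    fin_cases hA <;> exact hnetwork.real _ (by decide)
  rw [setup, run]
  generalize network.run (inputStore E) = s at *
  have hs := frame_run initPotential s
  have hrep := harcs.represents hE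
  have hres : ∀ e < (netOf s).M, s.nat RESIDUAL e 0 0 = 1 ∧ s.nat RESIDUAL e 1 0 = 0 :=
    fun e he => harcs.residual e (harcs.length ▸ he)
  have hflow : ∀ e < (netOf s).M, s.nat RESIDUAL e 1 0 = 0 := fun e he => (hres e he).2
  constructor
  · exact hE.of_frame hs
  all_goals try rw [netOf_frame hs]
  all_goals try rw [hs.nat RESIDUAL (by decide)]
  · exact hrep
  · exact fun e he => ⟨fun _ => (hres e he).1.ge, fun _ => by rw [(hres e he).1, hflow e he]⟩
  · exact hrep.valid_initialPotential hflow hV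
  · rw [hV, hrep.sink_eq, initialPotential_sink]
  · exact hflow
  · simp [hs.nat 5 (by decide), hlen]

/-! ### Shortest augmenting paths -/

section Scan

/-- In the store, arc `e` can be used from end `d` and leads out of the tree. -/
def Leaves (s : Store) (e d : ℕ) : Prop :=
  e < (netOf s).M ∧ d < 2 ∧ 1 ≤ nodeVal (s.nat TREE) ((netOf s).node e d) ∧
    nodeVal (s.nat TREE) ((netOf s).node e (1 - d)) = 0 ∧ 1 ≤ s.nat RESIDUAL e d 0

/-- The slack of arc `e`, used from end `d`: the loss of potential minus the gain. -/
def slack (s : Store) (e d : ℕ) : ℝ :=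
  nodeVal (s.real POTENTIAL) ((netOf s).node e d) -
    nodeVal (s.real POTENTIAL) ((netOf s).node e (1 - d)) - (netOf s).gain e d 0

/-- The store `s` contains an arc of least slack among those arcs with ends in `Q` that leave the
tree in the store `s₀`, if there are any. -/
structure HoldsBest (s₀ : Store) (Q : Set (ℕ × ℕ)) (s : Store) : Prop where
  none : s.nat FOUND 0 0 0 = 0 → ∀ q ∈ Q, ¬ Leaves s₀ q.1 q.2
  some : s.nat FOUND 0 0 0 ≠ 0 → Leaves s₀ (s.nat FOUNDARC 0 0 0) (s.nat FOUNDEND 0 0 0) ∧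
    s.real SLACK 0 0 0 = slack s₀ (s.nat FOUNDARC 0 0 0) (s.nat FOUNDEND 0 0 0) ∧
    ∀ q ∈ Q, Leaves s₀ q.1 q.2 → s.real SLACK 0 0 0 ≤ slack s₀ q.1 q.2

variable {s₀ s s' : Store} {Q : Set (ℕ × ℕ)} {k d : ℕ}

lemma leaves_frame (hs : scan.Frame s s') : Leaves s' = Leaves s := by
  funext e d
  simp only [Leaves, netOf_frame hs, hs.nat TREE (by decide), hs.nat RESIDUAL (by decide)]

lemma slack_frame (hs : scan.Frame s s') : slack s' = slack s := by
  funext e d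
  simp only [slack, netOf_frame hs, hs.real POTENTIAL (by decide)]

open Classical in
lemma run_probe (hk : s.nat ARC 0 0 0 = k) (hkM : k < (netOf s).M) (hd : d < 2) :
    (probe d (1 - d)).run s =
      if Leaves s k d then
        if 1 ≤ s.nat FOUND 0 0 0 ∧ s.real SLACK 0 0 0 ≤ slack s k d then s
        else (((s.setReal SLACK 0 0 0 (slack s k d)).setNat FOUND 0 0 0 1).setNat FOUNDARC 0 0 0
          k).setNat FOUNDEND 0 0 0 d
      else s := by
  have hleaves : (1 ≤ s.nat TREE (s.nat ENDS k 0 d) (s.nat ENDS k 1 d) 0 ∧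
      s.nat TREE (s.nat ENDS k 0 (1 - d)) (s.nat ENDS k 1 (1 - d)) 0 = 0 ∧
      1 ≤ s.nat RESIDUAL k d 0) ↔ Leaves s k d := by
    rw [Leaves, and_iff_right hkM, and_iff_right hd]
    rfl
  have hslack : s.real POTENTIAL (s.nat ENDS k 0 d) (s.nat ENDS k 1 d) 0 -
      s.real POTENTIAL (s.nat ENDS k 0 (1 - d)) (s.nat ENDS k 1 (1 - d)) 0 -
      s.real GAIN k d 0 = slack s k d := rfl
  simp [probe, run, hk, hleaves, hslack]

lemma HoldsBest.probe (hs : scan.Frame s₀ s) (hQ : HoldsBest s₀ Q s) (hk : s.nat ARC 0 0 0 = k)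
    (hkM : k < (netOf s₀).M) (hd : d < 2) :
    HoldsBest s₀ (insert (k, d) Q) ((probe d (1 - d)).run s) := by
  rw [run_probe hk (by rwa [netOf_frame hs]) hd, leaves_frame hs, slack_frame hs]
  split_ifs with hleaves hle
  · refine ⟨fun h0 => absurd h0 (by omega), fun h0 => ?_⟩
    obtain ⟨hbest, hslack, hmin⟩ := hQ.some h0
    exact ⟨hbest, hslack, Set.forall_mem_insert.2 ⟨fun _ => hle.2, hmin⟩⟩
  · refine ⟨fun h0 => absurd h0 (by simp), fun _ => ?_⟩
    suffices hmin : ∀ q ∈ Q, Leaves s₀ q.1 q.2 → slack s₀ k d ≤ slack s₀ q.1 q.2 by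
      simpa [hleaves] using hmin
    intro q hq hl
    have h0 : s.nat FOUND 0 0 0 ≠ 0 := fun h0 => hQ.none h0 q hq hl
    have hlt : slack s₀ k d < s.real SLACK 0 0 0 :=
      not_le.1 fun h => hle ⟨Nat.one_le_iff_ne_zero.2 h0, h⟩
    exact hlt.le.trans ((hQ.some h0).2.2 q hq hl)
  · refine ⟨fun h0 => Set.forall_mem_insert.2 ⟨hleaves, hQ.none h0⟩, fun h0 => ?_⟩
    obtain ⟨hbest, hslack, hmin⟩ := hQ.some h0
    exact ⟨hbest, hslack, Set.forall_mem_insert.2 ⟨fun h => absurd h hleaves, hmin⟩⟩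

lemma HoldsBest.mono {Q' : Set (ℕ × ℕ)} (h : HoldsBest s₀ Q s) (hQ : Q' ⊆ Q) :
    HoldsBest s₀ Q' s :=
  ⟨fun h0 q hq => h.none h0 q (hQ hq), fun h0 =>
    ⟨(h.some h0).1, (h.some h0).2.1, fun q hq => (h.some h0).2.2 q (hQ hq)⟩⟩

lemma holdsBest_scan (s : Store) :
    HoldsBest s {q | q.1 < (netOf s).M ∧ q.2 < 2} (scan.run s) := by
  have hs₀ := frame_run (assign FOUND 0) s
  rw [scan, run]
  refine run_count (fun k s' => HoldsBest s {q | q.1 < k ∧ q.2 < 2} s') ?_ ?_ ?_ ?_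
  · simp [run, netOf]
  · rintro k s' v ⟨hnone, hsome⟩
    exact ⟨by simpa using hnone, by simpa using hsome⟩
  · exact ⟨fun _ q hq => absurd hq.1 q.1.not_lt_zero, fun h0 => absurd h0 (by simp [run])⟩
  · intro k hkM s' hk hs' hbest
    have hs : scan.Frame s s' := hs₀.mono.trans hs'.mono
    have hs₁ := frame_run (probe 0 1) s'
    refine ((hbest.probe hs hk hkM (d := 0) (by decide)).probe (d := 1) (k := k)
      (hs.trans hs₁.mono) ?_ hkM (by decide)).mono ?_
    · rw [hs₁.nat ARC (by decide), hk]
    · rintro ⟨e, d⟩ ⟨he, hd⟩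
      simp only [Set.mem_insert_iff, Prod.mk.injEq, Set.mem_ofPred_eq] at he hd ⊢
      omega

end Scan

section Tree

variable {G : Net} {r : Table ℕ} {src v : Node} {L : List Node} {s : Store}

lemma nodeVal_lower (hl : s.nat 0 0 0 0 = G.l) (hT : s.nat 0 3 0 0 = G.T) (v : Node) :
    nodeVal ((lower.run s).real POTENTIAL) v =
      if (1 ≤ nodeVal (s.nat TREE) v ∧ v.2 < G.T + 2) ∧ v.1 < G.l then
        nodeVal (s.real POTENTIAL) v - s.real SLACK 0 0 0
      else nodeVal (s.real POTENTIAL) v := by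
  refine run_count_count_pointwise (x := ORIG) (y := TIME) (e := locs) (e' := horizon + 2)
    (c := ite (.nle 1 (.cell TREE (var ORIG) (var TIME) 0))
      (rset POTENTIAL (var ORIG) (var TIME) 0
        (.cell POTENTIAL (var ORIG) (var TIME) 0 - .cell SLACK 0 0 0)) skip)
    (N' := G.T + 2) (fun s' v => nodeVal (s'.real POTENTIAL) v)
    (fun _ y => y - s.real SLACK 0 0 0) (fun v => 1 ≤ nodeVal (s.nat TREE) v)
    Prod.fst Prod.snd hl (fun s' hs' => by simp [hs'.nat 0 (by decide), hT]) (by decide)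
    (fun _ _ _ _ => rfl) (fun a _ t _ s' ha ht hs' v => ?_) v
  simp only [run, holds_nle, eval_one, eval_cell, eval_zero, eval_const, ha, ht,
    hs'.nat TREE (by decide), evalReal_sub, evalReal_cell, hs'.real SLACK (by decide)]
  by_cases hS : 1 ≤ s.nat TREE a t 0
  · simp only [if_pos hS, Store.setReal_real_self, nodeVal_updateAt]
    rcases em (v.1 = a ∧ v.2 = t) with ⟨rfl, rfl⟩ | hv
    · simp [nodeVal, hS]
    · rw [if_neg hv, if_neg fun h => hv ⟨h.1.2, h.2⟩]
  · rw [if_neg hS, if_neg]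
    rintro ⟨⟨hv, rfl⟩, rfl⟩
    exact hS hv

/-- The store holds the network `G`, the residual capacities `r`, a dual feasible potential, and a
tree of tight arcs with root `src` and nodes `L`. -/
structure HoldsTree (G : Net) (r : Table ℕ) (src : Node) (L : List Node) (s : Store) : Prop where
  net : netOf s = G
  res : s.nat RESIDUAL = r
  tree : G.Tree (G.Tight r (s.real POTENTIAL)) (s.nat PARENTARC) (s.nat PARENTEND) src L
  mem : ∀ v, G.Inner v ∨ v = G.sink → nodeVal (s.nat TREE) v = if v ∈ L then 1 else 0
  nodes : ∀ v ∈ L, G.Inner v ∨ v = G.sink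
  valid : G.Valid r (s.real POTENTIAL)
  sink : nodeVal (s.real POTENTIAL) G.sink = 0

namespace HoldsTree

lemma locs (h : HoldsTree G r src L s) : s.nat 0 0 0 0 = G.l := congrArg Net.l h.net

lemma horizon (h : HoldsTree G r src L s) : s.nat 0 3 0 0 = G.T := congrArg Net.T h.net

lemma of_frame (h : HoldsTree G r src L s) {c : Code} {s' : Store} (hs : c.Frame s s')
    (hn : ∀ A ∈ [0, ENDS, RESIDUAL, DEC, ARCS, TREE, PARENTARC, PARENTEND], A ∉ c.writes := by
      decide)
    (hr : ∀ A ∈ [GAIN, POTENTIAL], A ∉ c.realWrites := by decide) : HoldsTree G r src L s' := by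
  have hnat := fun A hA => hs.nat A (hn A hA)
  have hreal := fun A hA => hs.real A (hr A hA)
  simp only [List.forall_mem_cons] at hnat hreal
  have hnet : netOf s' = netOf s := netOf_congr (by simp [hnat]) (by simp [hreal])
  obtain ⟨h1, h2, h3, h4, h5, h6, h7⟩ := h
  constructor <;> (try simp only [hnet, hnat, hreal]) <;> assumption

lemma leaves_iff (hG : G.Proper) (h : HoldsTree G r src L s) {e d : ℕ} : Leaves s e d ↔
    e < G.M ∧ d < 2 ∧ G.node e d ∈ L ∧ G.node e (1 - d) ∉ L ∧ 1 ≤ r e d 0 := by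
  rw [Leaves, h.net, h.res]
  refine and_congr_right fun he => and_congr_right fun hd => ?_
  rw [h.mem _ (hG.node he hd), h.mem _ (hG.node he (d := 1 - d) (by omega))]
  split_ifs <;> simp [*]

lemma inner (h : HoldsTree G r src L s) (hL : G.sink ∉ L) (hv : v ∈ L) : G.Inner v :=
  (h.nodes v hv).resolve_right fun h => hL (h ▸ hv)

lemma exists_leaves (hG : G.Proper) (hr : G.Capacities r) (h : HoldsTree G r src L s)
    (hL : G.sink ∉ L) : ∃ e < G.M, Leaves s e 0 := by
  have hsrc := h.tree.src_mem
  obtain ⟨e, he, htail, hhead, hdec⟩ := hG.exit src (h.inner hL hsrc)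
  refine ⟨e, he, (h.leaves_iff hG).2 ⟨he, by decide, ?_, ?_, (hr e he).1 hdec⟩⟩
  exacts [htail ▸ hsrc, hhead ▸ hL]

lemma nodeVal_lower (h : HoldsTree G r src L s) (hL : G.sink ∉ L)
    (hv : G.Inner v ∨ v = G.sink) :
    nodeVal ((Algorithm.lower.run s).real POTENTIAL) v =
      if v ∈ L then nodeVal (s.real POTENTIAL) v - s.real SLACK 0 0 0
      else nodeVal (s.real POTENTIAL) v := by
  rw [Algorithm.nodeVal_lower h.locs h.horizon, h.mem v hv]
  refine if_congr ⟨fun hin => by_contra fun hvL => ?_, fun hvL => ?_⟩ rfl rfl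
  · simp [hvL] at hin
  · obtain ⟨hloc, htime⟩ := h.inner hL hvL
    simp [hvL, hloc, show v.2 < G.T + 2 by omega]

lemma lower (hG : G.Proper) (h : HoldsTree G r src L s) (hL : G.sink ∉ L)
    (hpos : 0 ≤ s.real SLACK 0 0 0)
    (hmin : ∀ e d, Leaves s e d → s.real SLACK 0 0 0 ≤ slack s e d) :
    HoldsTree G r src L (Algorithm.lower.run s) := by
  have hs := frame_run Algorithm.lower s
  constructor
  · rw [netOf_frame hs, h.net]
  · rw [hs.nat RESIDUAL (by decide), h.res]
  · rw [hs.nat PARENTARC (by decide), hs.nat PARENTEND (by decide)]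
    refine h.tree.congr (fun e d hin hin' ⟨he, hd, hres, htight⟩ => ⟨he, hd, hres, ?_⟩)
      fun _ _ => ⟨rfl, rfl⟩
    rw [h.nodeVal_lower hL (h.nodes _ hin), h.nodeVal_lower hL (h.nodes _ hin'), if_pos hin,
      if_pos hin']
    linarith
  · rw [hs.nat TREE (by decide)]
    exact h.mem
  · exact h.nodes
  · refine h.valid.of_shift (S := {v | v ∈ L}) hpos (fun e he d hd hv => ?_)
      (fun e he d hd hv => ?_) fun e he d hd hres hin hout => ?_
    · exact (h.nodeVal_lower hL (hG.node he hd)).trans (if_pos hv)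
    · exact (h.nodeVal_lower hL (hG.node he hd)).trans (if_neg hv)
    · have hslack := hmin e d ((h.leaves_iff hG).2 ⟨he, hd, hin, hout, hres⟩)
      rwa [slack, h.net] at hslack
  · rw [h.nodeVal_lower hL (Or.inr rfl), if_neg hL, h.sink]

lemma attach (hG : G.Proper) (h : HoldsTree G r src L s) {e d : ℕ}
    (he : s.nat FOUNDARC 0 0 0 = e) (hd : s.nat FOUNDEND 0 0 0 = d)
    (htight : G.Tight r (s.real POTENTIAL) e d) (hin : G.node e d ∈ L)
    (hout : G.node e (1 - d) ∉ L) :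
    HoldsTree G r src (G.node e (1 - d) :: L) (Algorithm.attach.run s) := by
  have hhead := hG.node htight.1 (d := 1 - d) (by omega)
  have hnode : (s.nat ENDS e 0 (1 - d), s.nat ENDS e 1 (1 - d)) = G.node e (1 - d) := by
    rw [← h.net]
    rfl
  generalize hw : G.node e (1 - d) = w at *
  obtain ⟨a, t⟩ := w
  obtain ⟨ha, ht⟩ := Prod.mk.inj hnode
  have hrun : Algorithm.attach.run s =
      ((s.setNat PARENTARC a t 0 e).setNat PARENTEND a t 0 d).setNat TREE a t 0 1 := by
    simp [Algorithm.attach, run, he, hd, ha, ht]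
  rw [hrun]
  constructor
  · rw [← h.net]
    exact netOf_congr (by simp) rfl
  · simp [h.res]
  · refine .cons hout (h.tree.congr (fun _ _ _ _ => id) fun v hv => ?_) ?_ ?_ ?_
    · have hne : ¬ (v.1 = a ∧ v.2 = t) := fun h => hout ((Prod.ext h.1 h.2 : v = (a, t)) ▸ hv)
      simp [nodeVal_updateAt, hne]
    · simpa [nodeVal_updateAt] using htight
    · simpa [nodeVal_updateAt] using hin
    · simpa [nodeVal_updateAt] using hw
  · intro v hv
    by_cases hva : v.1 = a ∧ v.2 = t <;> simp [nodeVal_updateAt, h.mem v hv, hva, Prod.ext_iff]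
  · exact List.forall_mem_cons.2 ⟨hhead, h.nodes⟩
  · exact h.valid
  · exact h.sink

-- Lowering the potential on the tree by the least slack keeps it dual feasible, and makes the arc
-- found tight.
lemma exists_cons (hG : G.Proper) (hr : G.Capacities r) (h : HoldsTree G r src L s)
    (hL : G.sink ∉ L) :
    ∃ w, HoldsTree G r src (w :: L) ((scan ;; Algorithm.lower ;; Algorithm.attach).run s) := by
  have hscan := frame_run scan s
  have hlower := frame_run Algorithm.lower (scan.run s)
  have h₁ := h.of_frame hscan
  obtain ⟨hnone, hsome⟩ := holdsBest_scan s
  rw [← leaves_frame hscan, h.net] at hnone hsome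
  rw [← slack_frame hscan] at hsome
  obtain ⟨e, he, hleaves⟩ := h₁.exists_leaves hG hr hL
  obtain ⟨hbest, hslack, hmin⟩ := hsome fun h0 => hnone h0 (e, 0) ⟨he, Nat.two_pos⟩ hleaves
  simp only [run]
  generalize scan.run s = s₁ at *
  generalize hbe : s₁.nat FOUNDARC 0 0 0 = e at *
  generalize hbd : s₁.nat FOUNDEND 0 0 0 = d at *
  obtain ⟨he, hd, hin, hout, hres⟩ := (h₁.leaves_iff hG).1 hbest
  have hpos : 0 ≤ s₁.real SLACK 0 0 0 := by
    have := h₁.valid e he d hd hres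
    rw [hslack, slack, h₁.net]
    linarith
  have h₂ := h₁.lower hG hL hpos fun e d hl => hmin (e, d) ⟨h₁.net ▸ hl.1, hl.2.1⟩ hl
  refine ⟨_, h₂.attach hG (by rw [hlower.nat FOUNDARC (by decide), hbe])
    (by rw [hlower.nat FOUNDEND (by decide), hbd]) ⟨he, hd, hres, ?_⟩ hin hout⟩
  rw [h₁.nodeVal_lower hL (hG.node he hd), h₁.nodeVal_lower hL (hG.node he (by omega)),
    if_pos hin, if_neg hout, hslack, slack, h₁.net]
  ring

end HoldsTree

-- Each round adds a node to the tree until it contains the sink, and there are at least as many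
-- arcs as inner nodes, since each inner node has an exit.
lemma HoldsTree.grow (hG : G.Proper) (hr : G.Capacities r) (h : HoldsTree G r src [src] s) :
    ∃ L, HoldsTree G r src L (grow.run s) ∧ L.length ≤ G.M + 1 ∧ G.sink ∈ L := by
  obtain ⟨L, hL, hle, hsink⟩ : ∃ L, HoldsTree G r src L (Algorithm.grow.run s) ∧
      L.length ≤ G.M + 1 ∧ (G.M + 1 ≤ L.length ∨ G.sink ∈ L) := by
    refine run_count (fun k s' => ∃ L, HoldsTree G r src L s' ∧ L.length ≤ k + 1 ∧
      (k + 1 ≤ L.length ∨ G.sink ∈ L)) ?_ ?_ ⟨[src], h, by simp⟩ ?_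
    · rw [← h.net]
      rfl
    · rintro k s' v ⟨L, hL, hlen⟩
      exact ⟨L, hL.of_frame (frame_setNat (c := assign ROUND 0) (by decide) s' 0 0 0 v), hlen⟩
    · rintro k - s' - - ⟨L, hL, hle, hge⟩
      have htest : s'.nat TREE 0 (G.T + 1) 0 = 0 ↔ G.sink ∉ L := by
        have hmem := hL.mem G.sink (Or.inr rfl)
        rw [show s'.nat TREE 0 (G.T + 1) 0 = if G.sink ∈ L then 1 else 0 from hmem]
        simp
      simp only [run, holds_nle, eval_cell, eval_zero, eval_add, eval_three, eval_one,
        hL.horizon, Nat.le_zero, htest]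
      split_ifs with hs
      · exact ⟨L, hL, by omega, Or.inr hs⟩
      · obtain ⟨w, hw⟩ := hL.exists_cons hG hr hs
        have := hge.resolve_right hs
        exact ⟨w :: L, hw, by simp; omega, Or.inl (by simp; omega)⟩
  refine ⟨L, hL, hle, by_contra fun hcon => ?_⟩
  have := hG.length_le hL.tree.nodup fun v hv => hL.inner hcon hv
  have := hsink.resolve_right hcon
  omega

end Tree

/-- The current node. -/
def current (s : Store) : Node := (s.nat NODELOC 0 0 0, s.nat NODETIME 0 0 0)

/-- The node at which the current driver enters. -/
def entry (s : Store) : Node :=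
  (s.nat 2 (s.nat AGENT 0 0 0) 1 0, s.nat 2 (s.nat AGENT 0 0 0) 2 0)

lemma entry_frame {c : Code} {s s' : Store} (hs : c.Frame s s') (h2 : 2 ∉ c.writes := by decide)
    (hA : AGENT ∉ c.writes := by decide) : entry s' = entry s := by
  rw [entry, entry, hs.nat 2 h2, hs.nat AGENT hA]

section Augment

variable {G : Net} {r : Table ℕ} {L : List Node} {s₀ s : Store}

lemma nodeVal_initTree (hentry : (netOf s).Inner (entry s)) {v : Node}
    (hv : (netOf s).Inner v ∨ v = (netOf s).sink) :
    nodeVal ((initTree.run s).nat TREE) v = if v = entry s then 1 else 0 := by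
  have hclear : nodeVal ((clearTree.run s).nat TREE) v =
      if (True ∧ v.2 < (netOf s).T + 2) ∧ v.1 < (netOf s).l then 0 else nodeVal (s.nat TREE) v :=
    run_count_count_pointwise (fun s' v => nodeVal (s'.nat TREE) v) (fun _ _ => 0) (fun _ => True)
      Prod.fst Prod.snd rfl (fun s' hs' => by simp [hs'.nat 0 (by decide), netOf]) (by decide)
      (fun s' z _ hz => by rcases hz with rfl | rfl <;> rfl)
      (fun a _ t _ s' ha ht _ v => by simp [run, ha, ht, nodeVal_updateAt]) v
  have hbound : (True ∧ v.2 < (netOf s).T + 2) ∧ v.1 < (netOf s).l := by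
    rcases hv with ⟨hloc, htime⟩ | rfl
    · exact ⟨⟨trivial, by omega⟩, hloc⟩
    · exact ⟨⟨trivial, Nat.lt_succ_self _⟩, Nat.zero_lt_of_lt hentry.1⟩
  rw [if_pos hbound] at hclear
  have hs := entry_frame (frame_run clearTree s)
  rw [← hs, initTree, run]
  simp [run, nodeVal_updateAt, hclear, entry, Prod.ext_iff]

lemma holdsTree_initTree (hV : (netOf s).Valid (s.nat RESIDUAL) (s.real POTENTIAL))
    (hsink : nodeVal (s.real POTENTIAL) (netOf s).sink = 0) (hentry : (netOf s).Inner (entry s)) :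
    HoldsTree (netOf s) (s.nat RESIDUAL) (entry s) [entry s] (initTree.run s) := by
  have hs := frame_run initTree s
  constructor
  · exact netOf_frame hs
  · exact hs.nat RESIDUAL (by decide)
  · exact .root
  · intro v hv
    simp only [List.mem_singleton, nodeVal_initTree hentry hv]
  · simpa using Or.inl hentry
  · rwa [hs.real POTENTIAL (by decide)]
  · rwa [hs.real POTENTIAL (by decide)]

/-- The store in the course of an augmentation that began in the store `s₀`, when there is still one
unit of flow too many that leaves the current node; this node is in what is left of the tree. -/
structure Augmenting (G : Net) (s₀ : Store) (L : List Node) (s : Store) : Prop where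
  frame : augment.Frame s₀ s
  mem : current s ∈ L
  tree : G.Tree (G.Tight (s.nat RESIDUAL) (s₀.real POTENTIAL)) (s₀.nat PARENTARC)
    (s₀.nat PARENTEND) (entry s₀) L
  caps : G.Capacities (s.nat RESIDUAL)
  valid : G.Valid (s.nat RESIDUAL) (s₀.real POTENTIAL)
  flow : ∀ v, v ≠ G.sink → G.net (fun e => s.nat RESIDUAL e 1 0) v =
    G.net (fun e => s₀.nat RESIDUAL e 1 0) v + if current s = v then 1 else 0

namespace Augmenting

lemma setRound (h : Augmenting G s₀ L s) (k : ℕ) :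
    Augmenting G s₀ L (s.setNat ROUND 0 0 0 k) where
  frame := h.frame.trans (frame_setNat (by decide) s 0 0 0 k)
  mem := h.mem
  tree := h.tree
  caps := h.caps
  valid := h.valid
  flow := h.flow

lemma run_stepBack (hG : netOf s = G) {e d : ℕ} (hd : d < 2)
    (he : nodeVal (s.nat PARENTARC) (current s) = e)
    (hd' : nodeVal (s.nat PARENTEND) (current s) = d) :
    (stepBack.run s).nat RESIDUAL = G.flip (s.nat RESIDUAL) e d ∧
      current (stepBack.run s) = G.node e d := by
  have he : s.nat PARENTARC (s.nat NODELOC 0 0 0) (s.nat NODETIME 0 0 0) 0 = e := he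
  have hd' : s.nat PARENTEND (s.nat NODELOC 0 0 0) (s.nat NODETIME 0 0 0) 0 = d := hd'
  have hne : 1 - d ≠ d := by omega
  subst hG
  constructor
  · simp [stepBack, run, he, hd', Net.flip, netOf, updateAt, hne]
  · simp [current, stepBack, run, he, hd', Net.node, netOf]

lemma stepBack (hnet : netOf s₀ = G) (hG : G.Proper) (h : Augmenting G s₀ L s)
    (hcur : current s ≠ entry s₀) :
    ∃ L', Augmenting G s₀ L' (stepBack.run s) ∧ L'.length < L.length := by
  obtain ⟨L', htree, hlen⟩ := h.tree.exists_cons h.mem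
  generalize hw : current s = w at htree hcur
  cases htree with
  | root => exact absurd rfl hcur
  | cons hnot htree htight hmem hhead =>
    obtain ⟨hres, hcurrent⟩ := run_stepBack ((netOf_frame h.frame).trans hnet) htight.2.1
      (by rw [h.frame.nat PARENTARC (by decide), hw])
      (by rw [h.frame.nat PARENTEND (by decide), hw])
    generalize nodeVal (s₀.nat PARENTARC) w = e at *
    generalize nodeVal (s₀.nat PARENTEND) w = d at *
    refine ⟨L', ⟨h.frame.trans (frame_run _ s).mono, hcurrent ▸ hmem, ?_, ?_, ?_, ?_⟩, hlen⟩
    · rw [hres]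
      refine htree.congr (fun e' d' hin hin' ⟨he', hd', hpos, hgain⟩ =>
        ⟨he', hd', ?_, hgain⟩) fun _ _ => ⟨rfl, rfl⟩
      rwa [Net.flip_of_ne]
      rintro rfl
      have hd := htight.2.1
      rcases eq_or_ne d' d with rfl | hne
      · exact hnot (hhead ▸ hin')
      · exact hnot (hhead ▸ (show d' = 1 - d by omega) ▸ hin)
    · rw [hres]
      exact htight.capacities_flip hG h.caps
    · rw [hres]
      exact htight.valid_flip hG h.valid
    · intro v hv
      rw [hres, htight.net_flip hG, h.flow v hv, hhead, hcurrent, hw]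
      ring

end Augmenting

lemma HoldsTree.augmenting (hr : G.Capacities r) (h : HoldsTree G r (entry s) L s)
    (hsink : G.sink ∈ L) :
    Augmenting G s L ((assign NODELOC 0 ;; assign NODETIME (Algorithm.horizon + 1)).run s) where
  frame := (frame_run (assign NODELOC 0 ;; assign NODETIME (Algorithm.horizon + 1)) s).mono
  mem := by
    rw [← h.net] at hsink
    exact hsink
  tree := h.res ▸ h.tree
  caps := h.res ▸ hr
  valid := h.res ▸ h.valid
  flow v hv := by
    rw [← h.net] at hv
    rw [show current _ = (netOf s).sink from rfl, if_neg hv.symm, add_zero]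
    rfl

lemma HoldsTree.augment (hG : G.Proper) (hr : G.Capacities r)
    (h : HoldsTree G r (entry s) L s) (hL : L.length ≤ G.M + 1) (hsink : G.sink ∈ L) :
    ∃ L', Augmenting G s L' (augment.run s) ∧ current (augment.run s) = entry s := by
  obtain ⟨L', h', hcur⟩ : ∃ L', Augmenting G s L' (Algorithm.augment.run s) ∧
      (current (Algorithm.augment.run s) = entry s ∨ L'.length + (G.M + 1) ≤ G.M + 1) := by
    refine run_count (fun k s' => ∃ L', Augmenting G s L' s' ∧
      (current s' = entry s ∨ L'.length + k ≤ G.M + 1)) ?_ ?_ ?_ ?_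
    · rw [← h.net]
      rfl
    · rintro k s' v ⟨L', h', hcur⟩
      exact ⟨L', h'.setRound v, hcur⟩
    · exact ⟨L, h.augmenting hr hsink, Or.inr hL⟩
    · rintro k - s' - - ⟨L', h', hcur⟩
      have htest : (Test.and (equal (var NODELOC) (entryLoc (var AGENT)))
          (equal (var NODETIME) (entryTime (var AGENT)))).Holds s' ↔ current s' = entry s := by
        rw [← entry_frame h'.frame, current, entry, Prod.mk.injEq]
        simp
      rw [run, htest]
      split_ifs with hc
      · exact ⟨L', h', Or.inl hc⟩
      · obtain ⟨L'', h'', hlen⟩ := h'.stepBack h.net hG hc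
        have := hcur.resolve_left hc
        exact ⟨L'', h'', Or.inr (by omega)⟩
  refine ⟨L', h', hcur.resolve_right fun hlen => ?_⟩
  have := List.length_pos_of_mem h'.mem
  omega

end Augment

section Route

variable {E : Economy (Fin l) (Fin n) (Fin m)} {k : ℕ} {s : Store}

/-- The node at which driver `i` enters. -/
def source (E : Economy (Fin l) (Fin n) (Fin m)) (i : Fin n) : Node := (E.entryLoc i, E.entryTime i)

lemma Input.entry_eq (hE : Input E s) {i : Fin n} (hi : s.nat AGENT 0 0 0 = i) :
    entry s = source E i := by
  rw [entry, hi, hE.entryLoc, hE.entryTime, source]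

/-- The store holds an optimal flow for the first `k` drivers. -/
structure Routed (E : Economy (Fin l) (Fin n) (Fin m)) (k : ℕ) (s : Store) : Prop where
  input : Input E s
  rep : Represents E (netOf s)
  caps : (netOf s).Capacities (s.nat RESIDUAL)
  valid : (netOf s).Valid (s.nat RESIDUAL) (s.real POTENTIAL)
  sink : nodeVal (s.real POTENTIAL) (netOf s).sink = 0
  flow : ∀ v, v ≠ (netOf s).sink → (netOf s).net (fun e => s.nat RESIDUAL e 1 0) v =
    ∑ i : Fin n with i.1 < k, if source E i = v then 1 else 0

lemma Routed.setAgent (h : Routed E k s) (v : ℕ) : Routed E k (s.setNat AGENT 0 0 0 v) where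
  input := h.input.of_frame (frame_setNat (c := assign AGENT 0) (by decide) s 0 0 0 v)
  rep := h.rep
  caps := h.caps
  valid := h.valid
  sink := h.sink
  flow := h.flow

lemma Routed.routeOne (h : Routed E k s) {i : Fin n} (hi : s.nat AGENT 0 0 0 = i) (hk : i = k) :
    Routed E (k + 1) ((initTree ;; grow ;; augment).run s) := by
  have hentry := h.input.entry_eq hi
  have hG := h.rep.proper
  have hinit := holdsTree_initTree h.valid h.sink (hentry ▸ h.rep.inner _ (E.entryTime_le i))
  have hs := frame_run (initTree ;; grow) s
  obtain ⟨L, hgrow, hlen, hmem⟩ : ∃ L, HoldsTree (netOf s) (s.nat RESIDUAL) (entry s) L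
      ((initTree ;; grow).run s) ∧ L.length ≤ (netOf s).M + 1 ∧ (netOf s).sink ∈ L :=
    hinit.grow hG h.caps
  rw [← entry_frame hs] at hgrow
  obtain ⟨L', haug, hcur⟩ := hgrow.augment hG h.caps hlen hmem
  have hs' := frame_run augment ((initTree ;; grow).run s)
  have hnet : netOf (augment.run ((initTree ;; grow).run s)) = netOf s :=
    (netOf_frame hs').trans hgrow.net
  change Routed E (k + 1) (augment.run ((initTree ;; grow).run s))
  refine ⟨(h.input.of_frame hs).of_frame hs', ?_, ?_, ?_, ?_, fun v hv => ?_⟩ <;>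
    rw [hnet] at *
  · exact h.rep
  · exact haug.caps
  · rw [hs'.real POTENTIAL (by decide)]
    exact haug.valid
  · rw [hs'.real POTENTIAL (by decide)]
    exact hgrow.sink
  · rw [haug.flow v hv, hcur, entry_frame hs, hentry, hgrow.res, h.flow v hv]
    have hinsert : Finset.univ.filter (fun i' : Fin n => i'.1 < k + 1) =
        insert i (Finset.univ.filter fun i' : Fin n => i'.1 < k) := by
      ext i'
      simp only [Finset.mem_filter_univ, Finset.mem_insert, Fin.ext_iff]
      omega
    rw [hinsert, Finset.sum_insert (by simp [hk]), add_comm]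

lemma routed_route (h : SetUp E s) : Routed E n (route.run s) := by
  refine run_count (Routed E) h.input.drivers (fun _ _ v h => h.setAgent v) ?_
    fun k hk s' hs _ h => h.routeOne (i := ⟨k, hk⟩) hs rfl
  refine ⟨h.input, h.rep, h.caps, h.valid, h.sink, fun v _ => ?_⟩
  simp only [Nat.not_lt_zero, Finset.filter_false, Finset.sum_empty]
  exact Finset.sum_eq_zero fun e he => by simp [h.flow e (Finset.mem_range.1 he)]

end Route

section Prices

variable {E : Economy (Fin l) (Fin n) (Fin m)} {s : Store}

/-- The potential, as a function of locations and times. -/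
def potential (s : Store) (a : Fin l) (t : ℕ) : ℝ := s.real POTENTIAL a t 0

lemma real_writePrices (hE : Input E s) {r : Trip (Fin l)} (hr : r ∈ E.trips) :
    (writePrices.run s).real 3 r.orig r.dest r.start =
      E.potentialPrice (potential s) r := by
  have hstart : r.start < E.T + 1 := Nat.lt_succ_of_le ((E.start_lt_arrival r).le.trans hr)
  set F : ℕ × ℕ × ℕ → ℝ := fun i => s.real 0 i.1 i.2.1 i.2.2 + s.real POTENTIAL i.1 i.2.2 0 -
    s.real POTENTIAL i.2.1 (i.2.2 + s.nat 1 i.1 i.2.1 0) 0 with hF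
  have key := run_count_pointwise (x := ORIG) (e := locs) (c := count DEST locs
      (count TIME (horizon + 1) (rset 3 (var ORIG) (var DEST) (var TIME)
        (tripCost (var ORIG) (var DEST) (var TIME) + .cell POTENTIAL (var ORIG) (var TIME) 0 -
          .cell POTENTIAL (var DEST) (var TIME + travelTime (var ORIG) (var DEST)) 0))))
    (fun s' (i : ℕ × ℕ × ℕ) => s'.real 3 i.1 i.2.1 i.2.2) (fun i _ => F i)
    (fun i => i.2.1 < l ∧ i.2.2 < E.T + 1) Prod.fst hE.locs (fun _ _ => rfl)
    (fun a _ s₁ ha hs₁ i => ?_) (r.orig, r.dest, r.start)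
  · rw [if_pos ⟨⟨r.dest.2, hstart⟩, r.orig.2⟩] at key
    simp only [hF, hE.tripCost hr, hE.travelTime] at key
    exact key
  · have hE₁ : Input E s₁ := hE.of_frame hs₁
    rw [run_count_count_pointwise (x := DEST) (y := TIME) (e := locs) (e' := horizon + 1)
      (c := rset 3 (var ORIG) (var DEST) (var TIME)
        (tripCost (var ORIG) (var DEST) (var TIME) + .cell POTENTIAL (var ORIG) (var TIME) 0 -
          .cell POTENTIAL (var DEST) (var TIME + travelTime (var ORIG) (var DEST)) 0))
      (fun s' (i : ℕ × ℕ × ℕ) => s'.real 3 i.1 i.2.1 i.2.2)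
      (fun i _ => F i) (fun i => i.1 = a) (fun i => i.2.1) (fun i => i.2.2) hE₁.locs
      (N' := E.T + 1) (fun s' hs' => by simp [(hE₁.of_frame hs').horizon]) (by decide)
      (fun _ _ _ _ => rfl) (fun b _ t _ s₂ hb ht hs₂ i => ?_)]
    · grind
    · have ha₂ : s₂.nat ORIG 0 0 0 = a := by rw [hs₂.nat ORIG (by decide), ha]
      simp only [run, eval_cell, eval_zero, evalReal_cell, evalReal_add, evalReal_sub, eval_add,
        eval_const, ha₂, hb, ht, Store.setReal_real_self, updateAt, hs₂.real 0 (by decide),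
        hs₁.real 0 (by decide), hs₂.real POTENTIAL (by decide), hs₁.real POTENTIAL (by decide),
        hs₂.nat 1 (by decide), hs₁.nat 1 (by decide)]
      exact if_ctx_congr and_assoc.symm (fun h => by rw [hF]; simp only [h]) fun _ => rfl

lemma nat_writePickUps (hE : Input E s) (j : Fin m) :
    (writePickUps.run s).nat 4 j 0 0 = s.nat RESIDUAL (n + j) 1 0 := by
  have key := run_count_pointwise (x := AGENT) (e := riders)
    (c := nset 4 (var AGENT) 0 0 (residual (drivers + var AGENT) 1))
    (fun s' (j : ℕ) => s'.nat 4 j 0 0) (fun j _ => s.nat RESIDUAL (n + j) 1 0) (fun _ => True) id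
    hE.riders (fun _ _ => rfl) (fun k _ s' hk hs' j => by
      simp only [run, eval_cell, eval_add, eval_zero, eval_one, eval_const, hk,
        (hE.of_frame hs').drivers, hs'.nat RESIDUAL (by decide), Store.setNat_nat_self, updateAt,
        and_true, id_eq, true_and]
      exact if_ctx_congr Iff.rfl (fun h => by rw [h]) fun _ => rfl) j
  simpa [writePickUps] using key

end Prices

/-! ### Decomposition of flows into action paths -/

section Decomposition

open Economy

variable {E : Economy (Fin l) (Fin n) (Fin m)} {G : Net} {f r : ℕ → ℕ} {e : ℕ}
  {i : Fin n} {a : Trip (Fin l) × Option (Fin m)} {z z₀ : Fin n → ActionPath (Fin l) (Fin m)}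
  {v : Node} {D : Node → ℤ}

/-- Arc `e` of the network stands for the action `a`, a relocation or a trip with a rider. -/
structure IsAction (E : Economy (Fin l) (Fin n) (Fin m)) (G : Net) (e : ℕ)
    (a : Trip (Fin l) × Option (Fin m)) : Prop where
  mem_trips : a.1 ∈ E.trips
  tail : G.node e 0 = (↑a.1.orig, a.1.start)
  head : G.node e 1 = (↑a.1.dest, E.arrival a.1)
  le : n ≤ e
  eq_some_iff : ∀ j, a.2 = some j ↔ e = n + j
  request : ∀ j, a.2 = some j → a.1 = E.request j
  relocation : a.2 = none → IsRow G e (relocationRow E a.1)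

lemma IsAction.code_eq (ha : IsAction E G e a) :
    (if n + m ≤ e then 0 else e - n + 1) = a.2.elim 0 fun j => (j : ℕ) + 1 := by
  have hle := ha.le
  have hiff := ha.eq_some_iff
  cases hj : a.2 with
  | none =>
    refine if_pos (not_lt.1 fun hlt => ?_)
    have := (hiff ⟨e - n, by omega⟩).2 (by simp only; omega)
    simp [hj] at this
  | some j =>
    obtain rfl := (hiff j).1 hj
    simp

lemma Represents.exists_isAction_or_exit (hG : Represents E G) (he : e < G.M) (hn : n ≤ e) :
    (∃ a, IsAction E G e a) ∨ (n + m ≤ e ∧ ∃ (a : Fin l) (t : ℕ), IsRow G e (exitRow E a t)) := by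
  rcases hG.exists_row he with ⟨i, rfl, -⟩ | ⟨j, rfl, hR⟩ | ⟨hge, a, t, -, hR⟩ | ⟨hge, r, hr, hR⟩
  · exact absurd hn i.2.not_ge
  · refine .inl ⟨(E.request j, some j), E.request_mem j, hR.tail, hR.head, hn, fun j' => ?_,
      fun j' h => ?_, fun h => by simp at h⟩
    · simp [Fin.ext_iff]
    · rw [Option.some.inj h]
  · exact .inr ⟨hge, a, t, hR⟩
  · refine .inl ⟨(r, none), hr, hR.tail, hR.head, hn, fun j => ?_, fun j h => by simp at h,
      fun _ => hR⟩
    simp only [reduceCtorEq, false_iff]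
    omega

/-- The node at which an action path of driver `i` ends. -/
def endNode (E : Economy (Fin l) (Fin n) (Fin m)) (i : Fin n) (w : ActionPath (Fin l) (Fin m)) :
    Node :=
  ((endLoc (E.entryLoc i) (w.map Prod.fst) : Fin l), E.endTime (E.entryTime i) (w.map Prod.fst))

lemma endNode_concat (i : Fin n) (w : ActionPath (Fin l) (Fin m))
    (a : Trip (Fin l) × Option (Fin m)) :
    endNode E i (w ++ [a]) = (↑a.1.dest, E.arrival a.1) := by
  simp only [endNode, List.map_append, List.map_singleton, endLoc_concat, endTime_concat]

lemma count_carried_update (z : Fin n → ActionPath (Fin l) (Fin m)) (i : Fin n)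
    (a : Trip (Fin l) × Option (Fin m)) (j : Fin m) :
    ∑ i', (carried (Function.update z i (z i ++ [a]) i')).count j =
      ∑ i', (carried (z i')).count j + if a.2 = some j then 1 else 0 := by
  have hcount : ∀ i', (carried (Function.update z i (z i ++ [a]) i')).count j =
      (carried (z i')).count j + if i' = i then (if a.2 = some j then 1 else 0) else 0 := by
    intro i'
    rcases eq_or_ne i' i with rfl | hne
    · obtain ⟨q, _ | j'⟩ := a <;> simp [carried, List.count_singleton]
    · simp [hne]
  simp only [hcount, Finset.sum_add_distrib, Finset.sum_ite_eq', Finset.mem_univ, if_true]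

/-- The flow `f` decomposes into the flow along the action paths `z` and the remainder `r`. For the
arcs of the riders the amounts agree; arcs for relocations and exits need only have flow. -/
structure Decomposes (E : Economy (Fin l) (Fin n) (Fin m)) (G : Net) (f r : ℕ → ℕ)
    (z : Fin n → ActionPath (Fin l) (Fin m)) : Prop where
  le : ∀ e, r e ≤ f e
  emptyPath : ∀ e < n, r e = f e
  feasible : ∀ i, z i ∈ E.actionPaths i
  relocation : ∀ i q, (q, none) ∈ z i → ∃ e < G.M, 1 ≤ f e ∧ IsRow G e (relocationRow E q)
  rider : ∀ j : Fin m, f (n + j) = r (n + j) + ∑ i, (carried (z i)).count j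

/-- Arc `e`, not one for an empty path, begins at node `v` and has flow. -/
structure Usable (n : ℕ) (G : Net) (r : ℕ → ℕ) (v : Node) (e : ℕ) : Prop where
  lt : e < G.M
  le : n ≤ e
  flow : 1 ≤ r e
  tail : G.node e 0 = v

namespace Decomposes

lemma update_le (h : Decomposes E G f r z) (e e' : ℕ) :
    Function.update r e (r e - 1) e' ≤ f e' := by
  rcases eq_or_ne e' e with rfl | hne
  · rw [Function.update_self]
    exact (Nat.sub_le _ _).trans (h.le e')
  · rw [Function.update_of_ne hne]
    exact h.le e'

lemma drop (h : Decomposes E G f r z) (he : n + m ≤ e) :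
    Decomposes E G f (Function.update r e (r e - 1)) z where
  le := h.update_le e
  emptyPath e' he' := by rw [Function.update_of_ne (by omega), h.emptyPath e' he']
  feasible := h.feasible
  relocation := h.relocation
  rider j := by rw [Function.update_of_ne (by omega), h.rider j]

lemma concat_mem_actionPaths (h : Decomposes E G f r z) (ha : IsAction E G e a)
    (hend : endNode E i (z i) = G.node e 0) : z i ++ [a] ∈ E.actionPaths i := by
  have hnode := (hend.trans ha.tail).symm
  simp only [endNode, Prod.mk.injEq, Fin.val_inj] at hnode
  refine ⟨?_, fun q j hq => ?_⟩
  · rw [List.map_append]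
    exact (h.feasible i).1.concat hnode.1 hnode.2 ha.mem_trips
  · rcases List.mem_append.1 hq with hq | hq
    · exact (h.feasible i).2 q j hq
    · obtain rfl := List.mem_singleton.1 hq
      exact ha.request j rfl

lemma append (h : Decomposes E G f r z) (hu : Usable n G r v e) (ha : IsAction E G e a)
    (hend : endNode E i (z i) = G.node e 0) :
    Decomposes E G f (Function.update r e (r e - 1)) (Function.update z i (z i ++ [a])) where
  le := h.update_le e
  emptyPath e' he' := by
    rw [Function.update_of_ne (he'.trans_le hu.le).ne, h.emptyPath e' he']
  feasible i' := by
    rcases eq_or_ne i' i with rfl | hne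
    · rw [Function.update_self]
      exact h.concat_mem_actionPaths ha hend
    · rw [Function.update_of_ne hne]
      exact h.feasible i'
  relocation i' q hq := by
    rcases eq_or_ne i' i with rfl | hne
    · rw [Function.update_self] at hq
      rcases List.mem_append.1 hq with hq | hq
      · exact h.relocation i' q hq
      · obtain rfl := List.mem_singleton.1 hq
        exact ⟨e, hu.lt, hu.flow.trans (h.le e), ha.relocation rfl⟩
    · rw [Function.update_of_ne hne] at hq
      exact h.relocation i' q hq
  rider j := by
    have hflow := hu.flow
    rw [h.rider j, count_carried_update]
    by_cases hj : e = n + j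
    · rw [if_pos ((ha.eq_some_iff j).2 hj), ← hj, Function.update_self]
      omega
    · rw [if_neg fun h' => hj ((ha.eq_some_iff j).1 h'), Function.update_of_ne (Ne.symm hj),
        add_zero]

end Decomposes

/-- The flow without that on the arcs for empty paths. -/
def tripFlow (n : ℕ) (r : ℕ → ℕ) (e : ℕ) : ℕ := if e < n then 0 else r e

lemma Usable.net_tripFlow_update (hu : Usable n G r v e) (w : Node) :
    G.net (tripFlow n (Function.update r e (r e - 1))) w = G.net (tripFlow n r) w -
      (if v = w then 1 else 0) + if G.node e 1 = w then 1 else 0 := by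
  have hle := hu.le
  have hflow := hu.flow
  rw [G.net_of_eq (f := tripFlow n r) (c := -1) hu.lt, hu.tail]
  · ring
  · exact fun e' he' => by simp [tripFlow, he']
  · simp only [tripFlow, hle.not_gt, if_false, Function.update_self]
    omega

/-- There is flow on the arc for exiting where the action path `w` of driver `i` ends. -/
def Exits (E : Economy (Fin l) (Fin n) (Fin m)) (G : Net) (f : ℕ → ℕ) (i : Fin n)
    (w : ActionPath (Fin l) (Fin m)) : Prop :=
  ∃ e < G.M, 1 ≤ f e ∧ IsRow G e (exitRow E (endLoc (E.entryLoc i) (w.map Prod.fst))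
    (E.endTime (E.entryTime i) (w.map Prod.fst)))

/-- One unit of flow has been followed for driver `i` from her entrance to node `v`, where `D` is
the net outflow that will be left when the sink is reached. -/
structure Following (E : Economy (Fin l) (Fin n) (Fin m)) (G : Net) (f : ℕ → ℕ) (D : Node → ℤ)
    (i : Fin n) (z₀ z : Fin n → ActionPath (Fin l) (Fin m)) (r : ℕ → ℕ) (v : Node) : Prop where
  decomposes : Decomposes E G f r z
  other : ∀ i', i' ≠ i → z i' = z₀ i'
  flow : ∀ w, w ≠ G.sink → G.net (tripFlow n r) w = D w + if v = w then 1 else 0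
  cur : (v.2 ≤ E.T ∧ endNode E i (z i) = v) ∨ (v = G.sink ∧ Exits E G f i (z i))

lemma Represents.ne_sink (hG : Represents E G) (hv : v.2 ≤ E.T) : v ≠ G.sink := by
  rintro rfl
  rw [hG.sink_eq] at hv
  exact Nat.not_succ_le_self _ hv

namespace Following

lemma flow_update (h : Following E G f D i z₀ z r v) (hu : Usable n G r v e) (w : Node)
    (hw : w ≠ G.sink) : G.net (tripFlow n (Function.update r e (r e - 1))) w =
      D w + if G.node e 1 = w then 1 else 0 := by
  rw [hu.net_tripFlow_update, h.flow w hw, add_sub_cancel_right]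

lemma endNode_eq (h : Following E G f D i z₀ z r v) (hG : Represents E G) (hv : v.2 ≤ E.T) :
    endNode E i (z i) = v :=
  h.cur.elim And.right fun h' => absurd h'.1 (hG.ne_sink hv)

lemma exists_usable (h : Following E G f D i z₀ z r v) (hG : Represents E G) (hv : v.2 ≤ E.T)
    (hD : 0 ≤ D v) : ∃ e, Usable n G r v e := by
  have hpos : 0 < G.net (tripFlow n r) v := by
    rw [h.flow v (hG.ne_sink hv), if_pos rfl]
    omega
  obtain ⟨e, he, hflow, htail⟩ := G.exists_arc_of_net_pos hpos
  rw [tripFlow] at hflow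
  split_ifs at hflow with hn
  · omega
  · exact ⟨e, he, not_lt.1 hn, hflow, htail⟩

lemma append (h : Following E G f D i z₀ z r v) (hG : Represents E G) (hv : v.2 ≤ E.T)
    (hu : Usable n G r v e) (ha : IsAction E G e a) :
    Following E G f D i z₀ (Function.update z i (z i ++ [a])) (Function.update r e (r e - 1))
      (G.node e 1) where
  decomposes := h.decomposes.append hu ha ((h.endNode_eq hG hv).trans hu.tail.symm)
  other i' hi' := by rw [Function.update_of_ne hi', h.other i' hi']
  flow := h.flow_update hu
  cur := Or.inl ⟨by rw [ha.head]; exact ha.mem_trips, by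
    rw [Function.update_self, endNode_concat, ha.head]⟩

lemma exit (h : Following E G f D i z₀ z r v) (hG : Represents E G) (hv : v.2 ≤ E.T)
    (hu : Usable n G r v e) (he : n + m ≤ e) {b : Fin l} {t : ℕ} (hR : IsRow G e (exitRow E b t)) :
    Following E G f D i z₀ z (Function.update r e (r e - 1)) (G.node e 1) where
  decomposes := h.decomposes.drop he
  other := h.other
  flow := h.flow_update hu
  cur := by
    have hend := ((h.endNode_eq hG hv).trans hu.tail.symm).trans hR.tail
    simp only [endNode, exitRow, Prod.mk.injEq, Fin.val_inj] at hend
    exact Or.inr ⟨hR.head.trans hG.sink_eq.symm, e, hu.lt, hu.flow.trans (h.decomposes.le e), by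
      rwa [hend.1, hend.2]⟩

end Following

end Decomposition

section Demand

variable {E : Economy (Fin l) (Fin n) (Fin m)} {G : Net} {f r : ℕ → ℕ} {i : Fin n}
  {z z' : Fin n → ActionPath (Fin l) (Fin m)} {v : Node} {k : ℕ}

/-- The number of the drivers from `k` on that enter at node `v` and do not take the empty path. -/
def demand (E : Economy (Fin l) (Fin n) (Fin m)) (f : ℕ → ℕ) (k : ℕ) (v : Node) : ℤ :=
  ∑ i : Fin n with k ≤ i.1 ∧ f i.1 = 0, if source E i = v then 1 else 0

lemma demand_nonneg (E : Economy (Fin l) (Fin n) (Fin m)) (f : ℕ → ℕ) (k : ℕ) (v : Node) :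
    0 ≤ demand E f k v :=
  Finset.sum_nonneg fun _ _ => by split_ifs <;> decide

lemma demand_eq_zero (E : Economy (Fin l) (Fin n) (Fin m)) (f : ℕ → ℕ) (v : Node) :
    demand E f n v = 0 :=
  Finset.sum_eq_zero fun i hi => absurd (Finset.mem_filter.1 hi).2.1 i.2.not_ge

lemma demand_of_ne_zero (h : f i ≠ 0) (v : Node) : demand E f i v = demand E f (i + 1) v := by
  refine Finset.sum_congr (Finset.filter_congr fun i' _ => and_congr_left fun hi' => ?_)
    fun _ _ => rfl
  have hne : i'.1 ≠ i := fun heq => h (heq ▸ hi')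
  omega

lemma demand_of_eq_zero (h : f i = 0) (v : Node) :
    demand E f i v = demand E f (i + 1) v + if source E i = v then 1 else 0 := by
  have hinsert : Finset.univ.filter (fun i' : Fin n => i.1 ≤ i' ∧ f i' = 0) =
      insert i (Finset.univ.filter fun i' : Fin n => i + 1 ≤ i'.1 ∧ f i' = 0) := by
    ext i'
    simp only [Finset.mem_filter_univ, Finset.mem_insert]
    rcases eq_or_ne i' i with rfl | hne
    · simp [h]
    · have := Fin.val_ne_of_ne hne
      simp only [hne, false_or, and_congr_left_iff]
      omega
  rw [demand, hinsert, Finset.sum_insert (by simp), add_comm]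
  rfl

/-- The flow has been followed for the drivers before `k`, which gave the action paths `z` and left
the flow `r`. -/
structure Followed (E : Economy (Fin l) (Fin n) (Fin m)) (G : Net) (f : ℕ → ℕ) (k : ℕ)
    (z : Fin n → ActionPath (Fin l) (Fin m)) (r : ℕ → ℕ) : Prop where
  decomposes : Decomposes E G f r z
  eq_nil : ∀ i : Fin n, k ≤ i ∨ f i ≠ 0 → z i = []
  exits : ∀ i : Fin n, i < k → f i = 0 → Exits E G f i (z i)
  flow : ∀ w, w ≠ G.sink → G.net (tripFlow n r) w = demand E f k w

namespace Followed

lemma skip (h : Followed E G f i z r) (hi : f i ≠ 0) : Followed E G f (i + 1) z r where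
  decomposes := h.decomposes
  eq_nil i' hi' := h.eq_nil i' (hi'.imp_left fun hle => by omega)
  exits i' hlt hi' := h.exits i'
    (lt_of_le_of_ne (Nat.lt_succ_iff.1 hlt) fun heq => hi (heq ▸ hi')) hi'
  flow w hw := (h.flow w hw).trans (demand_of_ne_zero hi w)

lemma following (h : Followed E G f i z r) (hi : f i = 0) :
    Following E G f (demand E f (i + 1)) i z z r (source E i) where
  decomposes := h.decomposes
  other _ _ := rfl
  flow w hw := (h.flow w hw).trans (demand_of_eq_zero hi w)
  cur := Or.inl ⟨E.entryTime_le i, by rw [h.eq_nil i (Or.inl le_rfl)]; rfl⟩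

lemma succ (h : Followed E G f i z r) (hi : f i = 0) {r' : ℕ → ℕ}
    (h' : Following E G f (demand E f (i + 1)) i z z' r' v) (hv : E.T < v.2) :
    Followed E G f (i + 1) z' r' := by
  obtain ⟨rfl, hexits⟩ := h'.cur.resolve_left fun hcur => hcur.1.not_gt hv
  refine ⟨h'.decomposes, fun i' hi' => ?_, fun i' hlt hi' => ?_, fun w hw => ?_⟩
  · have hne : i' ≠ i := by
      rintro rfl
      exact hi'.elim (fun hle => by omega) fun hne => hne hi
    rw [h'.other i' hne]
    exact h.eq_nil i' (hi'.imp_left fun hle => by omega)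
  · rcases eq_or_ne i' i with rfl | hne
    · exact hexits
    · rw [h'.other i' hne]
      exact h.exits i' (lt_of_le_of_ne (Nat.lt_succ_iff.1 hlt) (Fin.val_ne_of_ne hne)) hi'
  · rw [h'.flow w hw, if_neg hw.symm, add_zero]

end Followed

end Demand

/-- The flow on the arcs. -/
def flowOf (s : Store) (e : ℕ) : ℕ := s.nat RESIDUAL e 1 0

section Actions

variable {E : Economy (Fin l) (Fin n) (Fin m)} {s s' : Store} {e : ℕ} {i : Fin n}
  {a : Trip (Fin l) × Option (Fin m)} {z : Fin n → ActionPath (Fin l) (Fin m)}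

/-- The store holds the action paths `z`, encoded as in `HoldsPlan`. -/
structure HoldsActions (s : Store) (z : Fin n → ActionPath (Fin l) (Fin m)) : Prop where
  len : ∀ i : Fin n, s.nat 5 i 0 0 = (z i).length
  row : ∀ (i : Fin n) (k : ℕ) (hk : k < (z i).length),
    s.nat 6 i k 0 = (z i)[k].1.orig ∧
    s.nat 6 i k 1 = (z i)[k].1.dest ∧
    s.nat 6 i k 2 = (z i)[k].1.start ∧
    s.nat 6 i k 3 = (z i)[k].2.elim 0 (fun j => (j : ℕ) + 1)

namespace HoldsActions

lemma congr (h : HoldsActions s z) (h5 : s'.nat 5 = s.nat 5) (h6 : s'.nat 6 = s.nat 6) :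
    HoldsActions s' z := by
  obtain ⟨hlen, hrow⟩ := h
  rw [← h5] at hlen
  rw [← h6] at hrow
  exact ⟨hlen, hrow⟩

lemma of_frame (h : HoldsActions s z) {c : Code} (hs : c.Frame s s')
    (h5 : 5 ∉ c.writes := by decide) (h6 : 6 ∉ c.writes := by decide) : HoldsActions s' z :=
  h.congr (hs.nat 5 h5) (hs.nat 6 h6)

lemma append (h : HoldsActions s z)
    (hlen : ∀ i', s'.nat 5 i' 0 0 = s.nat 5 i' 0 0 + if i' = i then 1 else 0)
    (hold : ∀ i' k c, ¬ (i' = i ∧ k = (z i).length) → s'.nat 6 i' k c = s.nat 6 i' k c)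
    (horig : s'.nat 6 i (z i).length 0 = a.1.orig) (hdest : s'.nat 6 i (z i).length 1 = a.1.dest)
    (hstart : s'.nat 6 i (z i).length 2 = a.1.start)
    (hcode : s'.nat 6 i (z i).length 3 = a.2.elim 0 fun j => (j : ℕ) + 1) :
    HoldsActions s' (Function.update z i (z i ++ [a])) where
  len i' := by
    rw [hlen, h.len]
    rcases eq_or_ne i' i with rfl | hne
    · simp
    · simp [hne, Fin.val_ne_of_ne hne]
  row i' k hk := by
    rcases eq_or_ne i' i with rfl | hne
    · simp only [Function.update_self, List.length_append, List.length_singleton] at hk ⊢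
      rcases (Nat.lt_succ_iff.1 hk).lt_or_eq with hlt | rfl
      · simp only [List.getElem_append_left hlt, hold i' k _ fun heq => hlt.ne heq.2]
        exact h.row i' k hlt
      · simp only [List.getElem_concat_length]
        exact ⟨horig, hdest, hstart, hcode⟩
    · simp only [Function.update_of_ne hne] at hk ⊢
      simp only [hold i' k _ fun heq => hne heq.1]
      exact h.row i' k hk

lemma recordTrip (h : HoldsActions s z) (hE : Input E s) (hi : s.nat AGENT 0 0 0 = i)
    (he : s.nat FOUNDARC 0 0 0 = e) (ha : IsAction E (netOf s) e a)
    (hcur : current s = (netOf s).node e 0) :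
    HoldsActions (recordTrip.run s) (Function.update z i (z i ++ [a])) := by
  have htail := hcur.trans ha.tail
  have hhead : (s.nat ENDS e 0 1, s.nat ENDS e 1 1) = (↑a.1.dest, E.arrival a.1) := ha.head
  simp only [current, Prod.mk.injEq] at htail hhead
  have hrun : Algorithm.recordTrip.run s =
      (((((s.setNat 6 i (z i).length 0 a.1.orig).setNat 6 i (z i).length 1 a.1.dest).setNat
        6 i (z i).length 2 a.1.start).setNat 6 i (z i).length 3
          (a.2.elim 0 fun j => (j : ℕ) + 1)).setNat 5 i 0 0 ((z i).length + 1)) := by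
    rw [← ha.code_eq]
    by_cases hle : n + m ≤ e <;>
      simp [Algorithm.recordTrip, run, hi, he, h.len, htail, hhead, hE.drivers, hE.riders, hle]
  rw [hrun]
  refine h.append (fun i' => ?_) (fun i' k c hne => ?_) ?_ ?_ ?_ ?_
  · by_cases hi' : i' = i <;> simp [updateAt, hi', h.len]
  · have hne' : ∀ p, ¬ (i' = i ∧ k = (z i).length ∧ p) := fun p hp => hne ⟨hp.1, hp.2.1⟩
    simp [updateAt, Fin.val_inj, hne']
  all_goals simp [updateAt]

end HoldsActions

end Actions

section Follow

variable {E : Economy (Fin l) (Fin n) (Fin m)} {s : Store} {e : ℕ} {i : Fin n}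
  {a : Trip (Fin l) × Option (Fin m)} {z z₀ : Fin n → ActionPath (Fin l) (Fin m)} {f : ℕ → ℕ}
  {D : Node → ℤ}

lemma current_frame {c : Code} {s s' : Store} (hs : c.Frame s s')
    (hloc : NODELOC ∉ c.writes := by decide) (htime : NODETIME ∉ c.writes := by decide) :
    current s' = current s := by
  rw [current, current, hs.nat NODELOC hloc, hs.nat NODETIME htime]

lemma flowOf_frame {c : Code} {s s' : Store} (hs : c.Frame s s')
    (hres : RESIDUAL ∉ c.writes := by decide) : flowOf s' = flowOf s := by
  unfold flowOf
  rw [hs.nat RESIDUAL hres]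

lemma usable_findArc (hE : Input E s) (h : ∃ e, Usable n (netOf s) (flowOf s) (current s) e) :
    Usable n (netOf s) (flowOf s) (current s) ((findArc.run s).nat FOUNDARC 0 0 0) := by
  obtain ⟨e, he⟩ := h
  refine run_count (N := (netOf s).M) (fun k s' => (∃ e < k, Usable n (netOf s) (flowOf s)
    (current s) e) → Usable n (netOf s) (flowOf s) (current s) (s'.nat FOUNDARC 0 0 0))
    rfl (fun _ _ _ h => h) (fun ⟨e, he, _⟩ => absurd he e.not_lt_zero)
    (fun k hk s' hcount hs' ih => ?_) ⟨e, he.lt, he⟩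
  have htest : (Test.and (.nle drivers (var ARC)) (.and (.nle 1 (residual (var ARC) 1))
      (.and (equal (var NODELOC) (arcLoc (var ARC) 0))
        (equal (var NODETIME) (arcTime (var ARC) 0))))).Holds s' ↔
      Usable n (netOf s) (flowOf s) (current s) k := by
    rw [← netOf_frame hs', ← flowOf_frame hs', ← current_frame hs'] at *
    simp only [holds_and, holds_nle, holds_equal, eval_cell, eval_zero, eval_one, eval_const,
      hcount, (hE.of_frame hs').drivers]
    exact ⟨fun ⟨hle, hflow, hloc, htime⟩ => ⟨hk, hle, hflow, Prod.ext hloc.symm htime.symm⟩,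
      fun hu => ⟨hu.le, hu.flow, (congrArg Prod.fst hu.tail).symm,
        (congrArg Prod.snd hu.tail).symm⟩⟩
  rw [run, htest]
  split_ifs with hu
  · intro _
    simpa [run, hcount] using hu
  · rintro ⟨e, he, heu⟩
    refine ih ⟨e, lt_of_le_of_ne (Nat.lt_succ_iff.1 he) fun heq => hu (heq ▸ heu), heu⟩

lemma flowOf_traverse (he : s.nat FOUNDARC 0 0 0 = e) :
    flowOf (traverse.run s) = Function.update (flowOf s) e (flowOf s e - 1) := by
  refine (flowOf_frame (frame_run
    (ite (.nle (arcTime (var FOUNDARC) 1) horizon) recordTrip skip ;; advance) _)).trans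
    (funext fun e' => ?_)
  simp [flowOf, run, he, updateAt, Function.update_apply]

lemma current_advance (he : s.nat FOUNDARC 0 0 0 = e) :
    current (advance.run s) = (netOf s).node e 1 := by
  simp [advance, run, current, he, Net.node, netOf]

lemma current_traverse (he : s.nat FOUNDARC 0 0 0 = e) :
    current (traverse.run s) = (netOf s).node e 1 := by
  have hs := frame_run (nset RESIDUAL (var FOUNDARC) 1 0 (residual (var FOUNDARC) 1 - 1) ;;
    ite (.nle (arcTime (var FOUNDARC) 1) horizon) recordTrip skip) s
  have hfound := congrFun (congrFun (congrFun (hs.nat FOUNDARC (by decide)) 0) 0) 0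
  rw [← netOf_frame hs]
  exact current_advance (hfound.trans he)

open Classical in
lemma run_traverse :
    ∃ s₁, (nset RESIDUAL (var FOUNDARC) 1 0 (residual (var FOUNDARC) 1 - 1)).Frame s s₁ ∧
      traverse.run s = advance.run (
          if (Test.nle (arcTime (var FOUNDARC) 1) horizon).Holds s₁ then recordTrip.run s₁
          else s₁) :=
  ⟨_, frame_run _ s, rfl⟩

lemma HoldsActions.traverse_of_isAction (h : HoldsActions s z) (hE : Input E s)
    (hi : s.nat AGENT 0 0 0 = i) (he : s.nat FOUNDARC 0 0 0 = e) (ha : IsAction E (netOf s) e a)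
    (hcur : current s = (netOf s).node e 0) :
    HoldsActions (traverse.run s) (Function.update z i (z i ++ [a])) := by
  obtain ⟨s₁, hs, hrun⟩ := run_traverse (s := s)
  have harr : s₁.nat ENDS e 1 1 = E.arrival a.1 := by
    rw [hs.nat ENDS (by decide)]
    exact congrArg Prod.snd ha.head
  rw [← hs.nat AGENT (by decide)] at hi
  rw [← hs.nat FOUNDARC (by decide)] at he
  rw [← netOf_frame hs] at ha hcur
  rw [← current_frame hs] at hcur
  rw [hrun, if_pos]
  · exact ((h.of_frame hs).recordTrip (hE.of_frame hs) hi he ha hcur).of_frame (frame_run advance _)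
  · simp only [holds_nle, eval_cell, eval_zero, eval_one, eval_three, eval_const, he, harr,
      (hE.of_frame hs).horizon]
    exact ha.mem_trips

lemma HoldsActions.traverse_of_lt (h : HoldsActions s z) (hE : Input E s)
    (he : s.nat FOUNDARC 0 0 0 = e) (hlt : E.T < ((netOf s).node e 1).2) :
    HoldsActions (traverse.run s) z := by
  obtain ⟨s₁, hs, hrun⟩ := run_traverse (s := s)
  rw [← hs.nat FOUNDARC (by decide)] at he
  rw [← netOf_frame hs] at hlt
  rw [hrun, if_neg]
  · exact (h.of_frame hs).of_frame (frame_run advance _)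
  · simp only [holds_nle, eval_cell, eval_zero, eval_one, eval_three, eval_const, he,
      (hE.of_frame hs).horizon]
    exact hlt.not_ge

lemma exists_following_traverse (hE : Input E s) (hG : Represents E (netOf s))
    (hi : s.nat AGENT 0 0 0 = i) (he : s.nat FOUNDARC 0 0 0 = e)
    (hu : Usable n (netOf s) (flowOf s) (current s) e)
    (h : Following E (netOf s) f D i z₀ z (flowOf s) (current s)) (hz : HoldsActions s z)
    (ht : (current s).2 ≤ E.T) : ∃ z', Following E (netOf s) f D i z₀ z'
      (flowOf (traverse.run s)) (current (traverse.run s)) ∧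
      HoldsActions (traverse.run s) z' := by
  rw [flowOf_traverse he, current_traverse he]
  rcases hG.exists_isAction_or_exit hu.lt hu.le with ⟨a, ha⟩ | ⟨hle, b, t, hR⟩
  · exact ⟨_, h.append hG ht hu ha, hz.traverse_of_isAction hE hi he ha hu.tail.symm⟩
  · refine ⟨z, h.exit hG ht hu hle hR, hz.traverse_of_lt hE he ?_⟩
    rw [hR.head]
    exact Nat.lt_succ_self E.T

lemma exists_following_findArc_traverse (hE : Input E s) (hG : Represents E (netOf s))
    (hD : ∀ v, 0 ≤ D v) (hi : s.nat AGENT 0 0 0 = i)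
    (h : Following E (netOf s) f D i z₀ z (flowOf s) (current s)) (hz : HoldsActions s z)
    (ht : (current s).2 ≤ E.T) : ∃ z', Following E (netOf s) f D i z₀ z'
      (flowOf ((findArc ;; traverse).run s)) (current ((findArc ;; traverse).run s)) ∧
      HoldsActions ((findArc ;; traverse).run s) z' ∧
      (current s).2 < (current ((findArc ;; traverse).run s)).2 := by
  have hu := usable_findArc hE (h.exists_usable hG ht (hD _))
  have hlt : (current s).2 < (current ((findArc ;; traverse).run s)).2 := by
    refine lt_of_eq_of_lt (congrArg Prod.snd hu.tail.symm)
      ((hG.proper.time_lt _ hu.lt).trans_eq (congrArg Prod.snd ?_))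
    rw [← netOf_frame (frame_run findArc s)]
    exact (current_traverse rfl).symm
  have hs := frame_run findArc s
  rw [← hs.nat AGENT (by decide)] at hi
  simp only [← netOf_frame hs, ← flowOf_frame hs, ← current_frame hs] at hG h ht hu
  obtain ⟨z', h', hz'⟩ := exists_following_traverse (hE.of_frame hs) hG hi rfl hu h
    (hz.of_frame hs) ht
  refine ⟨z', ?_, hz', hlt⟩
  rwa [← netOf_frame hs]

lemma exists_following_follow (hE : Input E s) (hG : Represents E (netOf s))
    (hD : ∀ v, 0 ≤ D v) (hi : s.nat AGENT 0 0 0 = i)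
    (h : Following E (netOf s) f D i z z (flowOf s) (source E i)) (hz : HoldsActions s z) :
    ∃ z' v, Following E (netOf s) f D i z z' (flowOf (follow.run s)) v ∧
      HoldsActions (follow.run s) z' ∧ E.T < v.2 := by
  let enter := assign NODELOC (entryLoc (var AGENT)) ;; assign NODETIME (entryTime (var AGENT))
  have hs₁ := frame_run enter s
  have hcur : current (enter.run s) = source E i := by
    rw [← hE.entry_eq hi]
    simp [enter, run, current, entry]
  rw [← hcur, ← flowOf_frame hs₁, ← netOf_frame hs₁] at h
  have hrun := run_count (x := ROUND) (e := horizon + 1)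
    (c := ite (.nle (var NODETIME) horizon) (findArc ;; traverse) skip) (N := E.T + 1)
    (fun k s' => ∃ z', Following E (netOf s) f D i z z' (flowOf s') (current s') ∧
      HoldsActions s' z' ∧ k ≤ (current s').2)
    (s := enter.run s) (by simp [(hE.of_frame hs₁).horizon])
    (fun _ _ _ ⟨z', h', hz', hk⟩ => ⟨z', h', hz'.congr rfl rfl, hk⟩)
    ⟨z, by rwa [← netOf_frame hs₁], hz.of_frame hs₁, Nat.zero_le _⟩
    fun k hkT s' _ hs₂ hI => ?_
  · obtain ⟨z', h', hz', hlt⟩ := hrun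
    exact ⟨z', _, h', hz', hlt⟩
  · obtain ⟨z', h', hz', hk⟩ := hI
    have hE' := (hE.of_frame hs₁).of_frame hs₂
    have hnet := (netOf_frame hs₂).trans (netOf_frame hs₁)
    have htest : (Test.nle (var NODETIME) horizon).Holds s' ↔ (current s').2 ≤ E.T := by
      simp only [holds_nle, eval_cell, eval_zero, eval_const, eval_three, hE'.horizon, current]
    rw [run, htest]
    split_ifs with ht
    · rw [← hs₁.nat AGENT (by decide), ← hs₂.nat AGENT (by decide)] at hi
      rw [← hnet] at hG h' ⊢
      obtain ⟨z'', h'', hz'', hlt⟩ := exists_following_findArc_traverse hE' hG hD hi h' hz' ht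
      exact ⟨z'', h'', hz'', hk.trans_lt hlt⟩
    · exact ⟨z', h', hz', (Nat.lt_succ_iff.1 hkT).trans_lt (not_le.1 ht)⟩

lemma exists_followed_writePaths (hE : Input E s) (hG : Represents E (netOf s))
    (hlen : ∀ i : Fin n, s.nat 5 i 0 0 = 0)
    (h : Followed E (netOf s) (flowOf s) 0 (fun _ => []) (flowOf s)) :
    ∃ z r, Followed E (netOf s) (flowOf s) n z r ∧ HoldsActions (writePaths.run s) z := by
  have hz : HoldsActions s fun _ : Fin n => ([] : ActionPath (Fin l) (Fin m)) :=
    ⟨hlen, fun _ _ hk => absurd hk (Nat.not_lt_zero _)⟩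
  have hrun := run_count (x := AGENT) (e := drivers)
    (c := ite (.nle (residual (var AGENT) 1) 0) follow skip) (N := n)
    (fun k s' => ∃ z, Followed E (netOf s) (flowOf s) k z (flowOf s') ∧ HoldsActions s' z)
    (by simp [hE.drivers]) (fun _ _ _ ⟨z', h', hz'⟩ => ⟨z', h', hz'.congr rfl rfl⟩) ⟨_, h, hz⟩
    fun k hk s' hcount hs hI => ?_
  · obtain ⟨z, h', hz'⟩ := hrun
    exact ⟨z, _, h', hz'⟩
  · obtain ⟨z, h', hz'⟩ := hI
    have htest : (Test.nle (residual (var AGENT) 1) 0).Holds s' ↔ flowOf s k = 0 := by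
      rw [← h'.decomposes.emptyPath k hk]
      simp [hcount, flowOf]
    rw [run, htest]
    lift k to Fin n using hk
    split_ifs with hi
    · have h₁ := h'.following hi
      rw [← netOf_frame hs] at hG h₁
      obtain ⟨z', v, h₂, hz₂, hv⟩ := exists_following_follow (hE.of_frame hs) hG
        (demand_nonneg E _ _) hcount h₁ hz'
      rw [netOf_frame hs] at h₂
      exact ⟨z', h'.succ hi h₂ hv, hz₂⟩
    · exact ⟨z, h'.skip hi, hz'⟩

end Follow

/-! ### Optimality and running time -/

section Optimality

open Economy

variable {E : Economy (Fin l) (Fin n) (Fin m)} {s s' : Store} {G : Net} {e k : ℕ}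
  {f r : ℕ → ℕ} {R : Row} {v : Node} {i : Fin n} {j : Fin m}
  {z : Fin n → ActionPath (Fin l) (Fin m)}

lemma Represents.net_eq_net_tripFlow_add (hG : Represents E G) (f : ℕ → ℕ) (hv : v ≠ G.sink) :
    G.net f v =
      G.net (tripFlow n f) v + ∑ i : Fin n, (f i : ℤ) * if source E i = v then 1 else 0 := by
  obtain ⟨k, hk⟩ : ∃ k, G.M = n + k := ⟨_, hG.M_eq_add.trans (Nat.add_assoc _ _ _)⟩
  have hempty : ∀ i : Fin n, ((if G.node i 0 = v then 1 else 0) - if G.node i 1 = v then 1 else 0) =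
      if source E i = v then (1 : ℤ) else 0 := fun i => by
    rw [(hG.emptyPath i).tail, if_neg (c := G.node i 1 = v), sub_zero]
    · rfl
    · rintro rfl
      exact hv ((hG.emptyPath i).head.trans hG.sink_eq.symm)
  simp only [Net.net, hk, Finset.sum_range_add]
  rw [add_comm]
  refine congrArg₂ (· + ·) ?_ ?_
  · rw [Finset.sum_eq_zero (s := Finset.range n), zero_add]
    · refine Finset.sum_congr rfl fun e _ => ?_
      rw [tripFlow, if_neg (Nat.le_add_right n e).not_gt]
    · intro e he
      simp [tripFlow, Finset.mem_range.1 he]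
  · rw [Finset.sum_range]
    exact Finset.sum_congr rfl fun i _ => by rw [hempty]

namespace Routed

lemma residual_add (h : Routed E k s) (he : e < n + m) :
    s.nat RESIDUAL e 0 0 + flowOf s e = 1 := by
  have hM := h.rep.M_eq_add
  refine (h.caps e (by omega)).2 ?_
  rcases Nat.lt_or_ge e n with hlt | hge
  · exact (h.rep.emptyPath ⟨e, hlt⟩).dec
  · obtain ⟨j, rfl⟩ := Nat.exists_eq_add_of_le hge
    exact (h.rep.rider ⟨j, by omega⟩).dec

lemma net_tripFlow (h : Routed E n s) (hv : v ≠ (netOf s).sink) :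
    (netOf s).net (tripFlow n (flowOf s)) v = demand E (flowOf s) 0 v := by
  have hsplit := h.rep.net_eq_net_tripFlow_add (flowOf s) hv
  rw [show (netOf s).net (flowOf s) v = _ from h.flow v hv, ← sub_eq_iff_eq_add] at hsplit
  rw [← hsplit, demand, Finset.sum_filter, Finset.sum_filter, ← Finset.sum_sub_distrib]
  refine Finset.sum_congr rfl fun i _ => ?_
  have hadd := h.residual_add (i.2.trans_le (Nat.le_add_right n m))
  obtain hi | hi : flowOf s i = 0 ∨ flowOf s i = 1 := by omega
  all_goals simp [hi]

lemma le_of_residual (h : Routed E k s) (hR : IsRow (netOf s) e R) (he : e < (netOf s).M)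
    (hres : 1 ≤ s.nat RESIDUAL e 0 0) :
    R.gain + nodeVal (s.real POTENTIAL) R.head ≤ nodeVal (s.real POTENTIAL) R.tail := by
  have := h.valid e he 0 (by omega) hres
  rwa [hR.gain, hR.tail, hR.head] at this

lemma le_of_flow (h : Routed E k s) (hR : IsRow (netOf s) e R) (he : e < (netOf s).M)
    (hflow : 1 ≤ flowOf s e) :
    nodeVal (s.real POTENTIAL) R.tail ≤ R.gain + nodeVal (s.real POTENTIAL) R.head := by
  have := h.valid e he 1 (by omega) hflow
  rw [hR.gain_one, hR.tail, hR.head] at this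
  linarith

lemma potential_sink (h : Routed E k s) : nodeVal (s.real POTENTIAL) (0, E.T + 1) = 0 := by
  rw [← h.rep.sink_eq]
  exact h.sink

lemma price_nonneg (h : Routed E k s) {q : Trip (Fin l)} (hq : q ∈ E.trips) :
    0 ≤ E.potentialPrice (potential s) q := by
  obtain ⟨e, he, -, hR⟩ := h.rep.relocation hq
  have := h.le_of_residual hR he ((h.caps e he).1 hR.dec)
  simp only [relocationRow, nodeVal] at this
  simp only [potentialPrice, potential]
  linarith

lemma price_nonpos (h : Routed E k s) {q : Trip (Fin l)}
    (hq : ∃ e < (netOf s).M, 1 ≤ flowOf s e ∧ IsRow (netOf s) e (relocationRow E q)) :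
    E.potentialPrice (potential s) q ≤ 0 := by
  obtain ⟨e, he, hflow, hR⟩ := hq
  have := h.le_of_flow hR he hflow
  simp only [relocationRow, nodeVal] at this
  simp only [potentialPrice, potential]
  linarith

lemma exit_le (h : Routed E k s) (a : Fin l) {t : ℕ} (ht : t ≤ E.T) :
    -E.exitCost (E.T - t) ≤ potential s a t := by
  obtain ⟨e, he, -, hR⟩ := h.rep.exit a ht
  have := h.le_of_residual hR he ((h.caps e he).1 hR.dec)
  rwa [exitRow, h.potential_sink, add_zero] at this

lemma le_exit (h : Routed E k s) {w : ActionPath (Fin l) (Fin m)}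
    (hw : Exits E (netOf s) (flowOf s) i w) :
    potential s (endLoc (E.entryLoc i) (w.map Prod.fst))
      (E.endTime (E.entryTime i) (w.map Prod.fst)) ≤
        -E.exitCost (E.T - E.endTime (E.entryTime i) (w.map Prod.fst)) := by
  obtain ⟨e, he, hflow, hR⟩ := hw
  have := h.le_of_flow hR he hflow
  rwa [exitRow, h.potential_sink, add_zero] at this

lemma value_le_price (h : Routed E k s) (hj : flowOf s (n + j) = 0) :
    E.value j ≤ E.potentialPrice (potential s) (E.request j) := by
  have hM := h.rep.M_eq_add
  have hadd := h.residual_add (Nat.add_lt_add_left j.2 n)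
  have := h.le_of_residual (h.rep.rider j) (by omega) (by omega)
  simp only [riderRow, nodeVal] at this
  simp only [potentialPrice, potential]
  linarith

lemma price_le_value (h : Routed E k s) (hj : 1 ≤ flowOf s (n + j)) :
    E.potentialPrice (potential s) (E.request j) ≤ E.value j := by
  have hM := h.rep.M_eq_add
  have := h.le_of_flow (h.rep.rider j) (by omega) hj
  simp only [riderRow, nodeVal] at this
  simp only [potentialPrice, potential]
  linarith

lemma emptyPath_le (h : Routed E k s) (hi : flowOf s i = 0) :
    -E.pathCost i [] ≤ potential s (E.entryLoc i) (E.entryTime i) := by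
  have hM := h.rep.M_eq_add
  have hadd := h.residual_add (i.2.trans_le (Nat.le_add_right n m))
  have := h.le_of_residual (h.rep.emptyPath i) (by omega) (by omega)
  rwa [emptyPathRow, h.potential_sink, add_zero] at this

lemma le_emptyPath (h : Routed E k s) (hi : flowOf s i ≠ 0) :
    potential s (E.entryLoc i) (E.entryTime i) ≤ -E.pathCost i [] := by
  have hM := h.rep.M_eq_add
  have := h.le_of_flow (h.rep.emptyPath i) (by omega) (Nat.one_le_iff_ne_zero.2 hi)
  rwa [emptyPathRow, h.potential_sink, add_zero] at this

lemma followed_zero (h : Routed E n s) :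
    Followed E (netOf s) (flowOf s) 0 (fun _ => []) (flowOf s) where
  decomposes :=
    { le := fun _ => le_rfl
      emptyPath := fun _ _ => rfl
      feasible := fun _ => ⟨trivial, by simp⟩
      relocation := by simp
      rider := by simp [carried] }
  eq_nil _ _ := rfl
  exits _ hi := absurd hi (Nat.not_lt_zero _)
  flow _ hw := h.net_tripFlow hw

end Routed

/-- The dispatch with action paths `z` that picks up the riders whose arcs have flow. -/
def dispatchOf (s : Store) (z : Fin n → ActionPath (Fin l) (Fin m)) :
    Dispatch (Fin l) (Fin n) (Fin m) := ⟨fun j => flowOf s (n + j), z⟩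

lemma Followed.eq_sum_count (h : Followed E G f n z r) (hG : Represents E G) (j : Fin m) :
    f (n + j) = ∑ i, (carried (z i)).count j := by
  have hM := hG.M_eq_add
  have hzero : tripFlow n r (n + j) = 0 := hG.proper.eq_zero_of_net_eq_zero
    (fun v hv => (h.flow v hv).trans (demand_eq_zero E f v)) (by omega)
  rw [tripFlow, if_neg (by omega)] at hzero
  rw [h.decomposes.rider j, hzero, zero_add]

open Classical in
lemma Followed.isFeasible (h : Followed E (netOf s) (flowOf s) n z r) (hs : Routed E k s) :
    E.IsFeasible (dispatchOf s z) := by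
  refine ⟨h.decomposes.feasible, fun j => ⟨?_, ?_⟩⟩
  · refine (h.eq_sum_count hs.rep j).trans (Finset.sum_congr rfl fun i _ => ?_)
    rw [(nodup_carried (h.decomposes.feasible i)).count]
    exact if_congr (picksUp_iff_mem_carried (h.decomposes.feasible i)).symm rfl rfl
  · have := hs.residual_add (Nat.add_lt_add_left j.2 n)
    simp only [dispatchOf]
    omega

lemma Followed.supports (h : Followed E (netOf s) (flowOf s) n z r) (hs : Routed E k s) :
    E.Supports (potential s) (dispatchOf s z) where
  price_nonneg _ hq := hs.price_nonneg hq
  exit_le a _ ht := hs.exit_le a ht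
  value_le_price _ hj := hs.value_le_price hj
  price_le_value _ hj := hs.price_le_value hj.ge
  relocation i q hq := hs.price_nonpos (h.decomposes.relocation i q hq)
  le_of_eq_nil i hi := by
    by_cases hf : flowOf s i = 0
    · have := hs.le_exit (h.exits i i.2 hf)
      rw [show z i = [] from hi] at this
      exact this.trans (neg_le_neg (E.pathCost_nil_le i))
    · exact hs.le_emptyPath hf
  le_of_ne_nil i hi := hs.emptyPath_le (by_contra fun hf => hi (h.eq_nil i (.inr hf)))
  exit_eq i hi := le_antisymm
    (hs.le_exit (h.exits i i.2 (by_contra fun hf => hi (h.eq_nil i (.inr hf)))))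
    (hs.exit_le _ (IsPathFrom.endTime_le (h.decomposes.feasible i).1 (E.entryTime_le i)))

theorem exists_isCE_of_routed (h : Routed E n s) (hlen : ∀ i : Fin n, s.nat 5 i 0 0 = 0) :
    ∃ d p, HoldsPlan E ((writePrices ;; writePickUps ;; writePaths).run s) d p ∧ E.IsCE d p := by
  have hs := frame_run (writePrices ;; writePickUps) s
  obtain ⟨z, r, hfol, hz⟩ := exists_followed_writePaths (h.input.of_frame hs)
    (by rw [netOf_frame hs]; exact h.rep)
    (by rw [hs.nat 5 (by decide)]; exact hlen)
    (by rw [netOf_frame hs, flowOf_frame hs]; exact h.followed_zero)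
  rw [netOf_frame hs, flowOf_frame hs] at hfol
  refine ⟨dispatchOf s z, E.potentialPrice (potential s),
    ⟨fun j => ?_, hz.len, hz.row, fun q hq => ?_⟩, (hfol.supports h).isCE (hfol.isFeasible h)⟩
  · have hprices := frame_run writePrices s
    change (writePaths.run (writePickUps.run (writePrices.run s))).nat 4 j 0 0 = _
    rw [(frame_run writePaths _).nat 4 (by decide), nat_writePickUps (h.input.of_frame hprices),
      hprices.nat RESIDUAL (by decide)]
    rfl
  · have hpaths := frame_run (writePickUps ;; writePaths) (writePrices.run s)
    exact (congrFun₃ (hpaths.real 3 (by decide)) _ _ _).trans (real_writePrices h.input hq)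

end Optimality

section Program

variable {E : Economy (Fin l) (Fin n) (Fin m)} {s : Store}

/-- The program that computes an equilibrium. -/
def program : Program := .seq setup.compile solve.compile

open Polynomial in
/-- A bound for the number of iterations of each loop of `solve`. -/
noncomputable def loopBound : ℕ[X] := X + (X * (X + 1) + X * (X * (X + 1))) + X + 3

open Polynomial in
/-- A bound for the running time of `program`. -/
noncomputable def runningTime : ℕ[X] := setup.time.comp (X + 2) + solve.time.comp loopBound

lemma eval_le_of_mem_bounds_setup (hE : Input E s) :
    ∀ e ∈ setup.bounds, e.eval s ≤ l + n + m + E.T + 2 := by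
  change ∀ e ∈ [drivers, riders, locs, horizon + 1, locs, locs, horizon + 1, riders, horizon + 1,
    locs, horizon + 1], _
  simp only [List.forall_mem_cons, eval_add, eval_cell, eval_zero, eval_one, eval_two,
    eval_three, hE.locs, hE.drivers, hE.riders, hE.horizon,
    List.not_mem_nil, false_imp_iff, implies_true, and_true]
  omega

lemma eval_le_of_mem_bounds_solve (hE : Input E s) :
    ∀ e ∈ solve.bounds, e.eval s ≤ s.nat ARCS 0 0 0 + (l + n + m + E.T) + 3 := by
  change ∀ e ∈ [drivers, locs, horizon + 2, var ARCS, var ARCS, locs, horizon + 2, var ARCS + 1,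
    locs, locs, horizon + 1, riders, drivers, horizon + 1, var ARCS], _
  simp only [List.forall_mem_cons, eval_cell, eval_zero, eval_one, eval_two, eval_three, eval_add,
    eval_const, hE.locs, hE.drivers, hE.riders, hE.horizon, List.not_mem_nil, false_imp_iff,
    implies_true, and_true]
  omega

lemma SetUp.le_loopBound (h : SetUp E s) :
    s.nat ARCS 0 0 0 + (l + n + m + E.T) + 3 ≤ loopBound.eval (l + n + m + E.T) := by
  have hM : s.nat ARCS 0 0 0 ≤ n + m + (l * (E.T + 1) + l * (l * (E.T + 1))) :=
    h.rep.M_eq.trans_le (length_rows_le E)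
  generalize hN : l + n + m + E.T = N
  have hexits : l * (E.T + 1) ≤ N * (N + 1) := Nat.mul_le_mul (by omega) (by omega)
  have hrelocations : l * (l * (E.T + 1)) ≤ N * (N * (N + 1)) := Nat.mul_le_mul (by omega) hexits
  simp only [loopBound, Polynomial.eval_add, Polynomial.eval_mul, Polynomial.eval_X,
    Polynomial.eval_one, Polynomial.eval_ofNat]
  omega

theorem exists_exec_program (E : Economy (Fin l) (Fin n) (Fin m)) :
    ∃ (t : ℕ) (s : Store), Exec program (inputStore E) t s ∧
      t ≤ runningTime.eval (l + n + m + E.T) ∧ ∃ d p, HoldsPlan E s d p ∧ E.IsCE d p := by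
  have hsetup := setUp_setup E
  obtain ⟨t₁, ht₁, hx₁⟩ := exec_compile wellFormed_setup
    (eval_le_of_mem_bounds_setup (Input.inputStore E))
  obtain ⟨t₂, ht₂, hx₂⟩ := exec_compile wellFormed_solve
    fun e he => (eval_le_of_mem_bounds_solve hsetup.input e he).trans hsetup.le_loopBound
  refine ⟨t₁ + t₂, _, hx₁.seq hx₂, ?_, exists_isCE_of_routed (routed_route hsetup) ?_⟩
  · simp only [runningTime, Polynomial.eval_add, Polynomial.eval_comp, Polynomial.eval_X,
      Polynomial.eval_ofNat]
    exact Nat.add_le_add ht₁ ht₂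
  · rw [(frame_run route _).nat 5 (by decide)]
    exact fun i => hsetup.len i

end Program

end Algorithm

/-! ### Renaming locations, drivers and riders -/

section Reindex

variable {Loc Drv Rdr Loc' Drv' Rdr' : Type*}

/-- The correspondence of trips induced by a correspondence of locations. -/
@[simps]
def Trip.congr (a : Loc ≃ Loc') : Trip Loc ≃ Trip Loc' where
  toFun r := ⟨a r.orig, a r.dest, r.start⟩
  invFun r := ⟨a.symm r.orig, a.symm r.dest, r.start⟩
  left_inv r := by simp
  right_inv r := by simp

/-- The correspondence of action paths induced by correspondences of locations and riders. -/
def actionPathCongr (a : Loc ≃ Loc') (c : Rdr ≃ Rdr') :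
    ActionPath Loc Rdr ≃ ActionPath Loc' Rdr' :=
  Equiv.listEquivOfEquiv ((Trip.congr a).prodCongr c.optionCongr)

/-- The dispatch with renamed locations, drivers and riders. -/
def Dispatch.reindex (d : Dispatch Loc Drv Rdr) (a : Loc ≃ Loc') (b : Drv ≃ Drv')
    (c : Rdr ≃ Rdr') : Dispatch Loc' Drv' Rdr' :=
  ⟨fun j => d.x (c.symm j), fun i => actionPathCongr a c (d.z (b.symm i))⟩

lemma Dispatch.reindex_surjective (a : Loc ≃ Loc') (b : Drv ≃ Drv') (c : Rdr ≃ Rdr') :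
    Function.Surjective fun d : Dispatch Loc Drv Rdr => d.reindex a b c := fun d =>
  ⟨⟨fun j => d.x (c j), fun i => (actionPathCongr a c).symm (d.z (b i))⟩, by simp [reindex]⟩

namespace Economy

/-- The economy with renamed locations, drivers and riders. -/
def reindex (E : Economy Loc Drv Rdr) (a : Loc ≃ Loc') (b : Drv ≃ Drv') (c : Rdr ≃ Rdr') :
    Economy Loc' Drv' Rdr' where
  T := E.T
  dist x y := E.dist (a.symm x) (a.symm y)
  dist_pos x y := E.dist_pos _ _
  dist_self x := E.dist_self _
  tripCost r := E.tripCost ((Trip.congr a).symm r)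
  tripCost_nonneg r hr := E.tripCost_nonneg _ hr
  exitCost := E.exitCost
  exitCost_nonneg := E.exitCost_nonneg
  exitCost_zero := E.exitCost_zero
  entered i := E.entered (b.symm i)
  entryLoc i := a (E.entryLoc (b.symm i))
  entryTime i := E.entryTime (b.symm i)
  exitTime i := E.exitTime (b.symm i)
  entryTime_lt_exitTime i := E.entryTime_lt_exitTime _
  entryTime_le i := E.entryTime_le _
  le_exitTime i := E.le_exitTime _
  request j := Trip.congr a (E.request (c.symm j))
  request_mem j := by simpa using E.request_mem (c.symm j)
  value j := E.value (c.symm j)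
  value_nonneg j := E.value_nonneg _

variable {E : Economy Loc Drv Rdr} {a : Loc ≃ Loc'} {b : Drv ≃ Drv'} {c : Rdr ≃ Rdr'}

lemma arrival_reindex (r : Trip Loc) :
    (E.reindex a b c).arrival (Trip.congr a r) = E.arrival r := by
  simp [arrival, reindex]

lemma mem_trips_reindex {r : Trip Loc} :
    Trip.congr a r ∈ (E.reindex a b c).trips ↔ r ∈ E.trips := by
  rw [trips, Set.mem_ofPred_eq, arrival_reindex]
  rfl

lemma isPathFrom_reindex {x : Loc} {t : ℕ} {P : List (Trip Loc)} :
    (E.reindex a b c).IsPathFrom (a x) t (P.map (Trip.congr a)) ↔ E.IsPathFrom x t P := by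
  induction P generalizing x t with
  | nil => exact Iff.rfl
  | cons r P ih =>
    simp only [List.map_cons, IsPathFrom, mem_trips_reindex, arrival_reindex]
    rw [Trip.congr_apply_dest, ih]
    simp

lemma endTime_reindex (t : ℕ) (P : List (Trip Loc)) :
    (E.reindex a b c).endTime t (P.map (Trip.congr a)) = E.endTime t P := by
  induction P generalizing t with
  | nil => rfl
  | cons r P ih => simp only [List.map_cons, endTime, arrival_reindex, ih]

lemma mem_paths_reindex {i : Drv} {P : List (Trip Loc)} :
    P.map (Trip.congr a) ∈ (E.reindex a b c).paths (b i) ↔ P ∈ E.paths i := by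
  simp only [paths, Set.mem_ofPred_eq]
  rw [← isPathFrom_reindex (a := a) (b := b) (c := c)]
  simp [reindex]

lemma paths_reindex (i : Drv) :
    (E.reindex a b c).paths (b i) = List.map (Trip.congr a) '' E.paths i := by
  refine Set.ext fun P => ⟨fun hP => ?_, ?_⟩
  · obtain ⟨P, rfl⟩ := (Equiv.listEquivOfEquiv (Trip.congr a)).surjective P
    exact ⟨P, mem_paths_reindex.1 hP, rfl⟩
  · rintro ⟨P, hP, rfl⟩
    exact mem_paths_reindex.2 hP

lemma pathCost_reindex (i : Drv) (P : List (Trip Loc)) :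
    (E.reindex a b c).pathCost (b i) (P.map (Trip.congr a)) = E.pathCost i P := by
  have hcost : (P.map (Trip.congr a)).map (E.reindex a b c).tripCost = P.map E.tripCost := by
    rw [List.map_map]
    exact List.map_congr_left fun r _ => by simp [reindex]
  have htime : (E.reindex a b c).entryTime (b i) = E.entryTime i := by simp [reindex]
  simp only [pathCost, hcost, htime, endTime_reindex]
  simp [reindex]

lemma mem_actionPathCongr {w : ActionPath Loc Rdr} {r : Trip Loc} {j : Rdr} :
    (Trip.congr a r, some (c j)) ∈ actionPathCongr a c w ↔ (r, some j) ∈ w :=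
  List.mem_map_of_injective (a := (r, some j))
    ((Trip.congr a).prodCongr c.optionCongr).injective

lemma map_fst_actionPathCongr (w : ActionPath Loc Rdr) :
    (actionPathCongr a c w).map Prod.fst = (w.map Prod.fst).map (Trip.congr a) := by
  simp [actionPathCongr, Equiv.listEquivOfEquiv, Function.comp_def]

lemma request_reindex (j : Rdr) :
    (E.reindex a b c).request (c j) = Trip.congr a (E.request j) := by
  simp [reindex]

lemma mem_actionPaths_reindex {i : Drv} {w : ActionPath Loc Rdr} :
    actionPathCongr a c w ∈ (E.reindex a b c).actionPaths (b i) ↔ w ∈ E.actionPaths i := by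
  simp only [actionPaths, Set.mem_ofPred_eq, map_fst_actionPathCongr, mem_paths_reindex,
    ← (Trip.congr a).forall_congr_right, ← c.forall_congr_right (q := fun _ => _ → _ = _),
    mem_actionPathCongr, request_reindex, EmbeddingLike.apply_eq_iff_eq]

lemma picksUp_reindex {w : ActionPath Loc Rdr} {j : Rdr} :
    (E.reindex a b c).PicksUp (actionPathCongr a c w) (c j) ↔ E.PicksUp w j := by
  rw [PicksUp, request_reindex, mem_actionPathCongr]
  rfl

lemma revenue_actionPathCongr (p : Trip Loc' → ℝ) (w : ActionPath Loc Rdr) :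
    revenue p (actionPathCongr a c w) = revenue (p ∘ Trip.congr a) w := by
  simp [revenue, actionPathCongr, Equiv.listEquivOfEquiv, Function.comp_def]

variable [Fintype Drv] [Fintype Drv'] {d : Dispatch Loc Drv Rdr}

lemma isFeasible_reindex :
    (E.reindex a b c).IsFeasible (d.reindex a b c) ↔ E.IsFeasible d := by
  classical
  simp only [IsFeasible, ← b.forall_congr_right (q := fun _ => _ ∈ _),
    ← c.forall_congr_right (q := fun _ => _ ∧ _), ← b.sum_comp, Dispatch.reindex,
    Equiv.symm_apply_apply, mem_actionPaths_reindex, picksUp_reindex]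

lemma isCE_reindex [Fintype Rdr] [Fintype Rdr'] {p : Trip Loc' → ℝ} :
    (E.reindex a b c).IsCE (d.reindex a b c) p ↔ E.IsCE d (p ∘ Trip.congr a) := by
  rw [IsCE, IsCE, isFeasible_reindex]
  refine and_congr_right fun hd => ?_
  have hutility : ∀ i, (E.reindex a b c).driverUtility
      ((E.reindex a b c).priced (d.reindex a b c) p) (b i) =
        E.driverUtility (E.priced d (p ∘ Trip.congr a)) i := fun i => by
    rw [hd.driverUtility_priced, (isFeasible_reindex.2 hd).driverUtility_priced]
    simp only [driverCost, Dispatch.reindex, Equiv.symm_apply_apply, revenue_actionPathCongr,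
      map_fst_actionPathCongr, pathCost_reindex]
  refine and_congr ?_ ?_
  · simp only [← c.forall_congr_right (q := fun _ => _ ∧ _), request_reindex, Function.comp_apply]
    simp [reindex, Dispatch.reindex]
  · rw [← b.forall_congr_right]
    simp only [hutility, paths_reindex, Set.image_image, pathCost_reindex,
      List.map_map]
    rfl

lemma exists_isCE [Finite Loc] [Fintype Rdr] (E : Economy Loc Drv Rdr) : ∃ d p, E.IsCE d p := by
  obtain ⟨_, _, _, _, d, p, _, h⟩ := Algorithm.exists_exec_program
    (E.reindex (Finite.equivFin Loc) (Fintype.equivFin Drv) (Fintype.equivFin Rdr))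
  obtain ⟨d, rfl⟩ := Dispatch.reindex_surjective (Finite.equivFin Loc) (Fintype.equivFin Drv)
    (Fintype.equivFin Rdr) d
  exact ⟨d, _, isCE_reindex.1 h⟩

end Economy

end Reindex

end Rideshare

theorem lemma3 :
    (∀ (Loc Drv Rdr : Type*) [Finite Loc] [Fintype Drv] [Fintype Rdr]
      (E : Rideshare.Economy Loc Drv Rdr),
      -- a dispatch is welfare-optimal iff some anonymous trip prices make it an equilibrium
      (∀ d, E.IsWelfareOptimal d ↔ ∃ p, E.IsCE d p) ∧
      -- optimal equilibrium plans exist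
      (∃ d p, E.IsWelfareOptimal d ∧ E.IsCE d p) ∧
      -- properties of all these plans
      (∀ d p, E.IsCE d p →
        E.StrictBudgetBalance (E.priced d p) ∧
        E.RiderIR (E.priced d p) ∧ E.DriverIR (E.priced d p) ∧
        E.RiderEnvyFree (E.priced d p) ∧ E.DriverEnvyFree (E.priced d p))) ∧
    -- one program computes an optimal equilibrium plan of every economy in polynomial time
    (∃ (c : Rideshare.Program) (B : Polynomial ℕ),
      ∀ (l n m : ℕ) (E : Rideshare.Economy (Fin l) (Fin n) (Fin m)),
        ∃ (steps : ℕ) (s : Rideshare.Store),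
          Rideshare.Exec c (Rideshare.inputStore E) steps s ∧
          steps ≤ B.eval (l + n + m + E.T) ∧
          ∃ d p, Rideshare.HoldsPlan E s d p ∧ E.IsWelfareOptimal d ∧ E.IsCE d p) := by
  refine ⟨fun Loc Drv Rdr _ _ _ E => ?_,
    Rideshare.Algorithm.program, Rideshare.Algorithm.runningTime, fun l n m E => ?_⟩
  · obtain ⟨d₀, p₀, h₀⟩ := E.exists_isCE
    exact ⟨fun d => ⟨fun hd => ⟨p₀, h₀.of_isWelfareOptimal hd⟩, fun ⟨_, hp⟩ => hp.isWelfareOptimal⟩,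
      ⟨d₀, p₀, h₀.isWelfareOptimal, h₀⟩, fun d p h => ⟨h.strictBudgetBalance, h.riderIR, h.driverIR,
        h.riderEnvyFree, h.driverEnvyFree⟩⟩
  · obtain ⟨t, s, h1, h2, d, p, h3, h4⟩ := Rideshare.Algorithm.exists_exec_program E
    exact ⟨t, s, h1, h2, d, p, h3, h4.isWelfareOptimal, h4⟩
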